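/- Let $r\ge 1$, let $M_r$ be the algebra of complex $r\times r$ matrices and $\mathfrak Q:=L_2((0,1),M_r)$. For $q\in\mathfrak Q$ put $$\vartheta:=\frac1i\begin{pmatrix}I&0\\0&-I\end{pmatrix},\qquad \boldsymbol q:=\begin{pmatrix}0&q\\q^*&0\end{pmatrix},$$ and let $T_q$ be the Dirac operator $T_qy=\vartheta y'+\boldsymbol q y$ with domain consisting of all $y=(y_1,y_2)^\top$, $y_1,y_2\in W_2^1((0,1),\mathbb C^r)$, such that $y_1(0)=y_2(0)$ and $y_1(1)=y_2(1)$. For $\lambda\in\mathbb C$ let $u_q(\cdot,\lambda)\in W_2^1((0,1),M_{2r})$ be the solution of $\vartheta u'+\boldsymbol q u=\lambda u$, $u(0)=I_{2r}$; put $a:=\frac1{\sqrt2}\begin{pmatrix}I&-I\end{pmatrix}$, $s(\lambda,q):=a\,u_q(1,\lambda)\vartheta a^*$, $c(\lambda,q):=a\,u_q(1,\lambda)a^*$, and let $m_q(\lambda):=-s(\lambda,q)^{-1}c(\lambda,q)$ be the Weyl--Titchmarsh function of $T_q$. The spectral data of $T_q$ is the sequence $\mathfrak a_q=((\lambda_j(q),\alpha_j(q)))_{j\in\mathbb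 Z}$, where $(\lambda_j(q))_{j\in\mathbb Z}$ are the pairwise distinct eigenvalues of $T_q$, all of which are real, labelled in increasing order so that $\lambda_0(q)\le 0<\lambda_1(q)$, and $\alpha_j(q):=-\operatorname{res}_{\lambda=\lambda_j(q)}m_q(\lambda)$ are the norming matrices. Let $\mathfrak A:=\{\mathfrak a_q\mid q\in\mathfrak Q\}$ be the class of spectral data. **Theorem 2.** Every $q\in\mathfrak Q$ has exactly one spectral data sequence $\mathfrak a_q$, and the mapping $\mathfrak Q\ni q\mapsto\mathfrak a_q\in\mathfrak A$ is bijective. In particular, the eigenvalues and the norming matrices determine the potential $q$ uniquely. -/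

import Mathlib

open MeasureTheory Filter Topology Set
open scoped Matrix Matrix.Norms.L2Operator

noncomputable section

namespace DiracInverse

/-- Lebesgue measure on the interval `(0,1)`. -/
abbrev unitMeasure : Measure ℝ := volume.restrict (Ioo (0 : ℝ) 1)

/-- The space `L₂((0,1), M_r)` of potentials (classes of functions modulo a.e. equality); matrices
carry the operator norm on the Euclidean space `ℂ^r`. -/
abbrev Potential (r : ℕ) : Type := Lp (Matrix (Fin r) (Fin r) ℂ) 2 unitMeasure

/-- `y` restricted to `[0,1]` is (the continuous representative of) a function of the Sobolev class
`W₂¹((0,1), E)`, and `y'` is its derivative: `y' ∈ L₂((0,1), E)` and `y` is a primitive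
of `y'` on `[0,1]`. Values outside `[0,1]` play no role. -/
def HasSobolevDeriv {E : Type*} [NormedAddCommGroup E] [NormedSpace ℝ E] (y y' : ℝ → E) : Prop :=
  MemLp y' 2 unitMeasure ∧ ∀ x ∈ Icc (0 : ℝ) 1, y x = y 0 + ∫ t in (0 : ℝ)..x, y' t

/-- The `2r × 2r` matrix `ϑ = (1/i) diag(I, -I)`. -/
def theta (r : ℕ) : Matrix (Fin r ⊕ Fin r) (Fin r ⊕ Fin r) ℂ :=
  (1 / Complex.I) • Matrix.fromBlocks 1 0 0 (-1)

/-- The `2r × 2r` matrix-valued function with zero diagonal blocks and off-diagonal blocks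
`q` (upper right) and `q*` (lower left). -/
def blockPotential {r : ℕ} (q : Potential r) (x : ℝ) :
    Matrix (Fin r ⊕ Fin r) (Fin r ⊕ Fin r) ℂ :=
  Matrix.fromBlocks 0 (q x) (q x)ᴴ 0

/-- The graph of the Dirac operator `T_q`: the function `y = (y₁, y₂)` belongs to the domain of
`T_q`, that is, `y₁, y₂ ∈ W₂¹((0,1), ℂ^r)`, `y₁(0) = y₂(0)`, `y₁(1) = y₂(1)`, and
`T_q y = ϑ y' + (0, q; q*, 0) y` equals `f` almost everywhere on `(0,1)`. -/
def DiracGraph {r : ℕ} (q : Potential r) (y f : ℝ → Fin r ⊕ Fin r → ℂ) : Prop :=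
  (∀ k : Fin r, y 0 (Sum.inl k) = y 0 (Sum.inr k)) ∧
  (∀ k : Fin r, y 1 (Sum.inl k) = y 1 (Sum.inr k)) ∧
  ∃ y' : ℝ → Fin r ⊕ Fin r → ℂ, HasSobolevDeriv y y' ∧
    ∀ᵐ x ∂unitMeasure, theta r *ᵥ y' x + blockPotential q x *ᵥ y x = f x

/-- The complex number `z` is an eigenvalue of `T_q`. -/
def IsEigenvalue {r : ℕ} (q : Potential r) (z : ℂ) : Prop :=
  ∃ y : ℝ → Fin r ⊕ Fin r → ℂ, DiracGraph q y (fun x => z • y x) ∧ ∃ x ∈ Icc (0 : ℝ) 1, y x ≠ 0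

/-- `u` solves the Cauchy problem `ϑ u' + (0, q; q*, 0) u = z u`, `u(0) = I`, in
`W₂¹((0,1), M_{2r})`. -/
def IsCauchySolution {r : ℕ} (q : Potential r) (z : ℂ)
    (u : ℝ → Matrix (Fin r ⊕ Fin r) (Fin r ⊕ Fin r) ℂ) : Prop :=
  u 0 = 1 ∧ ∃ u' : ℝ → Matrix (Fin r ⊕ Fin r) (Fin r ⊕ Fin r) ℂ, HasSobolevDeriv u u' ∧
    ∀ᵐ x ∂unitMeasure, theta r * u' x + blockPotential q x * u x = z • u x

/-- The solution `u_q(x, z)` of the Cauchy problem (its values on `[0,1]` are unique). -/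
def cauchySolution {r : ℕ} (q : Potential r) (z : ℂ) :
    ℝ → Matrix (Fin r ⊕ Fin r) (Fin r ⊕ Fin r) ℂ :=
  Classical.epsilon (IsCauchySolution q z)

/-- The `r × 2r` matrix `a = (1/√2) (I, -I)` of the boundary conditions. -/
def boundaryMatrix (r : ℕ) : Matrix (Fin r) (Fin r ⊕ Fin r) ℂ :=
  ((1 / Real.sqrt 2 : ℝ) : ℂ) • Matrix.fromCols 1 (-1)

/-- `s(z, q) = a φ_q(1, z)`, where `φ_q = u_q ϑ a*`. -/
def sMatrix {r : ℕ} (q : Potential r) (z : ℂ) : Matrix (Fin r) (Fin r) ℂ :=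
  boundaryMatrix r * (cauchySolution q z 1 * theta r * (boundaryMatrix r)ᴴ)

/-- `c(z, q) = a ψ_q(1, z)`, where `ψ_q = u_q a*`. -/
def cMatrix {r : ℕ} (q : Potential r) (z : ℂ) : Matrix (Fin r) (Fin r) ℂ :=
  boundaryMatrix r * (cauchySolution q z 1 * (boundaryMatrix r)ᴴ)

/-- The Weyl–Titchmarsh function `m_q(z) = - s(z, q)⁻¹ c(z, q)` of `T_q`. -/
def weylFunction {r : ℕ} (q : Potential r) (z : ℂ) : Matrix (Fin r) (Fin r) ℂ :=
  -((sMatrix q z)⁻¹ * cMatrix q z)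

/-- `A` is the residue at `z₀` of the matrix-valued function `m` (for `m` holomorphic in a punctured
neighbourhood of `z₀`): the entrywise integral of `m` over all small circles around `z₀`, divided
by `2πi`. -/
def IsResidue {r : ℕ} (m : ℂ → Matrix (Fin r) (Fin r) ℂ) (z₀ : ℂ)
    (A : Matrix (Fin r) (Fin r) ℂ) : Prop :=
  ∀ᶠ ε : ℝ in 𝓝[>] 0, ∀ k l : Fin r,
    (2 * Real.pi * Complex.I)⁻¹ * (∮ z in C(z₀, ε), m z k l) = A k l

/-- The sequence `a = ((λ_j, α_j))_{j ∈ ℤ}` is the spectral data of `T_q`: the `λ_j` are the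
pairwise distinct eigenvalues of `T_q`, labelled increasingly with `λ_0 ≤ 0 < λ_1`, and `α_j` is
the norming matrix at `λ_j`, that is, minus the residue of `m_q` at `λ_j`. -/
def IsSpectralData {r : ℕ} (q : Potential r) (a : ℤ → ℝ × Matrix (Fin r) (Fin r) ℂ) : Prop :=
  StrictMono (fun j => (a j).1) ∧
  (a 0).1 ≤ 0 ∧ 0 < (a 1).1 ∧
  {z : ℂ | IsEigenvalue q z} = Set.range (fun j : ℤ => (((a j).1 : ℝ) : ℂ)) ∧
  ∀ j : ℤ, IsResidue (weylFunction q) (((a j).1 : ℝ) : ℂ) (-(a j).2)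

/-- The map `q ↦ a_q` sending a potential to its spectral data. -/
def spectralData {r : ℕ} (q : Potential r) : ℤ → ℝ × Matrix (Fin r) (Fin r) ℂ :=
  Classical.epsilon (IsSpectralData q)

/-- The class of all spectral data of Dirac operators `T_q` with `q ∈ L₂((0,1), M_r)`. -/
def spectralDataClass (r : ℕ) : Set (ℤ → ℝ × Matrix (Fin r) (Fin r) ℂ) :=
  {a | ∃ q : Potential r, IsSpectralData q a}

end DiracInverse

end

/-! Two facts carry the theorem: every potential has spectral data, and the data determine the
potential. Both are proved through the Weyl function `m`, by Liouville-type arguments.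

Three properties of `m` are needed. Green's formula for two Weyl solutions gives `m(z) - m(w)* = (z
- w̄) ∫ Ψ_w* Ψ_z` (`weylFunction_sub`). Hence `m(z̄)* = m(z)` off the real axis. Comparing `z` with
a point high above it on the same vertical line also gives `|m(z)| ≤ K (1 + 1/|Im z|)`
(`exists_norm_weylFunction_mul_im_le`). Finally, variation of constants in exponentially weighted
norms shows that `m → i` as `Im z → +∞`, uniformly in `Re z` (`tendsto_weylFunction`). By symmetry
`m → -i` downwards.

Existence of the data. The eigenvalues are the zeros of the entire function `det s`; they are real
by self-adjointness and isolated because `det s` does not vanish identically. Were they bounded on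
one side, `m` would be holomorphic on a half-plane. The growth bound extends across the real axis
(`norm_le_of_norm_mul_im_le`), so `m` would be bounded there, and Cauchy's estimate makes such a
function nearly constant on segments of fixed length inside discs of large radius. This contradicts
the jump from `-i` to `i`. So the eigenvalues are locally finite and unbounded in both directions,
and `ℤ` labels them in exactly one normalized way.

Data determine `m`. For two potentials with the same data, each entry of the difference of the Weyl
functions has at most simple poles, by the growth bound, and all its residues vanish. It therefore
extends to a bounded entire function that tends to `0` at `+i∞`, so it is zero
(`weylFunction_eq_of_isSpectralData`).

`m` determines the potential. If `m_p = m_q`, the matrix `u_p u_q⁻¹` is entire in `z`. Multiplying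
`u_p` and `u_q` by one and the same frame of initial values, built from `m`, makes both tend to the
identity at each interior point. Hence `u_p u_q⁻¹ → 1` upwards, and downwards by symmetry. It is
bounded on strips, so it is identically `1` (`transition_eq_one`), and differentiating `u_p = u_q`
in `x` recovers the potential (`eq_of_weylFunction_eq`). -/

noncomputable section

namespace DiracInverse

variable {r : ℕ}

/-! ### Functions of the class `W₂¹` -/

section Sobolev

/-- A function whose increments are controlled by those of an absolutely continuous function is
absolutely continuous. -/
theorem absolutelyContinuousOnInterval_of_dist_le {E : Type*} [PseudoMetricSpace E] {f : ℝ → E}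
    {h : ℝ → ℝ} {a b C : ℝ} (hh : AbsolutelyContinuousOnInterval h a b)
    (hC : ∀ x ∈ uIcc a b, ∀ y ∈ uIcc a b, dist (f x) (f y) ≤ C * dist (h x) (h y)) :
    AbsolutelyContinuousOnInterval f a b := by
  rw [absolutelyContinuousOnInterval_iff] at hh ⊢
  intro ε hε
  obtain ⟨δ, hδ, H⟩ := hh (ε / (|C| + 1)) (by positivity)
  refine ⟨δ, hδ, fun I hI hsum => ?_⟩
  have h1 := H I hI hsum
  have hmem : ∀ i ∈ Finset.range I.1, (I.2 i).1 ∈ uIcc a b ∧ (I.2 i).2 ∈ uIcc a b := hI.1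
  calc ∑ i ∈ Finset.range I.1, dist (f (I.2 i).1) (f (I.2 i).2)
      ≤ ∑ i ∈ Finset.range I.1, (|C| + 1) * dist (h (I.2 i).1) (h (I.2 i).2) := by
        refine Finset.sum_le_sum fun i hi => (hC _ (hmem i hi).1 _ (hmem i hi).2).trans ?_
        exact mul_le_mul_of_nonneg_right (by linarith [le_abs_self C]) dist_nonneg
    _ = (|C| + 1) * ∑ i ∈ Finset.range I.1, dist (h (I.2 i).1) (h (I.2 i).2) := by
        rw [Finset.mul_sum]
    _ < (|C| + 1) * (ε / (|C| + 1)) := by gcongr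
    _ = ε := by field_simp

variable {E F G : Type*} [NormedAddCommGroup E] [NormedSpace ℝ E]
  [NormedAddCommGroup F] [NormedSpace ℝ F] [NormedAddCommGroup G] [NormedSpace ℝ G]

namespace HasSobolevDeriv

variable {y y' : ℝ → E}

theorem intervalIntegrable (h : HasSobolevDeriv y y') {a b : ℝ} (ha : a ∈ Icc (0 : ℝ) 1)
    (hb : b ∈ Icc (0 : ℝ) 1) : IntervalIntegrable y' volume a b := by
  have : IntervalIntegrable y' volume 0 1 := by
    rw [intervalIntegrable_iff_integrableOn_Ioo_of_le zero_le_one]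
    exact h.1.integrable (by norm_num)
  refine this.mono_set ?_
  rw [uIcc_of_le (zero_le_one : (0 : ℝ) ≤ 1)]
  exact uIcc_subset_Icc ha hb

theorem sub_eq (h : HasSobolevDeriv y y') {a b : ℝ} (ha : a ∈ Icc (0 : ℝ) 1)
    (hb : b ∈ Icc (0 : ℝ) 1) : y b - y a = ∫ t in a..b, y' t := by
  have h0 : (0 : ℝ) ∈ Icc (0 : ℝ) 1 := by simp
  rw [h.2 a ha, h.2 b hb, ← intervalIntegral.integral_interval_sub_left
    (h.intervalIntegrable h0 hb) (h.intervalIntegrable h0 ha)]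
  abel

theorem continuousOn (h : HasSobolevDeriv y y') : ContinuousOn y (Icc 0 1) := by
  have hi : IntegrableOn y' (uIcc 0 1) := by
    have := h.intervalIntegrable (a := 0) (b := 1) (by simp) (by simp)
    rwa [intervalIntegrable_iff', ] at this
  have := intervalIntegral.continuousOn_primitive_interval hi
  rw [uIcc_of_le zero_le_one] at this
  exact (continuousOn_const.add this).congr h.2

theorem congr_deriv (h : HasSobolevDeriv y y') {y'' : ℝ → E} (h2 : y' =ᵐ[unitMeasure] y'') :
    HasSobolevDeriv y y'' := by
  refine ⟨h.1.ae_eq h2, fun x hx => ?_⟩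
  rw [h.2 x hx]
  congr 1
  refine intervalIntegral.integral_congr_ae ?_
  rw [unitMeasure, Filter.EventuallyEq, ae_restrict_iff' measurableSet_Ioo] at h2
  -- `unitMeasure` lives on the open interval while the integral runs over `(0, x]`; only the
  -- endpoint `1`, a null set, has to be discarded.
  have h1 : ∀ᵐ t : ℝ, t ≠ 1 := by simp [ae_iff]
  filter_upwards [h2, h1] with t ht ht1 hmem
  rw [uIoc_of_le hx.1] at hmem
  exact ht ⟨hmem.1, lt_of_le_of_ne (hmem.2.trans hx.2) ht1⟩

theorem clm (h : HasSobolevDeriv y y') [CompleteSpace E] [CompleteSpace F] (L : E →L[ℝ] F) :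
    HasSobolevDeriv (fun x => L (y x)) (fun x => L (y' x)) := by
  refine ⟨L.comp_memLp' h.1, fun x hx => ?_⟩
  dsimp only
  rw [h.2 x hx, map_add, L.intervalIntegral_comp_comm (h.intervalIntegrable (by simp) hx)]

theorem sub {z z' : ℝ → E} (h : HasSobolevDeriv y y') (hz : HasSobolevDeriv z z') :
    HasSobolevDeriv (fun x => y x - z x) (fun x => y' x - z' x) := by
  refine ⟨h.1.sub hz.1, fun x hx => ?_⟩
  dsimp only
  rw [h.2 x hx, hz.2 x hx, intervalIntegral.integral_sub (h.intervalIntegrable (by simp) hx)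
    (hz.intervalIntegrable (by simp) hx)]
  abel

theorem of_hasDerivAt (hy : ∀ x, HasDerivAt y (y' x) x) (hc : Continuous y')
    [CompleteSpace E] : HasSobolevDeriv y y' := by
  refine ⟨?_, fun x _ => ?_⟩
  · obtain ⟨C, hC⟩ := isCompact_Icc.exists_bound_of_continuousOn
      (s := Icc (0 : ℝ) 1) hc.continuousOn
    refine MemLp.of_bound hc.aestronglyMeasurable C ?_
    filter_upwards [ae_restrict_mem measurableSet_Ioo] with x hx
    exact hC x (Ioo_subset_Icc_self hx)
  · rw [intervalIntegral.integral_eq_sub_of_hasDerivAt (fun t _ => hy t)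
      (hc.intervalIntegrable _ _)]
    abel

/-- Lebesgue's differentiation theorem for the primitive. Endpoints are excluded because `y` is tied
to `y'` only on `[0,1]`, while a two-sided derivative needs a full neighbourhood. -/
theorem ae_hasDerivAt [CompleteSpace E] (h : HasSobolevDeriv y y') :
    ∀ᵐ x : ℝ, x ∈ Ioo (0 : ℝ) 1 → HasDerivAt y (y' x) x := by
  filter_upwards [(h.intervalIntegrable (a := 0) (b := 1) (by simp)
    (by simp)).ae_hasDerivAt_integral] with x hx hmem
  have h1 := hx (by rw [uIcc_of_le zero_le_one]; exact Ioo_subset_Icc_self hmem) 0 (by simp)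
  refine (h1.const_add (y 0)).congr_of_eventuallyEq ?_
  filter_upwards [Icc_mem_nhds hmem.1 hmem.2] with t ht using h.2 t ht

theorem memLp_bilin [CompleteSpace E] {w' : ℝ → F} (h : HasSobolevDeriv y y')
    (hw : MemLp w' 2 unitMeasure) (B : E →L[ℝ] F →L[ℝ] G) :
    MemLp (fun x => B (y x) (w' x)) 2 unitMeasure := by
  obtain ⟨C, hC⟩ := isCompact_Icc.exists_bound_of_continuousOn h.continuousOn
  refine MemLp.of_le_mul (c := ‖B‖ * C) hw ?_ ?_
  · have hy : AEStronglyMeasurable y unitMeasure :=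
      (h.continuousOn.mono Ioo_subset_Icc_self).aestronglyMeasurable measurableSet_Ioo
    exact B.aestronglyMeasurable_comp₂ hy hw.1
  · filter_upwards [ae_restrict_mem measurableSet_Ioo] with x hx
    refine (B.le_opNorm₂ _ _).trans ?_
    gcongr
    exact hC x (Ioo_subset_Icc_self hx)

/-- `H` is the primitive of `‖y'‖`: a monotone scalar majorant from which vector-valued functions
inherit absolute continuity. -/
theorem exists_absolutelyContinuous (h : HasSobolevDeriv y y') :
    ∃ H : ℝ → ℝ, AbsolutelyContinuousOnInterval H 0 1 ∧
      (∀ x ∈ Icc (0 : ℝ) 1, ∀ x' ∈ Icc (0 : ℝ) 1, x ≤ x' → H x ≤ H x' ∧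
        ‖y x' - y x‖ ≤ H x' - H x) := by
  have h0 : (0 : ℝ) ∈ Icc (0 : ℝ) 1 := by simp
  have hi : ∀ x ∈ Icc (0 : ℝ) 1, ∀ x' ∈ Icc (0 : ℝ) 1,
      IntervalIntegrable (fun t => ‖y' t‖) volume x x' :=
    fun x hx x' hx' => (h.intervalIntegrable hx hx').norm
  refine ⟨fun x => ∫ t in (0 : ℝ)..x, ‖y' t‖,
    (hi 0 h0 1 (by simp)).absolutelyContinuousOnInterval_intervalIntegral (by simp), ?_⟩
  intro x hx x' hx' hxx'
  have h1 : (∫ t in (0 : ℝ)..x', ‖y' t‖) - ∫ t in (0 : ℝ)..x, ‖y' t‖ = ∫ t in x..x', ‖y' t‖ :=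
    intervalIntegral.integral_interval_sub_left (hi 0 h0 x' hx') (hi 0 h0 x hx)
  have h2 : 0 ≤ ∫ t in x..x', ‖y' t‖ :=
    intervalIntegral.integral_nonneg hxx' fun _ _ => norm_nonneg _
  refine ⟨by linarith, ?_⟩
  dsimp only
  rw [h1, h.sub_eq hx hx']
  exact intervalIntegral.norm_integral_le_integral_norm hxx'

/-- The product rule in `W₂¹`. -/
theorem bilin [CompleteSpace E] [CompleteSpace F] [CompleteSpace G] {w w' : ℝ → F}
    (h : HasSobolevDeriv y y') (hw : HasSobolevDeriv w w') (B : E →L[ℝ] F →L[ℝ] G) :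
    HasSobolevDeriv (fun x => B (y x) (w x)) (fun x => B (y x) (w' x) + B (y' x) (w x)) := by
  have hL : MemLp (fun x => B (y x) (w' x) + B (y' x) (w x)) 2 unitMeasure :=
    (h.memLp_bilin hw.1 B).add (hw.memLp_bilin h.1 B.flip)
  -- `P` is the expected primitive. The difference `B (y, w) - P` is absolutely continuous with zero
  -- derivative almost everywhere, hence constant.
  set P : ℝ → G := fun x => ∫ t in (0 : ℝ)..x, (B (y t) (w' t) + B (y' t) (w t)) with hP
  have hS : HasSobolevDeriv P (fun x => B (y x) (w' x) + B (y' x) (w x)) :=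
    ⟨hL, fun x _ => by simp [hP]⟩
  obtain ⟨H1, hH1, hy⟩ := h.exists_absolutelyContinuous
  obtain ⟨H2, hH2, hw2⟩ := hw.exists_absolutelyContinuous
  obtain ⟨H3, hH3, hP3⟩ := hS.exists_absolutelyContinuous
  obtain ⟨C1, hC1⟩ := isCompact_Icc.exists_bound_of_continuousOn h.continuousOn
  obtain ⟨C2, hC2⟩ := isCompact_Icc.exists_bound_of_continuousOn hw.continuousOn
  -- A Lipschitz constant for `B (y, w) - P` relative to `H1 + H2 + H3`: `C1` and `C2` bound `y` and
  -- `w`, and the summand `1` pays for `P`.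
  set C := ‖B‖ * C1 + ‖B‖ * C2 + 1 with hC
  have hC10 : 0 ≤ C1 := (norm_nonneg _).trans (hC1 0 (by simp))
  have hC20 : 0 ≤ C2 := (norm_nonneg _).trans (hC2 0 (by simp))
  have hkey : ∀ a ∈ Icc (0 : ℝ) 1, ∀ b ∈ Icc (0 : ℝ) 1, a ≤ b →
      ‖(B (y b) (w b) - P b) - (B (y a) (w a) - P a)‖ ≤
        C * ((H1 + H2 + H3) b - (H1 + H2 + H3) a) ∧
        0 ≤ (H1 + H2 + H3) b - (H1 + H2 + H3) a := by
    intro a ha b hb hab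
    obtain ⟨m1, e1⟩ := hy a ha b hb hab
    obtain ⟨m2, e2⟩ := hw2 a ha b hb hab
    obtain ⟨m3, e3⟩ := hP3 a ha b hb hab
    have : (B (y b) (w b) - P b) - (B (y a) (w a) - P a) =
        B (y b) (w b - w a) + B (y b - y a) (w a) - (P b - P a) := by
      simp only [map_sub, sub_apply]; abel
    constructor
    · rw [this]
      calc _ ≤ ‖B (y b) (w b - w a)‖ + ‖B (y b - y a) (w a)‖ + ‖P b - P a‖ :=
            (norm_sub_le _ _).trans (by gcongr; exact norm_add_le _ _)
        _ ≤ ‖B‖ * C1 * (H2 b - H2 a) + ‖B‖ * (H1 b - H1 a) * C2 + (H3 b - H3 a) := by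
            refine add_le_add (add_le_add ((B.le_opNorm₂ _ _).trans ?_)
              ((B.le_opNorm₂ _ _).trans ?_)) e3
            · gcongr; exact hC1 b hb
            · have : 0 ≤ H1 b - H1 a := sub_nonneg.2 m1
              gcongr
              exact hC2 a ha
        _ ≤ C * ((H1 + H2 + H3) b - (H1 + H2 + H3) a) := by
            simp only [Pi.add_apply, hC]
            have n1 : 0 ≤ ‖B‖ * C1 := by positivity
            have n2 : 0 ≤ ‖B‖ * C2 := by positivity
            nlinarith [mul_nonneg n1 (sub_nonneg.2 m1), mul_nonneg n1 (sub_nonneg.2 m3),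
              mul_nonneg n2 (sub_nonneg.2 m2), mul_nonneg n2 (sub_nonneg.2 m3)]
    · simp only [Pi.add_apply]; linarith
  have hac : AbsolutelyContinuousOnInterval (fun x => B (y x) (w x) - P x) 0 1 := by
    refine absolutelyContinuousOnInterval_of_dist_le (C := C) ((hH1.add hH2).add hH3) ?_
    rw [uIcc_of_le zero_le_one]
    intro a ha b hb
    rw [dist_eq_norm, dist_eq_norm, Real.norm_eq_abs]
    rcases le_total a b with hab | hab
    · obtain ⟨k1, k2⟩ := hkey a ha b hb hab
      rw [norm_sub_rev, abs_sub_comm, abs_of_nonneg k2]; exact k1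
    · obtain ⟨k1, k2⟩ := hkey b hb a ha hab
      rw [abs_of_nonneg k2]; exact k1
  have h01 : ∀ᵐ t : ℝ, t ≠ 0 ∧ t ≠ 1 := by
    have a0 : ∀ᵐ t : ℝ, t ≠ 0 := by simp [ae_iff]
    have a1 : ∀ᵐ t : ℝ, t ≠ 1 := by simp [ae_iff]
    exact a0.and a1
  obtain ⟨c, hc⟩ := hac.const_of_ae_hasDerivAt_zero (by
    filter_upwards [h.ae_hasDerivAt, hw.ae_hasDerivAt, hS.ae_hasDerivAt, h01]
      with x hx1 hx2 hx3 hx4 hmem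
    rw [uIcc_of_le zero_le_one] at hmem
    have hm : x ∈ Ioo (0 : ℝ) 1 :=
      ⟨lt_of_le_of_ne hmem.1 (Ne.symm hx4.1), lt_of_le_of_ne hmem.2 hx4.2⟩
    have hd : HasDerivAt (fun x => B (y x) (w x)) (B (y x) (w' x) + B (y' x) (w x)) x := by
      simpa using (B.hasFDerivAt_of_bilinear (hx1 hm).hasFDerivAt (hx2 hm).hasFDerivAt).hasDerivAt
    have hs := hd.sub (hx3 hm)
    rw [sub_self] at hs
    exact hs)
  rw [uIcc_of_le zero_le_one] at hc
  refine ⟨hL, fun x hx => ?_⟩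
  have e0 := hc 0 (by simp)
  have e1 := hc x hx
  have : P 0 = 0 := by simp [hP]
  rw [this, sub_zero] at e0
  change B (y x) (w x) = B (y 0) (w 0) + P x
  rw [e0, ← e1]
  abel

end HasSobolevDeriv

end Sobolev

/-! ### Weighted estimates -/

theorem _root_.MeasureTheory.MemLp.intervalIntegrable_of_unit {E : Type*} [NormedAddCommGroup E]
    {k : ℝ → E} (hk : MemLp k 2 unitMeasure) {a b : ℝ} (ha : a ∈ Icc (0 : ℝ) 1)
    (hb : b ∈ Icc (0 : ℝ) 1) : IntervalIntegrable k volume a b := by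
  have : IntervalIntegrable k volume 0 1 := by
    rw [intervalIntegrable_iff_integrableOn_Ioo_of_le zero_le_one]
    exact hk.integrable (by norm_num)
  refine this.mono_set ?_
  rw [uIcc_of_le (zero_le_one : (0 : ℝ) ≤ 1)]
  exact uIcc_subset_Icc ha hb

theorem _root_.MeasureTheory.MemLp.intervalIntegrable_sq {k : ℝ → ℝ}
    (hk : MemLp k 2 unitMeasure) {a b : ℝ} (ha : a ∈ Icc (0 : ℝ) 1)
    (hb : b ∈ Icc (0 : ℝ) 1) : IntervalIntegrable (fun t => k t ^ 2) volume a b := by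
  have : IntervalIntegrable (fun t => k t ^ 2) volume 0 1 := by
    rw [intervalIntegrable_iff_integrableOn_Ioo_of_le zero_le_one]
    exact hk.integrable_sq
  refine this.mono_set ?_
  rw [uIcc_of_le (zero_le_one : (0 : ℝ) ≤ 1)]
  exact uIcc_subset_Icc ha hb

theorem integral_exp_left_le {a b τ : ℝ} (hτ : 0 < τ) :
    ∫ t in a..b, Real.exp (-(2 * τ * (b - t))) ^ 2 ≤ 1 / (4 * τ) := by
  have hd : ∀ t ∈ uIcc a b, HasDerivAt (fun t => Real.exp (-(4 * τ * (b - t))) / (4 * τ))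
      (Real.exp (-(2 * τ * (b - t))) ^ 2) t := by
    intro t _
    have : HasDerivAt (fun t => -(4 * τ * (b - t))) (4 * τ) t := by
      have h := (((hasDerivAt_id t).const_sub b).const_mul (4 * τ)).neg
      rw [mul_neg_one, neg_neg] at h
      exact h
    have h2 := this.exp.div_const (4 * τ)
    have h3 : Real.exp (-(4 * τ * (b - t))) * (4 * τ) / (4 * τ) =
        Real.exp (-(2 * τ * (b - t))) ^ 2 := by
      rw [← Real.exp_nat_mul, mul_div_assoc, div_self (by positivity), mul_one]
      push_cast
      ring_nf
    rw [h3] at h2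
    exact h2
  rw [intervalIntegral.integral_eq_sub_of_hasDerivAt hd
    ((Continuous.intervalIntegrable (by fun_prop) _ _))]
  simp only [sub_self, mul_zero, neg_zero, Real.exp_zero]
  have : 0 ≤ Real.exp (-(4 * τ * (b - a))) / (4 * τ) := by positivity
  linarith

theorem integral_exp_right_le {a b τ : ℝ} (hτ : 0 < τ) :
    ∫ t in a..b, Real.exp (-(2 * τ * (t - a))) ^ 2 ≤ 1 / (4 * τ) := by
  -- The reflection `t ↦ a + b - t` exchanges the two exponential weights.
  have := intervalIntegral.integral_comp_sub_left
    (fun t => Real.exp (-(2 * τ * (b - t))) ^ 2) (a := a) (b := b) (a + b)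
  have h2 := integral_exp_left_le (a := a) (b := b) hτ
  rw [add_sub_cancel_left, add_sub_cancel_right] at this
  rw [← this] at h2
  refine le_trans (le_of_eq ?_) h2
  congr 1
  ext t
  ring_nf

/-- The size `(∫ k² + 1) / √τ` of exponentially weighted integrals of `k`. -/
def weightBound (k : ℝ → ℝ) (τ : ℝ) : ℝ := ((∫ t in (0 : ℝ)..1, k t ^ 2) + 1) / √τ

theorem weightBound_nonneg (k : ℝ → ℝ) (τ : ℝ) : 0 ≤ weightBound k τ := by
  have : 0 ≤ ∫ t in (0 : ℝ)..1, k t ^ 2 :=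
    intervalIntegral.integral_nonneg zero_le_one fun _ _ => sq_nonneg _
  unfold weightBound
  positivity

/-- Young's inequality `k w ≤ k² / √τ + √τ w²` replaces Cauchy–Schwarz: with `∫ w² ≤ 1 / (4τ)` both
terms are of order `1 / √τ`. -/
theorem integral_mul_le_weightBound {k w : ℝ → ℝ} (hk : MemLp k 2 unitMeasure)
    (hw : Continuous w) {a b τ : ℝ} (hτ : 0 < τ) (ha : 0 ≤ a) (hab : a ≤ b) (hb : b ≤ 1)
    (h : ∫ t in a..b, w t ^ 2 ≤ 1 / (4 * τ)) :
    ∫ t in a..b, k t * w t ≤ weightBound k τ := by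
  have ha' : a ∈ Icc (0 : ℝ) 1 := ⟨ha, hab.trans hb⟩
  have hb' : b ∈ Icc (0 : ℝ) 1 := ⟨ha.trans hab, hb⟩
  have hsq := hk.intervalIntegrable_sq ha' hb'
  have hs : 0 < √τ := Real.sqrt_pos.2 hτ
  have hss : √τ * √τ = τ := Real.mul_self_sqrt hτ.le
  have hw2 : IntervalIntegrable (fun t => w t ^ 2) volume a b :=
    (hw.pow 2).intervalIntegrable _ _
  have hK : ∫ t in a..b, k t ^ 2 ≤ ∫ t in (0 : ℝ)..1, k t ^ 2 := by
    refine intervalIntegral.integral_mono_interval ha hab hb (ae_of_all _ fun _ => sq_nonneg _)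
      (hk.intervalIntegrable_sq (by simp) (by simp))
  calc ∫ t in a..b, k t * w t
      ≤ ∫ t in a..b, ((1 / √τ) * k t ^ 2 + √τ * w t ^ 2) := by
        refine intervalIntegral.integral_mono_on hab
          ((hk.intervalIntegrable_of_unit ha' hb').mul_continuousOn hw.continuousOn)
          ((hsq.const_mul _).add (hw2.const_mul _)) fun t _ => ?_
        have h1 : (1 / √τ) * k t ^ 2 + √τ * w t ^ 2 - k t * w t =
          (1 / √τ) * ((k t - √τ * w t / 2) ^ 2 + 3 / 4 * (√τ * w t) ^ 2) := by
          field_simp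
          ring
        have h2 : 0 ≤ (1 / √τ) * ((k t - √τ * w t / 2) ^ 2 + 3 / 4 * (√τ * w t) ^ 2) := by
          positivity
        linarith
    _ = (1 / √τ) * (∫ t in a..b, k t ^ 2) + √τ * ∫ t in a..b, w t ^ 2 := by
        rw [intervalIntegral.integral_add (hsq.const_mul _) (hw2.const_mul _),
          intervalIntegral.integral_const_mul, intervalIntegral.integral_const_mul]
    _ ≤ (1 / √τ) * (∫ t in (0 : ℝ)..1, k t ^ 2) + √τ * (1 / (4 * τ)) := by gcongr
    _ ≤ weightBound k τ := by
        have h1 : √τ * (1 / (4 * τ)) = 1 / √τ * (1 / 4) := by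
          field_simp
          nlinarith
        have h2 : weightBound k τ = 1 / √τ * ((∫ t in (0 : ℝ)..1, k t ^ 2) + 1) := by
          rw [weightBound, div_eq_inv_mul, one_div]
        rw [h1, h2, ← mul_add]
        exact mul_le_mul_of_nonneg_left (by linarith) (by positivity)

theorem integral_mul_exp_left_le {k : ℝ → ℝ} (hk : MemLp k 2 unitMeasure) {a b τ : ℝ}
    (hτ : 0 < τ) (ha : 0 ≤ a) (hab : a ≤ b) (hb : b ≤ 1) :
    ∫ t in a..b, k t * Real.exp (-(2 * τ * (b - t))) ≤ weightBound k τ :=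
  integral_mul_le_weightBound hk (by fun_prop) hτ ha hab hb (integral_exp_left_le hτ)

theorem integral_mul_exp_right_le {k : ℝ → ℝ} (hk : MemLp k 2 unitMeasure) {a b τ : ℝ}
    (hτ : 0 < τ) (ha : 0 ≤ a) (hab : a ≤ b) (hb : b ≤ 1) :
    ∫ t in a..b, k t * Real.exp (-(2 * τ * (t - a))) ≤ weightBound k τ :=
  integral_mul_le_weightBound hk (by fun_prop) hτ ha hab hb (integral_exp_right_le hτ)

theorem tendsto_weightBound (k : ℝ → ℝ) : Tendsto (weightBound k) atTop (𝓝 0) :=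
  tendsto_const_nhds.div_atTop Real.tendsto_sqrt_atTop

/-- A rate for which the weighted integral operator with kernel `k` is a contraction. -/
theorem exists_weightBound_le (k : ℝ → ℝ) {ε : ℝ} (hε : 0 < ε) :
    ∃ τ : ℝ, 0 < τ ∧ weightBound k τ ≤ ε :=
  (((tendsto_weightBound k).eventually (ge_mem_nhds hε)).and (eventually_gt_atTop 0)).exists.imp
    fun _ h => ⟨h.2, h.1⟩

/-- A Gronwall inequality with a square integrable kernel. -/
theorem le_of_le_add_integral {k g : ℝ → ℝ} (hk : MemLp k 2 unitMeasure) (hk0 : ∀ x, 0 ≤ k x)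
    (hg : ContinuousOn g (Icc 0 1)) (hg0 : ∀ x ∈ Icc (0 : ℝ) 1, 0 ≤ g x) {a τ : ℝ} (ha : 0 ≤ a)
    (hτ : 0 < τ) (hkτ : weightBound k τ ≤ 1 / 2)
    (h : ∀ x ∈ Icc (0 : ℝ) 1, g x ≤ a + ∫ t in (0 : ℝ)..x, k t * g t) :
    ∀ x ∈ Icc (0 : ℝ) 1, g x ≤ 2 * a * Real.exp (2 * τ) := by
  obtain ⟨x₀, hx₀, hmax⟩ := isCompact_Icc.exists_isMaxOn (nonempty_Icc.2 zero_le_one)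
    (hg.mul (Continuous.continuousOn (f := fun x : ℝ => Real.exp (-(2 * τ * x))) (by fun_prop)))
  -- `B` is the maximum of `g` for the weight `exp (-2τx)`. In this weighted norm the integral
  -- operator has norm at most `1/2`, so its contribution at `x₀` can be absorbed.
  set B := g x₀ * Real.exp (-(2 * τ * x₀)) with hB
  have hgB : ∀ t ∈ Icc (0 : ℝ) 1, g t ≤ B * Real.exp (2 * τ * t) := by
    intro t ht
    have : g t * Real.exp (-(2 * τ * t)) ≤ B := hmax ht
    calc g t = g t * Real.exp (-(2 * τ * t)) * Real.exp (2 * τ * t) := by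
          rw [mul_assoc, ← Real.exp_add]; simp
      _ ≤ _ := by gcongr
  have hB0 : 0 ≤ B := mul_nonneg (hg0 _ hx₀) (Real.exp_nonneg _)
  have hki := hk.intervalIntegrable_of_unit (a := 0) (b := x₀) (by simp) hx₀
  have hB2 : B ≤ 2 * a := by
    have h1 : ∫ t in (0 : ℝ)..x₀, k t * g t ≤
        B * Real.exp (2 * τ * x₀) * ∫ t in (0 : ℝ)..x₀, k t * Real.exp (-(2 * τ * (x₀ - t))) := by
      rw [← intervalIntegral.integral_const_mul]
      refine intervalIntegral.integral_mono_on hx₀.1 (hki.mul_continuousOn (hg.mono ?_))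
        ((hki.mul_continuousOn (by fun_prop)).const_mul _) fun t ht => ?_
      · rw [uIcc_of_le hx₀.1]; exact Icc_subset_Icc_right hx₀.2
      · have h2 := mul_le_mul_of_nonneg_left (hgB t ⟨ht.1, ht.2.trans hx₀.2⟩) (hk0 t)
        refine h2.trans (le_of_eq ?_)
        have : Real.exp (2 * τ * t) =
            Real.exp (2 * τ * x₀) * Real.exp (-(2 * τ * (x₀ - t))) := by
          rw [← Real.exp_add]; ring_nf
        rw [this]; ring
    have h2 := integral_mul_exp_left_le hk hτ le_rfl hx₀.1 hx₀.2
    have h3 := h x₀ hx₀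
    have e1 : 0 < Real.exp (2 * τ * x₀) := Real.exp_pos _
    have h4 : g x₀ = B * Real.exp (2 * τ * x₀) := by
      rw [hB, mul_assoc, ← Real.exp_add]; simp
    have h5 : B * Real.exp (2 * τ * x₀) *
        (∫ t in (0 : ℝ)..x₀, k t * Real.exp (-(2 * τ * (x₀ - t)))) ≤
        B * Real.exp (2 * τ * x₀) * (1 / 2) := by gcongr; linarith
    have h6 : B * Real.exp (2 * τ * x₀) ≤ 2 * a := by linarith
    have h7 : (1 : ℝ) ≤ Real.exp (2 * τ * x₀) := Real.one_le_exp (by have := hx₀.1; positivity)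
    nlinarith
  intro x hx
  calc g x ≤ B * Real.exp (2 * τ * x) := hgB x hx
    _ ≤ 2 * a * Real.exp (2 * τ) := by
        have : 2 * τ * x ≤ 2 * τ := by nlinarith [hx.2]
        gcongr

/-- A linear differential inequality with zero initial value has only the zero solution. -/
theorem HasSobolevDeriv.eq_zero {E : Type*} [NormedAddCommGroup E] [NormedSpace ℝ E]
    {y y' : ℝ → E} (h : HasSobolevDeriv y y') (h0 : y 0 = 0) {k : ℝ → ℝ}
    (hk : MemLp k 2 unitMeasure) (hk0 : ∀ x, 0 ≤ k x)
    (hle : ∀ᵐ x ∂unitMeasure, ‖y' x‖ ≤ k x * ‖y x‖) : ∀ x ∈ Icc (0 : ℝ) 1, y x = 0 := by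
  obtain ⟨τ, hτ, hkτ⟩ := exists_weightBound_le k (one_half_pos (α := ℝ))
  intro x hx
  have hc := h.continuousOn.norm
  have := le_of_le_add_integral hk hk0 hc (fun _ _ => norm_nonneg _) le_rfl hτ hkτ
    (fun x hx => ?_) x hx
  · simpa using this
  · rw [zero_add, h.2 x hx, h0, zero_add]
    refine intervalIntegral.norm_integral_le_of_norm_le hx.1 ?_
      ((hk.intervalIntegrable_of_unit (by simp) hx).mul_continuousOn (hc.mono ?_))
    · rw [ae_restrict_iff' measurableSet_Ioo] at hle
      have h1 : ∀ᵐ t : ℝ, t ≠ 1 := by simp [ae_iff]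
      filter_upwards [hle, h1] with t ht ht1 hmem
      exact ht ⟨hmem.1, lt_of_le_of_ne (hmem.2.trans hx.2) ht1⟩
    · rw [uIcc_of_le hx.1]; exact Icc_subset_Icc_right hx.2

/-! ### Linear systems with square integrable coefficients -/

/-- `1 - aⁿ` is the product of the commuting factors `1 - a` and `∑ aⁱ`, so a Neumann series is
needed only for a power of `a`. -/
theorem isUnit_one_sub_of_norm_pow_lt_one {R : Type*} [NormedRing R] [CompleteSpace R] {a : R}
    {n : ℕ} (h : ‖a ^ n‖ < 1) : IsUnit (1 - a) := by
  have hu : IsUnit (1 - a ^ n) := isUnit_one_sub_of_norm_lt_one h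
  have hc : Commute (1 - a) (∑ i ∈ Finset.range n, a ^ i) :=
    (Commute.one_left _).sub_left (Commute.sum_right _ _ _ fun i _ => Commute.self_pow _ i)
  rw [← mul_neg_geom_sum] at hu
  exact (hc.isUnit_mul_iff.1 hu).1

theorem differentiable_inverse_one_sub {R : Type*} [NormedRing R] [NormedAlgebra ℂ R]
    [CompleteSpace R] {a b : R} (h : ∀ z : ℂ, IsUnit (1 - (z • a + b))) :
    Differentiable ℂ (fun z : ℂ => Ring.inverse (1 - (z • a + b))) := fun z =>
  (differentiableAt_inverse (𝕜 := ℂ) (h z)).comp z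
    (((differentiableAt_id.smul_const a).add_const b).const_sub 1)

section Volterra

variable {𝔸 : Type*} [NormedRing 𝔸]

theorem intervalIntegrable_mul_IccExtend {A : ℝ → 𝔸} (hA : MemLp A 2 unitMeasure)
    (f : C(Icc (0 : ℝ) 1, 𝔸)) {a b : ℝ} (ha : a ∈ Icc (0 : ℝ) 1) (hb : b ∈ Icc (0 : ℝ) 1) :
    IntervalIntegrable (fun t => A t * IccExtend zero_le_one f t) volume a b :=
  (hA.intervalIntegrable_of_unit ha hb).mul_continuousOn
    (f.continuous.Icc_extend' (h := zero_le_one)).continuousOn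

theorem norm_IccExtend_le (f : C(Icc (0 : ℝ) 1, 𝔸)) (t : ℝ) :
    ‖IccExtend zero_le_one f t‖ ≤ ‖f‖ := f.norm_coe_le_norm _

variable [NormedAlgebra ℂ 𝔸]

/-- The Volterra operator `f ↦ ∫₀ˣ A f`. -/
def volterra (A : ℝ → 𝔸) (hA : MemLp A 2 unitMeasure) :
    C(Icc (0 : ℝ) 1, 𝔸) →L[ℂ] C(Icc (0 : ℝ) 1, 𝔸) :=
  LinearMap.mkContinuous
    { toFun := fun f =>
        ⟨fun x => ∫ t in (0 : ℝ)..x, A t * IccExtend zero_le_one f t, by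
          have hi : IntegrableOn (fun t => A t * IccExtend zero_le_one f t) (uIcc 0 1) := by
            have := intervalIntegrable_mul_IccExtend hA f (a := 0) (b := 1) (by simp) (by simp)
            rwa [intervalIntegrable_iff'] at this
          have := intervalIntegral.continuousOn_primitive_interval hi
          rw [uIcc_of_le zero_le_one] at this
          exact continuousOn_iff_continuous_domRestrict.1 this⟩
      map_add' := fun f g => by
        ext x
        change (∫ t in (0 : ℝ)..x, A t * IccExtend zero_le_one (f + g) t) =
          (∫ t in (0 : ℝ)..x, A t * IccExtend zero_le_one f t) +
          ∫ t in (0 : ℝ)..x, A t * IccExtend zero_le_one g t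
        rw [← intervalIntegral.integral_add
          (intervalIntegrable_mul_IccExtend hA f (by simp) x.2)
          (intervalIntegrable_mul_IccExtend hA g (by simp) x.2)]
        simp [IccExtend, mul_add]
      map_smul' := fun c f => by
        ext x
        change (∫ t in (0 : ℝ)..x, A t * IccExtend zero_le_one (c • f) t) =
          c • ∫ t in (0 : ℝ)..x, A t * IccExtend zero_le_one f t
        rw [← intervalIntegral.integral_smul]
        simp [IccExtend] }
    (∫ t in (0 : ℝ)..1, ‖A t‖) fun f => by
      have h0 : 0 ≤ ∫ t in (0 : ℝ)..1, ‖A t‖ :=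
        intervalIntegral.integral_nonneg zero_le_one fun _ _ => norm_nonneg _
      rw [ContinuousMap.norm_le _ (by positivity)]
      intro x
      have hn := hA.norm.intervalIntegrable_of_unit (a := 0) (b := 1) (by simp) (by simp)
      have hn' := hA.norm.intervalIntegrable_of_unit (a := 0) (by simp) x.2
      calc ‖∫ t in (0 : ℝ)..x, A t * IccExtend zero_le_one f t‖
          ≤ ∫ t in (0 : ℝ)..x, ‖A t‖ * ‖f‖ := by
            refine intervalIntegral.norm_integral_le_of_norm_le x.2.1 (ae_of_all _ fun t _ => ?_)
              (hn'.mul_const _)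
            exact (norm_mul_le _ _).trans (by gcongr; exact norm_IccExtend_le f t)
        _ = (∫ t in (0 : ℝ)..x, ‖A t‖) * ‖f‖ := intervalIntegral.integral_mul_const _ _
        _ ≤ _ := by
            gcongr
            exact intervalIntegral.integral_mono_interval le_rfl x.2.1 x.2.2
              (ae_of_all _ fun _ => norm_nonneg _) hn

theorem volterra_apply (A : ℝ → 𝔸) (hA : MemLp A 2 unitMeasure) (f : C(Icc (0 : ℝ) 1, 𝔸))
    (x : Icc (0 : ℝ) 1) :
    volterra A hA f x = ∫ t in (0 : ℝ)..x, A t * IccExtend zero_le_one f t := rfl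

/-- With the weight `exp (-2τx)` the Volterra operator has norm at most `1/2`. The induction records
this pointwise instead of introducing a second norm. -/
theorem norm_volterra_pow_le (A : ℝ → 𝔸) (hA : MemLp A 2 unitMeasure) {τ : ℝ} (hτ : 0 < τ)
    (h : weightBound (fun t => ‖A t‖) τ ≤ 1 / 2) (n : ℕ) (f : C(Icc (0 : ℝ) 1, 𝔸))
    (x : Icc (0 : ℝ) 1) :
    ‖(volterra A hA ^ n) f x‖ ≤ (1 / 2) ^ n * ‖f‖ * Real.exp (2 * τ * x) := by
  induction n generalizing x with
  | zero =>
    have : (1 : ℝ) ≤ Real.exp (2 * τ * x) := Real.one_le_exp (by have := x.2.1; positivity)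
    simp only [pow_zero, one_mul, one_apply_eq_self]
    exact (f.norm_coe_le_norm x).trans (by nlinarith [norm_nonneg f])
  | succ n ih =>
    rw [pow_succ', mul_apply_eq_comp, volterra_apply]
    have hn := hA.norm.intervalIntegrable_of_unit (a := 0) (by simp) x.2
    calc _ ≤ ∫ t in (0 : ℝ)..x, (1 / 2) ^ n * ‖f‖ * Real.exp (2 * τ * x) *
            (‖A t‖ * Real.exp (-(2 * τ * (x - t)))) := by
          refine intervalIntegral.norm_integral_le_of_norm_le x.2.1 (ae_of_all _ fun t ht => ?_)
            ((hn.mul_continuousOn (by fun_prop)).const_mul _)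
          have ht' : t ∈ Icc (0 : ℝ) 1 := ⟨ht.1.le, ht.2.trans x.2.2⟩
          have h1 := ih ⟨t, ht'⟩
          rw [IccExtend_of_mem _ _ ht']
          refine (norm_mul_le _ _).trans ((mul_le_mul_of_nonneg_left h1 (norm_nonneg _)).trans
            (le_of_eq ?_))
          have : Real.exp (2 * τ * t) =
              Real.exp (2 * τ * x) * Real.exp (-(2 * τ * (x - t))) := by
            rw [← Real.exp_add]; ring_nf
          simp only [this]; ring
      _ = (1 / 2) ^ n * ‖f‖ * Real.exp (2 * τ * x) *
            ∫ t in (0 : ℝ)..x, (‖A t‖ * Real.exp (-(2 * τ * (x - t)))) :=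
          intervalIntegral.integral_const_mul _ _
      _ ≤ (1 / 2) ^ n * ‖f‖ * Real.exp (2 * τ * x) * (1 / 2) := by
          gcongr
          exact (integral_mul_exp_left_le hA.norm hτ le_rfl x.2.1 x.2.2).trans h
      _ = _ := by ring

variable [CompleteSpace 𝔸]

/-- The weight lies between `exp (-2τ)` and `1`, so a high power of the operator is a strict
contraction in the ordinary sup norm as well. -/
theorem isUnit_one_sub_volterra (A : ℝ → 𝔸) (hA : MemLp A 2 unitMeasure) :
    IsUnit (1 - volterra A hA) := by
  obtain ⟨τ, hτ, h⟩ := exists_weightBound_le (fun t => ‖A t‖) (one_half_pos (α := ℝ))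
  have ht : Tendsto (fun n : ℕ => (1 / 2 : ℝ) ^ n * Real.exp (2 * τ)) atTop (𝓝 0) := by
    simpa using (tendsto_pow_atTop_nhds_zero_of_lt_one (r := (1 / 2 : ℝ)) (by norm_num)
      (by norm_num)).mul_const (Real.exp (2 * τ))
  obtain ⟨n, hn⟩ := (ht.eventually (gt_mem_nhds zero_lt_one)).exists
  have hlt : ‖volterra A hA ^ n‖ < 1 := by
    refine lt_of_le_of_lt (ContinuousLinearMap.opNorm_le_bound _ (by positivity) fun f => ?_) hn
    rw [ContinuousMap.norm_le _ (by positivity)]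
    intro x
    refine (norm_volterra_pow_le A hA hτ h n f x).trans ?_
    have : Real.exp (2 * τ * x) ≤ Real.exp (2 * τ) :=
      Real.exp_le_exp.2 (by nlinarith [x.2.2])
    calc _ ≤ (1 / 2) ^ n * ‖f‖ * Real.exp (2 * τ) := by gcongr
      _ = _ := by ring
  exact isUnit_one_sub_of_norm_pow_lt_one (R := C(Icc (0 : ℝ) 1, 𝔸) →L[ℂ] C(Icc (0 : ℝ) 1, 𝔸)) hlt

/-- Existence of a fundamental system depending holomorphically on the spectral parameter. -/
theorem exists_fundamental_system (J : 𝔸) (B : ℝ → 𝔸) (hB : MemLp B 2 unitMeasure) :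
    ∃ u : ℂ → ℝ → 𝔸, (∀ z, u z 0 = 1) ∧
      (∀ z, HasSobolevDeriv (u z) (fun t => (z • J + B t) * u z t)) ∧
      ∀ x, Differentiable ℂ (fun z => u z x) := by
  have hJ : MemLp (fun _ : ℝ => J) 2 unitMeasure := memLp_const J
  have hA : ∀ z : ℂ, MemLp (fun t => z • J + B t) 2 unitMeasure :=
    fun z => (memLp_const (z • J)).add hB
  -- The operator is affine in `z`, so the inverse of `1 - V` is holomorphic in `z`. Applying it to
  -- the constant function `1` and evaluating at a point preserve this.
  have hV : ∀ z, volterra _ (hA z) = z • volterra _ hJ + volterra B hB := by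
    intro z
    ext f x
    simp only [add_apply, FunLike.coe_smul, Pi.smul_apply, ContinuousMap.add_apply,
      ContinuousMap.smul_apply, volterra_apply]
    have h1 : IntervalIntegrable (fun t => z • (J * IccExtend zero_le_one f t)) volume 0 x :=
      (intervalIntegrable_mul_IccExtend hJ f (by simp) x.2).smul z
    rw [← intervalIntegral.integral_smul, ← intervalIntegral.integral_add h1
      (intervalIntegrable_mul_IccExtend hB f (by simp) x.2)]
    simp only [add_mul, smul_mul_assoc]
  let w : ℂ → C(Icc (0 : ℝ) 1, 𝔸) := fun z => Ring.inverse (1 - volterra _ (hA z)) 1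
  have hw : ∀ z, w z - volterra _ (hA z) (w z) = 1 := by
    intro z
    have h1 := Ring.mul_inverse_cancel _ (isUnit_one_sub_volterra _ (hA z))
    have h2 := congrArg (fun T => T (1 : C(Icc (0 : ℝ) 1, 𝔸))) h1
    simpa [sub_apply, w] using h2
  have hwd : Differentiable ℂ w := by
    have h1 := differentiable_inverse_one_sub (a := volterra _ hJ) (b := volterra B hB)
      fun z => hV z ▸ isUnit_one_sub_volterra _ (hA z)
    simp only [w, hV]
    exact h1.clm_apply (differentiable_const _)
  have hwx : ∀ z, ∀ x : Icc (0 : ℝ) 1, w z x =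
      1 + ∫ t in (0 : ℝ)..x, (z • J + B t) * IccExtend zero_le_one (w z) t := by
    intro z x
    have := congrArg (fun f : C(Icc (0 : ℝ) 1, 𝔸) => f x) (hw z)
    simp only [ContinuousMap.sub_apply, ContinuousMap.one_apply] at this
    rw [← volterra_apply _ (hA z), ← this]
    abel
  have h0 : ∀ z, IccExtend zero_le_one (w z) (0 : ℝ) = 1 := by
    intro z
    rw [IccExtend_of_mem _ _ (by simp : (0 : ℝ) ∈ Icc (0 : ℝ) 1), hwx]
    simp
  refine ⟨fun z => IccExtend zero_le_one (w z), h0, fun z => ⟨?_, fun x hx => ?_⟩, fun x => ?_⟩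
  · refine MemLp.of_le_mul (c := ‖w z‖) (hA z) ?_ (ae_of_all _ fun t => ?_)
    · exact (hA z).1.mul ((w z).continuous.Icc_extend' (h := zero_le_one)).aestronglyMeasurable
    · refine (norm_mul_le _ _).trans ?_
      rw [mul_comm]
      gcongr
      exact norm_IccExtend_le _ _
  · dsimp only
    rw [h0, IccExtend_of_mem _ _ hx, hwx]
  · exact (ContinuousMap.evalCLM ℂ (projIcc (0 : ℝ) 1 zero_le_one x)).differentiable.comp hwd

end Volterra

/-! ### The fundamental system of the Dirac equation -/

theorem theta_mul_theta (r : ℕ) : theta r * theta r = -1 := by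
  simp only [theta, Matrix.smul_mul, Matrix.mul_smul, Matrix.fromBlocks_multiply, smul_smul]
  ext (i | i) (j | j) <;> simp [Matrix.one_apply, apply_ite]

theorem conjTranspose_theta (r : ℕ) : (theta r)ᴴ = -theta r := by
  simp only [theta, Matrix.conjTranspose_smul, Matrix.fromBlocks_conjTranspose]
  simp

variable {r : ℕ}

theorem conjTranspose_blockPotential (q : Potential r) (x : ℝ) :
    (blockPotential q x)ᴴ = blockPotential q x := by
  simp [blockPotential, Matrix.fromBlocks_conjTranspose]

/-- The real linear map `q ↦ (0, q; q*, 0)`. -/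
def blockMap (r : ℕ) :
    Matrix (Fin r) (Fin r) ℂ →L[ℝ] Matrix (Fin r ⊕ Fin r) (Fin r ⊕ Fin r) ℂ :=
  LinearMap.toContinuousLinearMap
    { toFun := fun A => Matrix.fromBlocks 0 A Aᴴ 0
      map_add' := fun A B => by
        simp [Matrix.fromBlocks_add, Matrix.conjTranspose_add]
      map_smul' := fun c A => by
        ext (i | i) (j | j) <;> simp }

theorem memLp_potential (q : Potential r) : MemLp (fun x => q x) 2 unitMeasure := Lp.memLp q

theorem memLp_norm_potential (q : Potential r) : MemLp (fun x => ‖q x‖) 2 unitMeasure :=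
  (memLp_potential q).norm

theorem memLp_blockPotential (q : Potential r) : MemLp (blockPotential q) 2 unitMeasure :=
  (blockMap r).comp_memLp' (memLp_potential q)

theorem memLp_theta_mul_blockPotential (q : Potential r) :
    MemLp (fun x => theta r * blockPotential q x) 2 unitMeasure :=
  (ContinuousLinearMap.mul ℝ (Matrix (Fin r ⊕ Fin r) (Fin r ⊕ Fin r) ℂ) (theta r)).comp_memLp'
    (memLp_blockPotential q)

/-- The fundamental system `u_q(x, z)`. -/
def fundamental (q : Potential r) : ℂ → ℝ → Matrix (Fin r ⊕ Fin r) (Fin r ⊕ Fin r) ℂ :=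
  Classical.choose (exists_fundamental_system (-theta r) _ (memLp_theta_mul_blockPotential q))

theorem fundamental_zero (q : Potential r) (z : ℂ) : fundamental q z 0 = 1 :=
  (Classical.choose_spec
    (exists_fundamental_system (-theta r) _ (memLp_theta_mul_blockPotential q))).1 z

/-- Normal form of the equation: since `ϑ⁻¹ = -ϑ`, `ϑ u' + Q u = z u` reads `u' = (-zϑ + ϑQ) u`. -/
theorem hasSobolevDeriv_fundamental (q : Potential r) (z : ℂ) :
    HasSobolevDeriv (fundamental q z)
      (fun t => (z • -theta r + theta r * blockPotential q t) * fundamental q z t) :=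
  (Classical.choose_spec
    (exists_fundamental_system (-theta r) _ (memLp_theta_mul_blockPotential q))).2.1 z

theorem differentiable_fundamental (q : Potential r) (x : ℝ) :
    Differentiable ℂ (fun z => fundamental q z x) :=
  (Classical.choose_spec
    (exists_fundamental_system (-theta r) _ (memLp_theta_mul_blockPotential q))).2.2 x

theorem eq_of_dirac_equation {q : Potential r} {z : ℂ} {x : ℝ}
    {y y' : Matrix (Fin r ⊕ Fin r) (Fin r ⊕ Fin r) ℂ}
    (h : theta r * y' + blockPotential q x * y = z • y) :
    y' = (z • -theta r + theta r * blockPotential q x) * y := by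
  have h1 := congrArg (fun A => -theta r * A) h
  simp only [mul_add, neg_mul, ← mul_assoc, theta_mul_theta, one_mul, neg_neg] at h1
  rw [add_mul, Matrix.smul_mul, neg_mul, mul_assoc, ← mul_assoc]
  rw [Matrix.mul_smul] at h1
  rw [smul_neg, ← h1]
  abel

theorem dirac_equation_fundamental (q : Potential r) (z : ℂ) (x : ℝ) :
    theta r * ((z • -theta r + theta r * blockPotential q x) * fundamental q z x) +
      blockPotential q x * fundamental q z x = z • fundamental q z x := by
  rw [add_mul, mul_add, Matrix.smul_mul, Matrix.mul_smul, neg_mul, mul_neg, ← mul_assoc,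
    ← mul_assoc, ← mul_assoc, theta_mul_theta]
  simp

/-- Solutions of the matrix Dirac equation are determined by their initial values. -/
theorem eq_fundamental_mul {q : Potential r} {z : ℂ}
    {y y' : ℝ → Matrix (Fin r ⊕ Fin r) (Fin r ⊕ Fin r) ℂ} (h : HasSobolevDeriv y y')
    (he : ∀ᵐ x ∂unitMeasure, theta r * y' x + blockPotential q x * y x = z • y x) :
    ∀ x ∈ Icc (0 : ℝ) 1, y x = fundamental q z x * y 0 := by
  set A := fun t => z • -theta r + theta r * blockPotential q t
  have h2 := (hasSobolevDeriv_fundamental q z).clm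
    ((ContinuousLinearMap.mul ℝ (Matrix (Fin r ⊕ Fin r) (Fin r ⊕ Fin r) ℂ)).flip (y 0))
  have hA : MemLp (fun t => ‖A t‖) 2 unitMeasure :=
    ((memLp_const (z • -theta r)).add (memLp_theta_mul_blockPotential q)).norm
  intro x hx
  have := (h.sub h2).eq_zero (by simp [fundamental_zero]) hA (fun _ => norm_nonneg _) (by
    filter_upwards [he] with t ht
    rw [eq_of_dirac_equation ht]
    refine le_trans (le_of_eq ?_) (norm_mul_le _ _)
    simp only [ContinuousLinearMap.flip_apply, ContinuousLinearMap.mul_apply', mul_sub,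
      mul_assoc, A]) x hx
  simpa [sub_eq_zero] using this

theorem isCauchySolution_fundamental (q : Potential r) (z : ℂ) :
    IsCauchySolution q z (fundamental q z) :=
  ⟨fundamental_zero q z, _, hasSobolevDeriv_fundamental q z,
    ae_of_all _ fun x => dirac_equation_fundamental q z x⟩

/-- Solutions of the Cauchy problem may differ outside `[0,1]`, but uniqueness pins down the choice
of `Classical.epsilon` on `[0,1]`. From here on the holomorphic family `fundamental` can be used
instead. -/
theorem cauchySolution_eq (q : Potential r) (z : ℂ) {x : ℝ} (hx : x ∈ Icc (0 : ℝ) 1) :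
    cauchySolution q z x = fundamental q z x := by
  obtain ⟨h0, u', hu, he⟩ : IsCauchySolution q z (cauchySolution q z) :=
    Classical.epsilon_spec ⟨_, isCauchySolution_fundamental q z⟩
  rw [eq_fundamental_mul hu he x hx, h0, mul_one]

/-- The Lagrange identity. -/
theorem lagrange_identity (q : Potential r) (w z : ℂ) {x : ℝ} (hx : x ∈ Icc (0 : ℝ) 1) :
    (fundamental q w x)ᴴ * theta r * fundamental q z x =
      theta r + (z - star w) • ∫ t in (0 : ℝ)..x, (fundamental q w t)ᴴ * fundamental q z t := by
  have h1 := (hasSobolevDeriv_fundamental q w).clm 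
    (starL' ℝ (A := Matrix (Fin r ⊕ Fin r) (Fin r ⊕ Fin r) ℂ)).toContinuousLinearMap
  have h2 := (hasSobolevDeriv_fundamental q z).clm (ContinuousLinearMap.mul ℝ _ (theta r))
  have h3 := (h1.bilin h2 (ContinuousLinearMap.mul ℝ _)).2 x hx
  simp only [ContinuousLinearEquiv.coe_coe, starL'_apply, ContinuousLinearMap.mul_apply',
    fundamental_zero, star_one, one_mul, mul_one, Matrix.star_eq_conjTranspose] at h3
  rw [mul_assoc, h3, ← intervalIntegral.integral_smul]
  congr 1
  refine intervalIntegral.integral_congr fun t _ => ?_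
  -- In the derivative of `u_w* ϑ u_z` the two potential terms cancel because `Q* = Q` and `ϑ* =
  -- -ϑ`; only the spectral parameters survive.
  simp only [Matrix.conjTranspose_mul, Matrix.conjTranspose_add, Matrix.conjTranspose_smul,
    Matrix.conjTranspose_neg, conjTranspose_theta, conjTranspose_blockPotential, neg_neg]
  have e1 : (fundamental q w t)ᴴ * (theta r * ((z • -theta r + theta r * blockPotential q t) *
      fundamental q z t)) = z • ((fundamental q w t)ᴴ * fundamental q z t) -
        (fundamental q w t)ᴴ * (blockPotential q t * fundamental q z t) := by
    have := dirac_equation_fundamental q z t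
    rw [← eq_sub_iff_add_eq] at this
    rw [this, mul_sub, Matrix.mul_smul]
  rw [e1]
  have e2 : (star w • theta r + blockPotential q t * -theta r) * theta r =
      -(star w • (1 : Matrix (Fin r ⊕ Fin r) (Fin r ⊕ Fin r) ℂ)) + blockPotential q t := by
    rw [add_mul, Matrix.smul_mul, theta_mul_theta, mul_assoc, neg_mul, theta_mul_theta]
    simp
  have e3 : (fundamental q w t)ᴴ * (star w • theta r + blockPotential q t * -theta r) *
      (theta r * fundamental q z t) = -(star w • ((fundamental q w t)ᴴ * fundamental q z t)) +
        (fundamental q w t)ᴴ * (blockPotential q t * fundamental q z t) := by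
    rw [mul_assoc, ← mul_assoc _ (theta r), e2, add_mul, mul_add, neg_mul, Matrix.smul_mul,
      one_mul, mul_neg, Matrix.mul_smul]
  rw [e3, sub_smul]
  abel

/-- With first parameter `z̄` the integral in the Lagrange identity has coefficient `0`. This
expresses `u(z)⁻¹` through `u(z̄)*`, which supplies bounds for the inverse and the reflection in the
real axis. -/
theorem conjTranspose_fundamental_mul (q : Potential r) (z : ℂ) {x : ℝ}
    (hx : x ∈ Icc (0 : ℝ) 1) :
    (fundamental q (star z) x)ᴴ * theta r * fundamental q z x = theta r := by
  rw [lagrange_identity q _ _ hx]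
  simp

theorem inverse_fundamental_mul (q : Potential r) (z : ℂ) {x : ℝ} (hx : x ∈ Icc (0 : ℝ) 1) :
    (-theta r * (fundamental q (star z) x)ᴴ * theta r) * fundamental q z x = 1 := by
  rw [mul_assoc, mul_assoc, ← mul_assoc _ (theta r), conjTranspose_fundamental_mul q z hx,
    neg_mul, theta_mul_theta, neg_neg]

theorem fundamental_mul_inverse (q : Potential r) (z : ℂ) {x : ℝ} (hx : x ∈ Icc (0 : ℝ) 1) :
    fundamental q z x * (-theta r * (fundamental q (star z) x)ᴴ * theta r) = 1 :=
  mul_eq_one_comm.1 (inverse_fundamental_mul q z hx)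

theorem isUnit_fundamental (q : Potential r) (z : ℂ) {x : ℝ} (hx : x ∈ Icc (0 : ℝ) 1) :
    IsUnit (fundamental q z x) :=
  isUnit_iff_exists.2 ⟨_, fundamental_mul_inverse q z hx, inverse_fundamental_mul q z hx⟩

theorem inverse_fundamental (q : Potential r) (z : ℂ) {x : ℝ} (hx : x ∈ Icc (0 : ℝ) 1) :
    Ring.inverse (fundamental q z x) = -theta r * (fundamental q (star z) x)ᴴ * theta r :=
  by rw [← mul_one (Ring.inverse _), ← fundamental_mul_inverse q z hx,
    Ring.inverse_mul_cancel_left _ _ (isUnit_fundamental q z hx)]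

/-! ### Components of solutions -/

theorem toRows₁_theta_mul {κ : Type*} (X : Matrix (Fin r ⊕ Fin r) κ ℂ) :
    (theta r * X).toRows₁ = (-Complex.I) • X.toRows₁ := by
  ext i j
  simp [theta, Matrix.toRows₁, Matrix.mul_apply, Matrix.one_apply]

theorem toRows₂_theta_mul {κ : Type*} (X : Matrix (Fin r ⊕ Fin r) κ ℂ) :
    (theta r * X).toRows₂ = Complex.I • X.toRows₂ := by
  ext i j
  simp [theta, Matrix.toRows₂, Matrix.mul_apply, Matrix.one_apply]

theorem toRows₁_blockPotential_mul {κ : Type*} (q : Potential r) (x : ℝ)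
    (X : Matrix (Fin r ⊕ Fin r) κ ℂ) :
    (blockPotential q x * X).toRows₁ = q x * X.toRows₂ := by
  ext i j
  simp [blockPotential, Matrix.toRows₁, Matrix.toRows₂, Matrix.mul_apply]

theorem toRows₂_blockPotential_mul {κ : Type*} (q : Potential r) (x : ℝ)
    (X : Matrix (Fin r ⊕ Fin r) κ ℂ) :
    (blockPotential q x * X).toRows₂ = (q x)ᴴ * X.toRows₁ := by
  ext i j
  simp [blockPotential, Matrix.toRows₁, Matrix.toRows₂, Matrix.mul_apply]

theorem system_mul_eq (q : Potential r) (z : ℂ) (x : ℝ)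
    (U : Matrix (Fin r ⊕ Fin r) (Fin r ⊕ Fin r) ℂ) (W : Matrix (Fin r ⊕ Fin r) (Fin r) ℂ) :
    (z • -theta r + theta r * blockPotential q x) * U * W =
      theta r * ((-z) • (U * W) + blockPotential q x * (U * W)) := by
  simp only [add_mul, Matrix.smul_mul, mul_assoc, neg_mul, smul_neg, neg_smul, Matrix.mul_assoc,
    Matrix.add_mul, Matrix.mul_add, Matrix.neg_mul, Matrix.mul_neg, Matrix.mul_smul]

/-- The upper component of the solution with initial value `W`. -/
def upper (q : Potential r) (z : ℂ) (W : Matrix (Fin r ⊕ Fin r) (Fin r) ℂ) (x : ℝ) :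
    Matrix (Fin r) (Fin r) ℂ := (fundamental q z x * W).toRows₁

/-- The lower component of the solution with initial value `W`. -/
def lower (q : Potential r) (z : ℂ) (W : Matrix (Fin r ⊕ Fin r) (Fin r) ℂ) (x : ℝ) :
    Matrix (Fin r) (Fin r) ℂ := (fundamental q z x * W).toRows₂

theorem upper_zero (q : Potential r) (z : ℂ) (W : Matrix (Fin r ⊕ Fin r) (Fin r) ℂ) :
    upper q z W 0 = W.toRows₁ := by simp [upper, fundamental_zero]

theorem lower_zero (q : Potential r) (z : ℂ) (W : Matrix (Fin r ⊕ Fin r) (Fin r) ℂ) :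
    lower q z W 0 = W.toRows₂ := by simp [lower, fundamental_zero]

theorem hasSobolevDeriv_upper (q : Potential r) (z : ℂ)
    (W : Matrix (Fin r ⊕ Fin r) (Fin r) ℂ) :
    HasSobolevDeriv (upper q z W) (fun x => (Complex.I * z) • upper q z W x -
      Complex.I • (q x * lower q z W x)) := by
  let L : Matrix (Fin r ⊕ Fin r) (Fin r ⊕ Fin r) ℂ →L[ℝ] Matrix (Fin r) (Fin r) ℂ :=
    LinearMap.toContinuousLinearMap
      { toFun := fun A => (A * W).toRows₁
        map_add' := fun A B => by rw [Matrix.add_mul]; rfl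
        map_smul' := fun c A => by rw [Matrix.smul_mul]; rfl }
  have := (hasSobolevDeriv_fundamental q z).clm L
  refine this.congr_deriv (ae_of_all _ fun x => ?_)
  change ((z • -theta r + theta r * blockPotential q x) * fundamental q z x * W).toRows₁ = _
  rw [system_mul_eq, toRows₁_theta_mul]
  have e2 : ((-z) • (fundamental q z x * W) + blockPotential q x * (fundamental q z x * W)).toRows₁
      = (-z) • upper q z W x + q x * lower q z W x := by
    rw [lower, ← toRows₁_blockPotential_mul]; rfl
  rw [e2, smul_add, smul_smul, neg_mul_neg, neg_smul]
  exact (sub_eq_add_neg _ _).symm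

theorem hasSobolevDeriv_lower (q : Potential r) (z : ℂ)
    (W : Matrix (Fin r ⊕ Fin r) (Fin r) ℂ) :
    HasSobolevDeriv (lower q z W) (fun x => -(Complex.I * z) • lower q z W x +
      Complex.I • ((q x)ᴴ * upper q z W x)) := by
  let L : Matrix (Fin r ⊕ Fin r) (Fin r ⊕ Fin r) ℂ →L[ℝ] Matrix (Fin r) (Fin r) ℂ :=
    LinearMap.toContinuousLinearMap
      { toFun := fun A => (A * W).toRows₂
        map_add' := fun A B => by rw [Matrix.add_mul]; rfl
        map_smul' := fun c A => by rw [Matrix.smul_mul]; rfl }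
  have := (hasSobolevDeriv_fundamental q z).clm L
  refine this.congr_deriv (ae_of_all _ fun x => ?_)
  change ((z • -theta r + theta r * blockPotential q x) * fundamental q z x * W).toRows₂ = _
  rw [system_mul_eq, toRows₂_theta_mul]
  have e2 : ((-z) • (fundamental q z x * W) + blockPotential q x * (fundamental q z x * W)).toRows₂
      = (-z) • lower q z W x + (q x)ᴴ * upper q z W x := by
    rw [upper, ← toRows₂_blockPotential_mul]; rfl
  rw [e2, smul_add, smul_smul, mul_neg]

theorem HasSobolevDeriv.exp_smul {E : Type*} [NormedAddCommGroup E] [NormedSpace ℂ E]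
    [CompleteSpace E] {y y' : ℝ → E} (h : HasSobolevDeriv y y') (c : ℂ) :
    HasSobolevDeriv (fun x : ℝ => Complex.exp (c * x) • y x)
      (fun x : ℝ => Complex.exp (c * x) • (y' x + c • y x)) := by
  have he : HasSobolevDeriv (fun x : ℝ => Complex.exp (c * x))
      (fun x : ℝ => Complex.exp (c * x) * c) := by
    refine HasSobolevDeriv.of_hasDerivAt (fun x => ?_) (by fun_prop)
    have h1 : HasDerivAt (fun x : ℝ => c * (x : ℂ)) c x := by
      have := (Complex.ofRealCLM.hasDerivAt (x := x)).const_mul c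
      rw [Complex.ofRealCLM_apply, Complex.ofReal_one, mul_one] at this
      exact this
    exact h1.cexp
  have := he.bilin h (ContinuousLinearMap.lsmul ℝ ℂ)
  refine this.congr_deriv (ae_of_all _ fun x => ?_)
  change Complex.exp (c * x) • y' x + (Complex.exp (c * x) * c) • y x =
    Complex.exp (c * x) • (y' x + c • y x)
  rw [smul_add, mul_smul]

/-- Variation of constants for the upper component. -/
theorem hasSobolevDeriv_exp_upper (q : Potential r) (z : ℂ)
    (W : Matrix (Fin r ⊕ Fin r) (Fin r) ℂ) :
    HasSobolevDeriv (fun x : ℝ => Complex.exp (-(Complex.I * z) * x) • upper q z W x)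
      (fun x : ℝ => Complex.exp (-(Complex.I * z) * x) •
        (-Complex.I) • (q x * lower q z W x)) := by
  have := (hasSobolevDeriv_upper q z W).exp_smul (-(Complex.I * z))
  convert this using 3 with x
  rw [neg_smul, neg_smul]; abel

/-- Variation of constants for the lower component. -/
theorem hasSobolevDeriv_exp_lower (q : Potential r) (z : ℂ)
    (W : Matrix (Fin r ⊕ Fin r) (Fin r) ℂ) :
    HasSobolevDeriv (fun x : ℝ => Complex.exp (Complex.I * z * x) • lower q z W x)
      (fun x : ℝ => Complex.exp (Complex.I * z * x) •
        Complex.I • ((q x)ᴴ * upper q z W x)) := by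
  have := (hasSobolevDeriv_lower q z W).exp_smul (Complex.I * z)
  convert this using 3 with x
  rw [neg_smul]; abel

/-! ### Boundary conditions and Green's formula -/

theorem inv_sqrt_two_sq : ((1 / Real.sqrt 2 : ℝ) : ℂ) * ((1 / Real.sqrt 2 : ℝ) : ℂ) = 1 / 2 := by
  rw [← Complex.ofReal_mul, div_mul_div_comm, Real.mul_self_sqrt (by norm_num)]
  norm_num

theorem inv_sqrt_two_ne_zero : ((1 / Real.sqrt 2 : ℝ) : ℂ) ≠ 0 := by
  rw [Complex.ofReal_ne_zero]; positivity

theorem boundaryMatrix_mul {κ : Type*} (X : Matrix (Fin r ⊕ Fin r) κ ℂ) :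
    boundaryMatrix r * X = ((1 / Real.sqrt 2 : ℝ) : ℂ) • (X.toRows₁ - X.toRows₂) := by
  ext i j
  simp [boundaryMatrix, Matrix.mul_apply, Matrix.toRows₁, Matrix.toRows₂, Matrix.one_apply,
    Matrix.fromCols, sub_eq_add_neg, mul_add]

theorem boundaryMatrix_mul_eq_zero_iff {κ : Type*} {X : Matrix (Fin r ⊕ Fin r) κ ℂ} :
    boundaryMatrix r * X = 0 ↔ X.toRows₁ = X.toRows₂ := by
  rw [boundaryMatrix_mul, smul_eq_zero_iff_right inv_sqrt_two_ne_zero, sub_eq_zero]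

theorem toRows₁_conjTranspose_boundaryMatrix :
    ((boundaryMatrix r)ᴴ).toRows₁ = ((1 / Real.sqrt 2 : ℝ) : ℂ) • 1 := by
  ext i j
  rcases eq_or_ne i j with h | h
  · simp [boundaryMatrix, Matrix.toRows₁, h]
  · simp [boundaryMatrix, Matrix.toRows₁, Matrix.one_apply, h, h.symm]

theorem toRows₂_conjTranspose_boundaryMatrix :
    ((boundaryMatrix r)ᴴ).toRows₂ = -(((1 / Real.sqrt 2 : ℝ) : ℂ) • 1) := by
  ext i j
  rcases eq_or_ne i j with h | h
  · simp [boundaryMatrix, Matrix.toRows₂, h]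
  · simp [boundaryMatrix, Matrix.toRows₂, Matrix.one_apply, h, h.symm]

theorem conjTranspose_mul_theta_mul {κ : Type*} (X Y : Matrix (Fin r ⊕ Fin r) κ ℂ) :
    Xᴴ * (theta r * Y) =
      (-Complex.I) • (X.toRows₁ᴴ * Y.toRows₁) + Complex.I • (X.toRows₂ᴴ * Y.toRows₂) := by
  ext i j
  have h1 : ∀ k, (theta r * Y) (Sum.inl k) j = -Complex.I * Y (Sum.inl k) j := fun k =>
    congrFun (congrFun (toRows₁_theta_mul Y) k) j
  have h2 : ∀ k, (theta r * Y) (Sum.inr k) j = Complex.I * Y (Sum.inr k) j := fun k =>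
    congrFun (congrFun (toRows₂_theta_mul Y) k) j
  rw [Matrix.mul_apply, Fintype.sum_sum_type]
  simp only [h1, h2, Matrix.add_apply, Matrix.smul_apply, Matrix.mul_apply, smul_eq_mul,
    Finset.mul_sum, Matrix.conjTranspose_apply, Matrix.toRows₁_apply, Matrix.toRows₂_apply]
  congr 1 <;> exact Finset.sum_congr rfl fun k _ => by ring

/-- The boundary subspace is isotropic for `ϑ`: upper and lower parts enter with opposite factors
`-i` and `i`. This is the symmetry of the operator, and it removes boundary terms from Green's
formula. -/
theorem conjTranspose_mul_theta_mul_eq_zero {κ : Type*} {X Y : Matrix (Fin r ⊕ Fin r) κ ℂ}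
    (hX : boundaryMatrix r * X = 0) (hY : boundaryMatrix r * Y = 0) :
    Xᴴ * (theta r * Y) = 0 := by
  rw [boundaryMatrix_mul_eq_zero_iff] at hX hY
  rw [conjTranspose_mul_theta_mul, hX, hY, neg_smul, neg_add_cancel]

theorem boundaryMatrix_mul_conjTranspose : boundaryMatrix r * (boundaryMatrix r)ᴴ = 1 := by
  rw [boundaryMatrix_mul, toRows₁_conjTranspose_boundaryMatrix,
    toRows₂_conjTranspose_boundaryMatrix, sub_neg_eq_add, ← add_smul, smul_smul, mul_add,
    inv_sqrt_two_sq]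
  norm_num

/-- The columns of `ϑ a*` satisfy the boundary condition at `0`, so `s(z)` is the defect at `1` of
the solutions satisfying that condition. -/
theorem boundaryMatrix_mul_theta_mul :
    boundaryMatrix r * (theta r * (boundaryMatrix r)ᴴ) = 0 := by
  rw [boundaryMatrix_mul_eq_zero_iff, toRows₁_theta_mul, toRows₂_theta_mul,
    toRows₁_conjTranspose_boundaryMatrix, toRows₂_conjTranspose_boundaryMatrix]
  simp

/-- Entries of the Gram matrix of the solutions with initial values `X` and `Y`. -/
def gram (q : Potential r) (w z : ℂ) (X Y : Matrix (Fin r ⊕ Fin r) (Fin r) ℂ) :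
    Matrix (Fin r) (Fin r) ℂ :=
  fun i j => ∫ t in (0 : ℝ)..1,
    ((fundamental q w t * X)ᴴ * (fundamental q z t * Y)) i j

theorem continuousOn_fundamental (q : Potential r) (z : ℂ) :
    ContinuousOn (fundamental q z) (Icc 0 1) :=
  (hasSobolevDeriv_fundamental q z).continuousOn

/-- Green's formula. -/
theorem green_formula (q : Potential r) (w z : ℂ)
    (X Y : Matrix (Fin r ⊕ Fin r) (Fin r) ℂ) :
    (fundamental q w 1 * X)ᴴ * (theta r * (fundamental q z 1 * Y)) =
      Xᴴ * (theta r * Y) + (z - star w) • gram q w z X Y := by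
  have h := lagrange_identity q w z (x := 1) (by simp)
  have h1 : (fundamental q w 1 * X)ᴴ * (theta r * (fundamental q z 1 * Y)) =
      Xᴴ * ((fundamental q w 1)ᴴ * theta r * fundamental q z 1) * Y := by
    rw [Matrix.conjTranspose_mul]
    simp only [Matrix.mul_assoc]
  rw [h1, h, Matrix.mul_add, Matrix.add_mul, Matrix.mul_assoc, Matrix.mul_smul, Matrix.smul_mul]
  congr 2
  ext i j
  let L : Matrix (Fin r ⊕ Fin r) (Fin r ⊕ Fin r) ℂ →L[ℝ] ℂ :=
    LinearMap.toContinuousLinearMap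
      { toFun := fun A => (Xᴴ * A * Y) i j
        map_add' := fun A B => by rw [Matrix.mul_add, Matrix.add_mul]; rfl
        map_smul' := fun c A => by rw [Matrix.mul_smul, Matrix.smul_mul]; rfl }
  have hi : IntervalIntegrable (fun t => (fundamental q w t)ᴴ * fundamental q z t) volume 0 1 := by
    refine ContinuousOn.intervalIntegrable ?_
    rw [uIcc_of_le zero_le_one]
    exact (continuous_star.comp_continuousOn (continuousOn_fundamental q w)).mul
      (continuousOn_fundamental q z)
  have := L.intervalIntegral_comp_comm hi
  change L _ = _
  rw [← this]
  unfold gram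
  refine intervalIntegral.integral_congr fun t _ => ?_
  change (Xᴴ * ((fundamental q w t)ᴴ * fundamental q z t) * Y) i j = ((fundamental q w t * X)ᴴ * (fundamental q z t * Y)) i j
  rw [Matrix.conjTranspose_mul]
  simp only [Matrix.mul_assoc]

/-- The squared norm `∫ |u_q W|²` of the solution with initial value `W`. -/
def energy (q : Potential r) (z : ℂ) (W : Matrix (Fin r ⊕ Fin r) (Fin r) ℂ) : ℝ :=
  ∫ t in (0 : ℝ)..1, ∑ i, ∑ k, ‖(fundamental q z t * W) k i‖ ^ 2

theorem continuousOn_fundamental_mul_apply (q : Potential r) (z : ℂ)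
    (W : Matrix (Fin r ⊕ Fin r) (Fin r) ℂ) (k : Fin r ⊕ Fin r) (i : Fin r) :
    ContinuousOn (fun t => (fundamental q z t * W) k i) (Icc 0 1) := by
  have h1 : Continuous fun A : Matrix (Fin r ⊕ Fin r) (Fin r ⊕ Fin r) ℂ => (A * W) k i :=
    (continuous_id.matrix_mul continuous_const).matrix_elem k i
  exact h1.comp_continuousOn (continuousOn_fundamental q z)

theorem continuousOn_energyDensity (q : Potential r) (z : ℂ)
    (W : Matrix (Fin r ⊕ Fin r) (Fin r) ℂ) :
    ContinuousOn (fun t => ∑ i, ∑ k, ‖(fundamental q z t * W) k i‖ ^ 2) (Icc 0 1) :=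
  continuousOn_finsetSum _ fun i _ => continuousOn_finsetSum _ fun k _ =>
    (continuousOn_fundamental_mul_apply q z W k i).norm.pow 2

theorem intervalIntegrable_energyDensity (q : Potential r) (z : ℂ)
    (W : Matrix (Fin r ⊕ Fin r) (Fin r) ℂ) :
    IntervalIntegrable (fun t => ∑ i, ∑ k, ‖(fundamental q z t * W) k i‖ ^ 2) volume 0 1 := by
  refine ContinuousOn.intervalIntegrable ?_
  rw [uIcc_of_le zero_le_one]
  exact continuousOn_energyDensity q z W

theorem energy_nonneg (q : Potential r) (z : ℂ) (W : Matrix (Fin r ⊕ Fin r) (Fin r) ℂ) :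
    0 ≤ energy q z W :=
  intervalIntegral.integral_nonneg zero_le_one fun _ _ => by positivity

theorem intervalIntegrable_gram (q : Potential r) (w z : ℂ)
    (X Y : Matrix (Fin r ⊕ Fin r) (Fin r) ℂ) (i j : Fin r) :
    IntervalIntegrable (fun t => ((fundamental q w t * X)ᴴ * (fundamental q z t * Y)) i j)
      volume 0 1 := by
  refine ContinuousOn.intervalIntegrable ?_
  rw [uIcc_of_le zero_le_one]
  simp only [Matrix.mul_apply (M := (_ : Matrix _ _ _)ᴴ), Matrix.conjTranspose_apply]
  exact continuousOn_finsetSum _ fun k _ =>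
    (continuous_star.comp_continuousOn (continuousOn_fundamental_mul_apply q w X k i)).mul
      (continuousOn_fundamental_mul_apply q z Y k j)

theorem trace_gram (q : Potential r) (z : ℂ) (W : Matrix (Fin r ⊕ Fin r) (Fin r) ℂ) :
    (gram q z z W W).trace = energy q z W := by
  change ∑ i, ∫ t in (0 : ℝ)..1, ((fundamental q z t * W)ᴴ * (fundamental q z t * W)) i i = _
  rw [energy, ← intervalIntegral.integral_finsetSum fun i _ => intervalIntegrable_gram q z z W W i i,
    ← intervalIntegral.integral_ofReal]
  refine intervalIntegral.integral_congr fun t _ => ?_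
  simp only [Complex.ofReal_sum]
  refine Finset.sum_congr rfl fun i _ => ?_
  rw [Matrix.mul_apply]
  refine Finset.sum_congr rfl fun k _ => ?_
  rw [Matrix.conjTranspose_apply, Complex.star_def, ← Complex.normSq_eq_conj_mul_self,
    Complex.normSq_eq_norm_sq]

/-- The energy density is continuous, and at `t = 0` it is the sum of the squared entries of `W`. -/
theorem eq_zero_of_energy_eq_zero {q : Potential r} {z : ℂ}
    {W : Matrix (Fin r ⊕ Fin r) (Fin r) ℂ} (h : energy q z W = 0) : W = 0 := by
  by_contra hW
  have hne : ∃ k i, W k i ≠ 0 := by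
    by_contra! hc
    exact hW (by ext k i; exact hc k i)
  obtain ⟨k, i, hki⟩ := hne
  have : 0 < energy q z W := by
    refine intervalIntegral.integral_pos zero_lt_one (continuousOn_energyDensity q z W)
      (fun _ _ => by positivity) ⟨0, by simp, ?_⟩
    refine Finset.sum_pos' (fun _ _ => by positivity) ⟨i, Finset.mem_univ _, ?_⟩
    refine Finset.sum_pos' (fun _ _ => by positivity) ⟨k, Finset.mem_univ _, ?_⟩
    rw [fundamental_zero, Matrix.one_mul]
    positivity
  exact this.ne' h

/-- A Cauchy–Schwarz bound with a free parameter. -/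
theorem norm_gram_le (q : Potential r) (w z : ℂ) (X Y : Matrix (Fin r ⊕ Fin r) (Fin r) ℂ)
    (i j : Fin r) {δ : ℝ} (hδ : 0 < δ) :
    ‖gram q w z X Y i j‖ ≤ δ * energy q w X + energy q z Y / δ := by
  have hX := intervalIntegrable_energyDensity q w X
  have hY := intervalIntegrable_energyDensity q z Y
  have hsum : δ * energy q w X + energy q z Y / δ = ∫ t in (0 : ℝ)..1,
      (δ * (∑ i, ∑ k, ‖(fundamental q w t * X) k i‖ ^ 2) +
        (∑ i, ∑ k, ‖(fundamental q z t * Y) k i‖ ^ 2) / δ) := by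
    rw [intervalIntegral.integral_add (hX.const_mul _) (hY.div_const _),
      intervalIntegral.integral_const_mul, intervalIntegral.integral_div]
    rfl
  rw [hsum]
  refine intervalIntegral.norm_integral_le_of_norm_le zero_le_one (ae_of_all _ fun t _ => ?_)
    ((hX.const_mul _).add (hY.div_const _))
  rw [Matrix.mul_apply]
  have hXi : ∑ k, ‖(fundamental q w t * X) k i‖ ^ 2 ≤
      ∑ i, ∑ k, ‖(fundamental q w t * X) k i‖ ^ 2 :=
    Finset.single_le_sum (f := fun i => ∑ k, ‖(fundamental q w t * X) k i‖ ^ 2)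
      (fun _ _ => by positivity) (Finset.mem_univ i)
  have hYj : ∑ k, ‖(fundamental q z t * Y) k j‖ ^ 2 ≤
      ∑ i, ∑ k, ‖(fundamental q z t * Y) k i‖ ^ 2 :=
    Finset.single_le_sum (f := fun i => ∑ k, ‖(fundamental q z t * Y) k i‖ ^ 2)
      (fun _ _ => by positivity) (Finset.mem_univ j)
  calc _ ≤ ∑ k, ‖(fundamental q w t * X) k i‖ * ‖(fundamental q z t * Y) k j‖ := by
        refine (norm_sum_le _ _).trans (le_of_eq (Finset.sum_congr rfl fun k _ => ?_))
        rw [Matrix.conjTranspose_apply, norm_mul, norm_star]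
    _ ≤ ∑ k, (δ * ‖(fundamental q w t * X) k i‖ ^ 2 +
          ‖(fundamental q z t * Y) k j‖ ^ 2 / δ) := by
        refine Finset.sum_le_sum fun k _ => ?_
        set a := ‖(fundamental q w t * X) k i‖
        set b := ‖(fundamental q z t * Y) k j‖
        have h1 : δ * a ^ 2 + b ^ 2 / δ - a * b =
            ((δ * a - b / 2) ^ 2 + 3 / 4 * b ^ 2) / δ := by
          field_simp; ring
        have h2 : 0 ≤ ((δ * a - b / 2) ^ 2 + 3 / 4 * b ^ 2) / δ := by positivity
        linarith
    _ = δ * (∑ k, ‖(fundamental q w t * X) k i‖ ^ 2) +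
          (∑ k, ‖(fundamental q z t * Y) k j‖ ^ 2) / δ := by
        rw [Finset.sum_add_distrib, Finset.mul_sum, Finset.sum_div]
    _ ≤ _ := by gcongr

/-! ### Eigenvalues -/

theorem sMatrix_eq (q : Potential r) (z : ℂ) :
    sMatrix q z = boundaryMatrix r * (fundamental q z 1 * (theta r * (boundaryMatrix r)ᴴ)) := by
  rw [sMatrix, cauchySolution_eq q z (by simp), Matrix.mul_assoc (fundamental q z 1)]

theorem cMatrix_eq (q : Potential r) (z : ℂ) :
    cMatrix q z = boundaryMatrix r * (fundamental q z 1 * (boundaryMatrix r)ᴴ) := by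
  rw [cMatrix, cauchySolution_eq q z (by simp)]

theorem conjTranspose_theta_mul_boundary :
    (theta r * (boundaryMatrix r)ᴴ)ᴴ * (theta r * (boundaryMatrix r)ᴴ) = 1 := by
  rw [Matrix.conjTranspose_mul, Matrix.conjTranspose_conjTranspose, conjTranspose_theta,
    Matrix.mul_assoc, ← Matrix.mul_assoc _ (theta r), Matrix.neg_mul, theta_mul_theta, neg_neg,
    Matrix.one_mul, boundaryMatrix_mul_conjTranspose]

/-- A kernel vector of `s(z)` yields a solution satisfying both boundary conditions. Green's formula
with `w = z` then says `(z - z̄)` times its energy is zero, which forces the solution to vanish. -/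
theorem det_sMatrix_ne_zero (q : Potential r) {z : ℂ} (hz : z.im ≠ 0) :
    (sMatrix q z).det ≠ 0 := by
  intro h
  obtain ⟨v, hv, hsv⟩ := Matrix.exists_mulVec_eq_zero_iff.2 h
  -- All columns of `V` equal `v`, so that the identities for square matrices apply to a single
  -- vector.
  set V : Matrix (Fin r) (Fin r) ℂ := Matrix.of fun i _ => v i with hV
  have hsV : sMatrix q z * V = 0 := by
    ext i j
    exact congrFun hsv i
  set W := theta r * (boundaryMatrix r)ᴴ * V with hW
  have h0 : boundaryMatrix r * W = 0 := by
    rw [hW, ← Matrix.mul_assoc, boundaryMatrix_mul_theta_mul, Matrix.zero_mul]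
  have h1 : boundaryMatrix r * (fundamental q z 1 * W) = 0 := by
    rw [hW, ← Matrix.mul_assoc, ← Matrix.mul_assoc, Matrix.mul_assoc (boundaryMatrix r),
      ← sMatrix_eq, hsV]
  have hg := green_formula q z z W W
  rw [conjTranspose_mul_theta_mul_eq_zero h0 h0, conjTranspose_mul_theta_mul_eq_zero h1 h1,
    zero_add] at hg
  have hzz : z - star z ≠ 0 := by
    intro hc
    apply hz
    have := congrArg Complex.im hc
    simp at this
    linarith
  have hg0 : gram q z z W W = 0 := (smul_eq_zero_iff_right hzz).1 hg.symm
  have he : energy q z W = 0 := by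
    have := trace_gram q z W
    rw [hg0, Matrix.trace_zero] at this
    exact_mod_cast this.symm
  have hW0 := eq_zero_of_energy_eq_zero he
  have hV0 : V = 0 := by
    have := congrArg (fun A => (theta r * (boundaryMatrix r)ᴴ)ᴴ * A) hW0
    rwa [hW, ← Matrix.mul_assoc _ (theta r * (boundaryMatrix r)ᴴ),
      conjTranspose_theta_mul_boundary, Matrix.one_mul, Matrix.mul_zero] at this
  apply hv
  ext i
  exact congrFun (congrFun hV0 i) i

/-- Solutions of the vector Dirac equation are determined by their initial values. -/
theorem eq_fundamental_mulVec {q : Potential r} {z : ℂ} {y y' : ℝ → Fin r ⊕ Fin r → ℂ}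
    (h : HasSobolevDeriv y y')
    (he : ∀ᵐ x ∂unitMeasure, theta r *ᵥ y' x + blockPotential q x *ᵥ y x = z • y x) :
    ∀ x ∈ Icc (0 : ℝ) 1, y x = fundamental q z x *ᵥ y 0 := by
  intro x hx
  let L : (Fin r ⊕ Fin r → ℂ) →L[ℝ] Matrix (Fin r ⊕ Fin r) (Fin r ⊕ Fin r) ℂ :=
    LinearMap.toContinuousLinearMap
      { toFun := fun v => Matrix.of fun i _ => v i
        map_add' := fun _ _ => rfl
        map_smul' := fun _ _ => rfl }
  have h1 := eq_fundamental_mul (q := q) (z := z) (h.clm L) (by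
    filter_upwards [he] with t ht
    ext i j
    exact congrFun ht i) x hx
  ext i
  exact congrFun (congrFun h1 i) i

/-- Solutions obeying the condition at `0` are exactly `u ϑ a* v`, and the condition at `1` then
reads `s(z) v = 0`. -/
theorem isEigenvalue_iff (q : Potential r) (z : ℂ) :
    IsEigenvalue q z ↔ (sMatrix q z).det = 0 := by
  rw [← Matrix.exists_mulVec_eq_zero_iff]
  constructor
  · rintro ⟨y, ⟨h0, h1, y', hy, he⟩, x, hx, hne⟩
    have hsol := eq_fundamental_mulVec hy he
    have hy0 : y 0 ≠ 0 := fun hc => hne (by rw [hsol x hx, hc, Matrix.mulVec_zero])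
    -- Both blocks of `ϑ a*` equal `-i/√2` times the identity, so the factor `i√2` gives `ϑ a* v =
    -- y(0)`.
    refine ⟨fun k => (Complex.I * (Real.sqrt 2 : ℝ)) * y 0 (Sum.inl k), ?_, ?_⟩
    · intro hc
      apply hy0
      have h2 : ∀ k, y 0 (Sum.inl k) = 0 := fun k => by simpa using congrFun hc k
      ext (k | k)
      · exact h2 k
      · rw [← h0 k]; exact h2 k
    · have h2 : (theta r * (boundaryMatrix r)ᴴ) *ᵥ
          (fun k => (Complex.I * (Real.sqrt 2 : ℝ)) * y 0 (Sum.inl k)) = y 0 := by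
        ext (k | k)
        · have e1 : (theta r * (boundaryMatrix r)ᴴ).toRows₁ = _ := toRows₁_theta_mul _
          rw [toRows₁_conjTranspose_boundaryMatrix] at e1
          have e2 : ∀ l, (theta r * (boundaryMatrix r)ᴴ) (Sum.inl k) l = _ := fun l =>
            congrFun (congrFun e1 k) l
          simp [Matrix.mulVec, dotProduct, e2, Matrix.one_apply]
          field_simp
          simp
        · have e1 : (theta r * (boundaryMatrix r)ᴴ).toRows₂ = _ := toRows₂_theta_mul _
          rw [toRows₂_conjTranspose_boundaryMatrix] at e1
          have e2 : ∀ l, (theta r * (boundaryMatrix r)ᴴ) (Sum.inr k) l = _ := fun l =>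
            congrFun (congrFun e1 k) l
          simp [Matrix.mulVec, dotProduct, e2, Matrix.one_apply, ← h0 k]
          field_simp
          simp
      rw [sMatrix_eq, ← Matrix.mulVec_mulVec, ← Matrix.mulVec_mulVec, h2,
        ← hsol 1 (by simp)]
      ext k
      have := congrFun (congrFun (boundaryMatrix_mul
        (Matrix.of fun i (_ : Fin 1) => y 1 i)) k) 0
      change _ = ((1 / Real.sqrt 2 : ℝ) : ℂ) * (y 1 (Sum.inl k) - y 1 (Sum.inr k)) at this
      rw [h1 k, sub_self, mul_zero] at this
      exact this
  · rintro ⟨v, hv, hsv⟩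
    set w := (theta r * (boundaryMatrix r)ᴴ) *ᵥ v with hw
    have hvec : ∀ y : Fin r ⊕ Fin r → ℂ, boundaryMatrix r *ᵥ y = 0 →
        ∀ k, y (Sum.inl k) = y (Sum.inr k) := by
      intro y hy k
      have h1 : boundaryMatrix r * (Matrix.of fun i (_ : Fin 1) => y i) = 0 := by
        ext k l
        exact congrFun hy k
      rw [boundaryMatrix_mul_eq_zero_iff] at h1
      exact congrFun (congrFun h1 k) 0
    let L : Matrix (Fin r ⊕ Fin r) (Fin r ⊕ Fin r) ℂ →L[ℝ] (Fin r ⊕ Fin r → ℂ) :=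
      LinearMap.toContinuousLinearMap
        { toFun := fun A => A *ᵥ w
          map_add' := fun A B => Matrix.add_mulVec A B w
          map_smul' := fun c A => Matrix.smul_mulVec c A w }
    refine ⟨fun x => fundamental q z x *ᵥ w, ⟨hvec _ ?_, hvec _ ?_, _,
      (hasSobolevDeriv_fundamental q z).clm L, ae_of_all _ fun x => ?_⟩, 0, by simp, ?_⟩
    · rw [fundamental_zero, Matrix.one_mulVec, hw, Matrix.mulVec_mulVec,
        boundaryMatrix_mul_theta_mul, Matrix.zero_mulVec]
    · rw [Matrix.mulVec_mulVec, hw, Matrix.mulVec_mulVec, Matrix.mul_assoc, ← sMatrix_eq, hsv]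
    · change theta r *ᵥ (((z • -theta r + theta r * blockPotential q x) *
        fundamental q z x) *ᵥ w) + blockPotential q x *ᵥ (fundamental q z x *ᵥ w) =
        z • (fundamental q z x *ᵥ w)
      rw [Matrix.mulVec_mulVec w, Matrix.mulVec_mulVec w, ← Matrix.add_mulVec,
        dirac_equation_fundamental, Matrix.smul_mulVec]
    · dsimp only
      rw [fundamental_zero, Matrix.one_mulVec]
      intro hc
      apply hv
      have := congrArg (fun u => (theta r * (boundaryMatrix r)ᴴ)ᴴ *ᵥ u) hc
      rwa [hw, Matrix.mulVec_mulVec, conjTranspose_theta_mul_boundary, Matrix.one_mulVec,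
        Matrix.mulVec_zero] at this

theorem IsEigenvalue.im_eq_zero {q : Potential r} {z : ℂ} (h : IsEigenvalue q z) : z.im = 0 := by
  by_contra hz
  exact det_sMatrix_ne_zero q hz ((isEigenvalue_iff q z).1 h)

/-! ### The Weyl solution -/

/-- The initial value of the Weyl solution. -/
def weylInitial (q : Potential r) (z : ℂ) : Matrix (Fin r ⊕ Fin r) (Fin r) ℂ :=
  (boundaryMatrix r)ᴴ + theta r * (boundaryMatrix r)ᴴ * weylFunction q z

/-- The Weyl function is the coefficient that makes `c + s m = 0`, which is the boundary condition
at `1` for the Weyl solution. -/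
theorem boundary_weylSolution {q : Potential r} {z : ℂ} (hz : (sMatrix q z).det ≠ 0) :
    boundaryMatrix r * (fundamental q z 1 * weylInitial q z) = 0 := by
  have hu : IsUnit (sMatrix q z).det := isUnit_iff_ne_zero.2 hz
  rw [weylInitial, Matrix.mul_add, Matrix.mul_add, ← cMatrix_eq, ← Matrix.mul_assoc,
    ← Matrix.mul_assoc, Matrix.mul_assoc (boundaryMatrix r), ← sMatrix_eq, weylFunction,
    Matrix.mul_neg, ← Matrix.mul_assoc, Matrix.mul_nonsing_inv _ hu, Matrix.one_mul,
    add_neg_cancel]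

/-- Green's formula for two Weyl solutions: the term at `1` vanishes by isotropy, and the term at
`0` is `m(w)* - m(z)`. This Herglotz identity is the source of the symmetry and the growth bound of
`m`. -/
theorem weylFunction_sub {q : Potential r} {w z : ℂ} (hw : (sMatrix q w).det ≠ 0)
    (hz : (sMatrix q z).det ≠ 0) :
    weylFunction q z - (weylFunction q w)ᴴ =
      (z - star w) • gram q w z (weylInitial q w) (weylInitial q z) := by
  have hg := green_formula q w z (weylInitial q w) (weylInitial q z)
  rw [conjTranspose_mul_theta_mul_eq_zero (boundary_weylSolution hw) (boundary_weylSolution hz)]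
    at hg
  rw [← neg_eq_iff_add_eq_zero.2 hg.symm]
  have e1 : theta r * weylInitial q z =
      theta r * (boundaryMatrix r)ᴴ - (boundaryMatrix r)ᴴ * weylFunction q z := by
    rw [weylInitial, Matrix.mul_add, ← Matrix.mul_assoc, ← Matrix.mul_assoc, theta_mul_theta,
      Matrix.neg_mul, Matrix.neg_mul, Matrix.one_mul, sub_eq_add_neg]
  have e2 : boundaryMatrix r * (theta r * weylInitial q z) = -weylFunction q z := by
    rw [e1, Matrix.mul_sub, boundaryMatrix_mul_theta_mul, ← Matrix.mul_assoc,
      boundaryMatrix_mul_conjTranspose, Matrix.one_mul, zero_sub]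
  have e3 : (theta r * (boundaryMatrix r)ᴴ)ᴴ * (theta r * weylInitial q z) = 1 := by
    rw [e1, Matrix.mul_sub, conjTranspose_theta_mul_boundary, ← Matrix.mul_assoc,
      Matrix.conjTranspose_mul, conjTranspose_theta, Matrix.conjTranspose_conjTranspose,
      Matrix.mul_neg, Matrix.neg_mul, Matrix.mul_assoc (boundaryMatrix r),
      boundaryMatrix_mul_theta_mul]
    simp
  have e4 : (weylInitial q w)ᴴ * (theta r * weylInitial q z) =
      -weylFunction q z + (weylFunction q w)ᴴ := by
    rw [weylInitial, Matrix.conjTranspose_add, Matrix.conjTranspose_mul,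
      Matrix.conjTranspose_conjTranspose, Matrix.add_mul, e2, Matrix.mul_assoc, e3,
      Matrix.mul_one]
  rw [e4, neg_add_rev, neg_neg]
  abel

theorem conjTranspose_weylFunction_star (q : Potential r) {z : ℂ} (hz : z.im ≠ 0) :
    (weylFunction q (star z))ᴴ = weylFunction q z := by
  have h := weylFunction_sub (q := q) (w := star z) (z := z)
    (det_sMatrix_ne_zero q (by simpa using hz)) (det_sMatrix_ne_zero q hz)
  rw [star_star, sub_self, zero_smul, sub_eq_zero] at h
  exact h.symm

/-! ### Asymptotics far from the real axis -/

/-- The `L¹` norm of a potential. -/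
def potentialNorm (q : Potential r) : ℝ := ∫ t in (0 : ℝ)..1, ‖q t‖

theorem potentialNorm_nonneg (q : Potential r) : 0 ≤ potentialNorm q :=
  intervalIntegral.integral_nonneg zero_le_one fun _ _ => norm_nonneg _

/-- The relative error in the asymptotics of solutions. -/
def asymptoticError (q : Potential r) (τ : ℝ) : ℝ :=
  weightBound (fun t => ‖q t‖) τ * (1 + potentialNorm q)

theorem tendsto_asymptoticError (q : Potential r) :
    Tendsto (asymptoticError q) atTop (𝓝 0) := by
  have h := (tendsto_weightBound (fun t => ‖q t‖)).mul_const (1 + potentialNorm q)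
  rw [zero_mul] at h
  exact h

/-- The a priori estimate behind the asymptotics of decaying and growing solutions. -/
theorem bounds_of_coupled_inequalities (q : Potential r) {f g w : ℝ → ℝ} {c τ : ℝ}
    (hf : ContinuousOn f (Icc 0 1)) (hg : ContinuousOn g (Icc 0 1))
    (hf0 : ∀ x ∈ Icc (0 : ℝ) 1, 0 ≤ f x) (hw : Continuous w)
    (hkw : ∫ t in (0 : ℝ)..1, ‖q t‖ * w t ≤ weightBound (fun t => ‖q t‖) τ)
    (hτ : asymptoticError q τ ≤ 1 / 2)
    (h1 : ∀ x ∈ Icc (0 : ℝ) 1, f x ≤ c + ∫ t in (0 : ℝ)..1, ‖q t‖ * g t)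
    (h2 : ∀ B, (∀ t ∈ Icc (0 : ℝ) 1, f t ≤ B) → ∀ x ∈ Icc (0 : ℝ) 1,
      g x ≤ (w x + weightBound (fun t => ‖q t‖) τ) * B) :
    ∫ t in (0 : ℝ)..1, ‖q t‖ * g t ≤ 2 * asymptoticError q τ * c ∧
      ∀ x ∈ Icc (0 : ℝ) 1, g x ≤ (w x + weightBound (fun t => ‖q t‖) τ) * (2 * c) := by
  -- Here `f` stands for the dominant component freed of its exponential, `g` for the subordinate
  -- one, and `w` for a boundary layer. A bound `B` for `f` controls `g` through `h2` and returns
  -- through `h1` as `B ≤ c + B / 2`.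
  obtain ⟨x₀, hx₀, hmax⟩ := isCompact_Icc.exists_isMaxOn (nonempty_Icc.2 zero_le_one) hf
  set ε := weightBound (fun t => ‖q t‖) τ with hε
  set B := f x₀
  have hB0 : 0 ≤ B := hf0 x₀ hx₀
  have hfB : ∀ t ∈ Icc (0 : ℝ) 1, f t ≤ B := fun t ht => hmax ht
  have hki := (memLp_norm_potential q).intervalIntegrable_of_unit (a := 0) (b := 1)
    (by simp) (by simp)
  have hint : ∫ t in (0 : ℝ)..1, ‖q t‖ * g t ≤ asymptoticError q τ * B := by
    calc ∫ t in (0 : ℝ)..1, ‖q t‖ * g t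
        ≤ ∫ t in (0 : ℝ)..1, (‖q t‖ * w t * B + ‖q t‖ * (ε * B)) := by
          refine intervalIntegral.integral_mono_on zero_le_one (hki.mul_continuousOn ?_)
            (((hki.mul_continuousOn hw.continuousOn).mul_const _).add (hki.mul_const _))
            fun t ht => ?_
          · rwa [uIcc_of_le zero_le_one]
          · refine (mul_le_mul_of_nonneg_left (h2 B hfB t ht) (norm_nonneg _)).trans
              (le_of_eq ?_)
            ring
      _ = (∫ t in (0 : ℝ)..1, ‖q t‖ * w t) * B + potentialNorm q * (ε * B) := by
          rw [intervalIntegral.integral_add ((hki.mul_continuousOn hw.continuousOn).mul_const _)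
            (hki.mul_const _), intervalIntegral.integral_mul_const,
            intervalIntegral.integral_mul_const, potentialNorm]
      _ ≤ ε * B + potentialNorm q * (ε * B) := by gcongr
      _ = asymptoticError q τ * B := by rw [asymptoticError, ← hε]; ring
  have hB : B ≤ 2 * c := by
    have h3 := h1 x₀ hx₀
    have h4 : asymptoticError q τ * B ≤ 1 / 2 * B := by gcongr
    change B ≤ _ at h3
    linarith
  have hE : 0 ≤ asymptoticError q τ :=
    mul_nonneg (weightBound_nonneg _ _) (by linarith [potentialNorm_nonneg q])
  refine ⟨hint.trans ?_, fun x hx => h2 _ (fun t ht => (hfB t ht).trans hB) x hx⟩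
  calc asymptoticError q τ * B ≤ asymptoticError q τ * (2 * c) := by gcongr
    _ = _ := by ring

theorem norm_exp_neg_I_mul (z : ℂ) (x : ℝ) :
    ‖Complex.exp (-(Complex.I * z) * x)‖ = Real.exp (z.im * x) := by
  rw [Complex.norm_exp]; simp

theorem norm_exp_I_mul (z : ℂ) (x : ℝ) :
    ‖Complex.exp (Complex.I * z * x)‖ = Real.exp (-(z.im * x)) := by
  rw [Complex.norm_exp]; simp

theorem norm_upper_integrand_le (q : Potential r) (z : ℂ)
    (W : Matrix (Fin r ⊕ Fin r) (Fin r) ℂ) (t : ℝ) :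
    ‖Complex.exp (-(Complex.I * z) * t) • (-Complex.I) • (q t * lower q z W t)‖ ≤
      ‖q t‖ * (Real.exp (z.im * t) * ‖lower q z W t‖) := by
  rw [norm_smul, norm_smul, norm_exp_neg_I_mul, norm_neg, Complex.norm_I, one_mul]
  calc _ ≤ Real.exp (z.im * t) * (‖q t‖ * ‖lower q z W t‖) := by
        gcongr; exact norm_mul_le _ _
    _ = _ := by ring

theorem norm_lower_integrand_le (q : Potential r) (z : ℂ)
    (W : Matrix (Fin r ⊕ Fin r) (Fin r) ℂ) (t : ℝ) :
    ‖Complex.exp (Complex.I * z * t) • Complex.I • ((q t)ᴴ * upper q z W t)‖ ≤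
      ‖q t‖ * (Real.exp (-(z.im * t)) * ‖upper q z W t‖) := by
  rw [norm_smul, norm_smul, norm_exp_I_mul, Complex.norm_I, one_mul]
  calc _ ≤ Real.exp (-(z.im * t)) * (‖q t‖ * ‖upper q z W t‖) := by
        gcongr
        refine (norm_mul_le _ _).trans (le_of_eq ?_)
        rw [Matrix.l2_opNorm_conjTranspose]
    _ = _ := by ring

theorem continuousOn_norm_upper (q : Potential r) (z : ℂ)
    (W : Matrix (Fin r ⊕ Fin r) (Fin r) ℂ) :
    ContinuousOn (fun t => ‖upper q z W t‖) (Icc 0 1) :=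
  (hasSobolevDeriv_upper q z W).continuousOn.norm

theorem continuousOn_norm_lower (q : Potential r) (z : ℂ)
    (W : Matrix (Fin r ⊕ Fin r) (Fin r) ℂ) :
    ContinuousOn (fun t => ‖lower q z W t‖) (Icc 0 1) :=
  (hasSobolevDeriv_lower q z W).continuousOn.norm

theorem intervalIntegrable_potential_mul (q : Potential r) {g : ℝ → ℝ}
    (hg : ContinuousOn g (Icc 0 1)) {a b : ℝ} (ha : a ∈ Icc (0 : ℝ) 1) (hb : b ∈ Icc (0 : ℝ) 1) :
    IntervalIntegrable (fun t => ‖q t‖ * g t) volume a b :=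
  ((memLp_norm_potential q).intervalIntegrable_of_unit ha hb).mul_continuousOn
    (hg.mono (uIcc_subset_Icc ha hb))

theorem norm_exp_smul_upper_sub_le (q : Potential r) (z : ℂ)
    (W : Matrix (Fin r ⊕ Fin r) (Fin r) ℂ) {a b : ℝ} (ha : a ∈ Icc (0 : ℝ) 1)
    (hb : b ∈ Icc (0 : ℝ) 1) (hab : a ≤ b) :
    ‖Complex.exp (-(Complex.I * z) * b) • upper q z W b -
        Complex.exp (-(Complex.I * z) * a) • upper q z W a‖ ≤
      ∫ t in a..b, ‖q t‖ * (Real.exp (z.im * t) * ‖lower q z W t‖) := by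
  rw [(hasSobolevDeriv_exp_upper q z W).sub_eq ha hb]
  refine intervalIntegral.norm_integral_le_of_norm_le hab
    (ae_of_all _ fun t _ => norm_upper_integrand_le q z W t)
    (intervalIntegrable_potential_mul q ?_ ha hb)
  exact ContinuousOn.mul (by fun_prop) (continuousOn_norm_lower q z W)

theorem norm_exp_smul_lower_sub_le (q : Potential r) (z : ℂ)
    (W : Matrix (Fin r ⊕ Fin r) (Fin r) ℂ) {a b : ℝ} (ha : a ∈ Icc (0 : ℝ) 1)
    (hb : b ∈ Icc (0 : ℝ) 1) (hab : a ≤ b) :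
    ‖Complex.exp (Complex.I * z * b) • lower q z W b -
        Complex.exp (Complex.I * z * a) • lower q z W a‖ ≤
      ∫ t in a..b, ‖q t‖ * (Real.exp (-(z.im * t)) * ‖upper q z W t‖) := by
  rw [(hasSobolevDeriv_exp_lower q z W).sub_eq ha hb]
  refine intervalIntegral.norm_integral_le_of_norm_le hab
    (ae_of_all _ fun t _ => norm_lower_integrand_le q z W t)
    (intervalIntegrable_potential_mul q ?_ ha hb)
  exact ContinuousOn.mul (by fun_prop) (continuousOn_norm_upper q z W)

theorem integral_potential_mul_nonneg_mono (q : Potential r) {g : ℝ → ℝ}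
    (hg : ContinuousOn g (Icc 0 1)) (hg0 : ∀ t, 0 ≤ g t) {x : ℝ} (hx : x ∈ Icc (0 : ℝ) 1) :
    ∫ t in (0 : ℝ)..x, ‖q t‖ * g t ≤ ∫ t in (0 : ℝ)..1, ‖q t‖ * g t :=
  intervalIntegral.integral_mono_interval le_rfl hx.1 hx.2
    (ae_of_all _ fun t => mul_nonneg (norm_nonneg _) (hg0 t))
    (intervalIntegrable_potential_mul q hg (by simp) (by simp))

/-- Asymptotics of solutions subject to the boundary condition at `1`. -/
theorem decaying_solution_bounds (q : Potential r) {z : ℂ} (hz : 0 < z.im)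
    (hE : asymptoticError q z.im ≤ 1 / 2) {W : Matrix (Fin r ⊕ Fin r) (Fin r) ℂ}
    (hW : boundaryMatrix r * (fundamental q z 1 * W) = 0) :
    ∀ x ∈ Icc (0 : ℝ) 1,
      ‖Complex.exp (-(Complex.I * z) * x) • upper q z W x - W.toRows₁‖ ≤
        2 * asymptoticError q z.im * ‖W.toRows₁‖ ∧
      Real.exp (z.im * x) * ‖lower q z W x‖ ≤
        (Real.exp (-(2 * z.im * (1 - x))) + weightBound (fun t => ‖q t‖) z.im) *
          (2 * ‖W.toRows₁‖) := by
  set τ := z.im with hτ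
  have hb : upper q z W 1 = lower q z W 1 := boundaryMatrix_mul_eq_zero_iff.1 hW
  have hcu : ContinuousOn (fun x => Real.exp (τ * x) * ‖upper q z W x‖) (Icc 0 1) :=
    ContinuousOn.mul (by fun_prop) (continuousOn_norm_upper q z W)
  have hcl : ContinuousOn (fun x => Real.exp (τ * x) * ‖lower q z W x‖) (Icc 0 1) :=
    ContinuousOn.mul (by fun_prop) (continuousOn_norm_lower q z W)
  have hu : ∀ x ∈ Icc (0 : ℝ) 1,
      ‖Complex.exp (-(Complex.I * z) * x) • upper q z W x - W.toRows₁‖ ≤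
        ∫ t in (0 : ℝ)..1, ‖q t‖ * (Real.exp (τ * t) * ‖lower q z W t‖) := by
    intro x hx
    have h1 := norm_exp_smul_upper_sub_le q z W (a := 0) (by simp) hx hx.1
    rw [upper_zero, Complex.ofReal_zero, mul_zero, Complex.exp_zero, one_smul] at h1
    exact h1.trans (integral_potential_mul_nonneg_mono q hcl (fun _ => by positivity) hx)
  have hk := memLp_norm_potential q
  have hbd := bounds_of_coupled_inequalities q (c := ‖W.toRows₁‖) (τ := τ)
    (w := fun x => Real.exp (-(2 * τ * (1 - x)))) hcu hcl
    (fun x _ => by positivity) (by fun_prop)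
    (integral_mul_exp_left_le hk hz le_rfl zero_le_one le_rfl) hE ?_ ?_
  · exact fun x hx => ⟨(hu x hx).trans hbd.1, hbd.2 x hx⟩
  · intro x hx
    have h1 := hu x hx
    have h2 : Real.exp (τ * x) * ‖upper q z W x‖ =
        ‖Complex.exp (-(Complex.I * z) * x) • upper q z W x‖ := by
      rw [norm_smul, norm_exp_neg_I_mul]
    rw [h2]
    have := norm_le_norm_add_norm_sub' (Complex.exp (-(Complex.I * z) * x) • upper q z W x)
      W.toRows₁
    linarith
  · intro B hB x hx
    -- The subordinate component is integrated backwards from `1`, where the boundary condition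
    -- equates it with the dominant one; hence the layer `exp (-2τ(1 - x))`.
    have h1 := norm_exp_smul_lower_sub_le q z W hx (b := 1) (by simp) hx.2
    have h2 : ‖Complex.exp (Complex.I * z * x) • lower q z W x‖ ≤
        ‖Complex.exp (Complex.I * z * (1 : ℝ)) • lower q z W 1‖ +
        ∫ t in x..1, ‖q t‖ * (Real.exp (-(z.im * t)) * ‖upper q z W t‖) := by
      have := norm_le_norm_add_norm_sub (Complex.exp (Complex.I * z * (1 : ℝ)) • lower q z W 1)
        (Complex.exp (Complex.I * z * x) • lower q z W x)
      linarith
    rw [norm_smul, norm_smul, norm_exp_I_mul, norm_exp_I_mul, ← hb, ← hτ] at h2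
    have hub : ∀ t ∈ Icc (0 : ℝ) 1, ‖upper q z W t‖ ≤ Real.exp (-(τ * t)) * B := by
      intro t ht
      calc ‖upper q z W t‖ = Real.exp (-(τ * t)) * (Real.exp (τ * t) * ‖upper q z W t‖) := by
            rw [← mul_assoc, ← Real.exp_add]; simp
        _ ≤ _ := by gcongr; exact hB t ht
    have h3 : ∫ t in x..1, ‖q t‖ * (Real.exp (-(τ * t)) * ‖upper q z W t‖) ≤
        Real.exp (-(2 * τ * x)) * B * weightBound (fun t => ‖q t‖) τ := by
      have hB0 : 0 ≤ B := le_trans (by positivity) (hB 0 (by simp))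
      calc _ ≤ ∫ t in x..1, Real.exp (-(2 * τ * x)) * B *
              (‖q t‖ * Real.exp (-(2 * τ * (t - x)))) := by
            refine intervalIntegral.integral_mono_on hx.2
              (intervalIntegrable_potential_mul q
                (ContinuousOn.mul (by fun_prop) (continuousOn_norm_upper q z W)) hx (by simp))
              ((intervalIntegrable_potential_mul q (by fun_prop) hx (by simp)).const_mul _)
              fun t ht => ?_
            have e1 : Real.exp (-(2 * τ * x)) * Real.exp (-(2 * τ * (t - x))) =
                Real.exp (-(τ * t)) * Real.exp (-(τ * t)) := by
              rw [← Real.exp_add, ← Real.exp_add]; ring_nf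
            calc _ ≤ ‖q t‖ * (Real.exp (-(τ * t)) * (Real.exp (-(τ * t)) * B)) := by
                  gcongr; exact hub t ⟨hx.1.trans ht.1, ht.2⟩
              _ = (Real.exp (-(τ * t)) * Real.exp (-(τ * t))) * B * ‖q t‖ := by ring
              _ = _ := by rw [← e1]; ring
        _ = Real.exp (-(2 * τ * x)) * B *
              ∫ t in x..1, ‖q t‖ * Real.exp (-(2 * τ * (t - x))) :=
            intervalIntegral.integral_const_mul _ _
        _ ≤ _ := by
            gcongr
            exact integral_mul_exp_right_le hk hz hx.1 hx.2 le_rfl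
    have h4 := hub 1 (by simp)
    calc Real.exp (τ * x) * ‖lower q z W x‖
        = Real.exp (2 * τ * x) * (Real.exp (-(τ * x)) * ‖lower q z W x‖) := by
          rw [← mul_assoc, ← Real.exp_add]; ring_nf
      _ ≤ Real.exp (2 * τ * x) * (Real.exp (-(τ * 1)) * (Real.exp (-(τ * 1)) * B) +
            Real.exp (-(2 * τ * x)) * B * weightBound (fun t => ‖q t‖) τ) := by
          gcongr
          exact h2.trans (add_le_add (by gcongr) h3)
      _ = (Real.exp (2 * τ * x) * Real.exp (-(τ * 1)) * Real.exp (-(τ * 1)) +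
            Real.exp (2 * τ * x) * Real.exp (-(2 * τ * x)) *
              weightBound (fun t => ‖q t‖) τ) * B := by ring
      _ = _ := by
          rw [← Real.exp_add, ← Real.exp_add, ← Real.exp_add, add_neg_cancel, Real.exp_zero,
            one_mul]
          ring_nf

/-- Asymptotics of solutions subject to the boundary condition at `0`. -/
theorem growing_solution_bounds (q : Potential r) {z : ℂ} (hz : 0 < z.im)
    (hE : asymptoticError q z.im ≤ 1 / 2) {W : Matrix (Fin r ⊕ Fin r) (Fin r) ℂ}
    (hW : W.toRows₁ = W.toRows₂) :
    ∀ x ∈ Icc (0 : ℝ) 1,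
      ‖Complex.exp (Complex.I * z * x) • lower q z W x - W.toRows₂‖ ≤
        2 * asymptoticError q z.im * ‖W.toRows₂‖ ∧
      Real.exp (-(z.im * x)) * ‖upper q z W x‖ ≤
        (Real.exp (-(2 * z.im * (x - 0))) + weightBound (fun t => ‖q t‖) z.im) *
          (2 * ‖W.toRows₂‖) := by
  set τ := z.im with hτ
  have hcu : ContinuousOn (fun x => Real.exp (-(τ * x)) * ‖upper q z W x‖) (Icc 0 1) :=
    ContinuousOn.mul (by fun_prop) (continuousOn_norm_upper q z W)
  have hcl : ContinuousOn (fun x => Real.exp (-(τ * x)) * ‖lower q z W x‖) (Icc 0 1) :=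
    ContinuousOn.mul (by fun_prop) (continuousOn_norm_lower q z W)
  have hl : ∀ x ∈ Icc (0 : ℝ) 1,
      ‖Complex.exp (Complex.I * z * x) • lower q z W x - W.toRows₂‖ ≤
        ∫ t in (0 : ℝ)..1, ‖q t‖ * (Real.exp (-(τ * t)) * ‖upper q z W t‖) := by
    intro x hx
    have h1 := norm_exp_smul_lower_sub_le q z W (a := 0) (by simp) hx hx.1
    rw [lower_zero, Complex.ofReal_zero, mul_zero, Complex.exp_zero, one_smul] at h1
    exact h1.trans (integral_potential_mul_nonneg_mono q hcu (fun _ => by positivity) hx)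
  have hk := memLp_norm_potential q
  have hbd := bounds_of_coupled_inequalities q (c := ‖W.toRows₂‖) (τ := τ)
    (w := fun x => Real.exp (-(2 * τ * (x - 0)))) hcl hcu
    (fun x _ => by positivity) (by fun_prop)
    (integral_mul_exp_right_le hk hz le_rfl zero_le_one le_rfl) hE ?_ ?_
  · exact fun x hx => ⟨(hl x hx).trans hbd.1, hbd.2 x hx⟩
  · intro x hx
    have h1 := hl x hx
    have h2 : Real.exp (-(τ * x)) * ‖lower q z W x‖ =
        ‖Complex.exp (Complex.I * z * x) • lower q z W x‖ := by
      rw [norm_smul, norm_exp_I_mul]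
    rw [h2]
    have := norm_le_norm_add_norm_sub' (Complex.exp (Complex.I * z * x) • lower q z W x)
      W.toRows₂
    linarith
  · intro B hB x hx
    -- Now the upper component is subordinate, and it is integrated forwards from `0`, where both
    -- components agree.
    have h1 := norm_exp_smul_upper_sub_le q z W (a := 0) (by simp) hx hx.1
    rw [upper_zero, Complex.ofReal_zero, mul_zero, Complex.exp_zero, one_smul, hW] at h1
    have hc : ‖W.toRows₂‖ ≤ B := by simpa [lower_zero] using hB 0 (by simp)
    have h2 : ‖Complex.exp (-(Complex.I * z) * x) • upper q z W x‖ ≤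
        B + ∫ t in (0 : ℝ)..x, ‖q t‖ * (Real.exp (z.im * t) * ‖lower q z W t‖) := by
      have := norm_le_norm_add_norm_sub' (Complex.exp (-(Complex.I * z) * x) • upper q z W x)
        W.toRows₂
      linarith
    rw [norm_smul, norm_exp_neg_I_mul, ← hτ] at h2
    have hlb : ∀ t ∈ Icc (0 : ℝ) 1, ‖lower q z W t‖ ≤ Real.exp (τ * t) * B := by
      intro t ht
      calc ‖lower q z W t‖ = Real.exp (τ * t) * (Real.exp (-(τ * t)) * ‖lower q z W t‖) := by
            rw [← mul_assoc, ← Real.exp_add]; simp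
        _ ≤ _ := by gcongr; exact hB t ht
    have h3 : ∫ t in (0 : ℝ)..x, ‖q t‖ * (Real.exp (τ * t) * ‖lower q z W t‖) ≤
        Real.exp (2 * τ * x) * B * weightBound (fun t => ‖q t‖) τ := by
      have hB0 : 0 ≤ B := le_trans (by positivity) (hB 0 (by simp))
      calc _ ≤ ∫ t in (0 : ℝ)..x, Real.exp (2 * τ * x) * B *
              (‖q t‖ * Real.exp (-(2 * τ * (x - t)))) := by
            refine intervalIntegral.integral_mono_on hx.1
              (intervalIntegrable_potential_mul q
                (ContinuousOn.mul (by fun_prop) (continuousOn_norm_lower q z W)) (by simp) hx)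
              ((intervalIntegrable_potential_mul q (by fun_prop) (by simp) hx).const_mul _)
              fun t ht => ?_
            have e1 : Real.exp (2 * τ * x) * Real.exp (-(2 * τ * (x - t))) =
                Real.exp (τ * t) * Real.exp (τ * t) := by
              rw [← Real.exp_add, ← Real.exp_add]; ring_nf
            calc _ ≤ ‖q t‖ * (Real.exp (τ * t) * (Real.exp (τ * t) * B)) := by
                  gcongr; exact hlb t ⟨ht.1, ht.2.trans hx.2⟩
              _ = (Real.exp (τ * t) * Real.exp (τ * t)) * B * ‖q t‖ := by ring
              _ = _ := by rw [← e1]; ring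
        _ = Real.exp (2 * τ * x) * B *
              ∫ t in (0 : ℝ)..x, ‖q t‖ * Real.exp (-(2 * τ * (x - t))) :=
            intervalIntegral.integral_const_mul _ _
        _ ≤ _ := by
            gcongr
            exact integral_mul_exp_left_le hk hz le_rfl hx.1 hx.2
    calc Real.exp (-(τ * x)) * ‖upper q z W x‖
        = Real.exp (-(2 * τ * x)) * (Real.exp (τ * x) * ‖upper q z W x‖) := by
          rw [← mul_assoc, ← Real.exp_add]; ring_nf
      _ ≤ Real.exp (-(2 * τ * x)) * (B +
            Real.exp (2 * τ * x) * B * weightBound (fun t => ‖q t‖) τ) := by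
          gcongr
          exact h2.trans (by gcongr)
      _ = (Real.exp (-(2 * τ * x)) + Real.exp (-(2 * τ * x)) * Real.exp (2 * τ * x) *
              weightBound (fun t => ‖q t‖) τ) * B := by ring
      _ = _ := by
          rw [← Real.exp_add, neg_add_cancel, Real.exp_zero, one_mul, sub_zero]

/-- The filter of neighbourhoods of `+i∞`, uniform in the real part. -/
abbrev upperInfinity : Filter ℂ := comap Complex.im atTop

theorem eventually_upperInfinity_im_gt (C : ℝ) : ∀ᶠ z in upperInfinity, C < z.im :=
  tendsto_comap.eventually (eventually_gt_atTop C)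

instance upperInfinity_neBot : NeBot upperInfinity :=
  NeBot.comap_of_surj inferInstance fun y => ⟨⟨0, y⟩, rfl⟩

/-- The sum of the decaying exponential and the weighted bound. -/
theorem tendsto_exp_add_weightBound (q : Potential r) {c : ℝ} (hc : 0 < c) :
    Tendsto (fun z : ℂ => Real.exp (-(2 * z.im * c)) + weightBound (fun t => ‖q t‖) z.im)
      upperInfinity (𝓝 0) := by
  have h1 : Tendsto (fun τ : ℝ => Real.exp (-(2 * τ * c))) atTop (𝓝 0) := by
    refine Real.tendsto_exp_neg_atTop_nhds_zero.comp ?_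
    exact (tendsto_id.const_mul_atTop (by norm_num : (0 : ℝ) < 2)).atTop_mul_const hc
  have h2 := (h1.add (tendsto_weightBound (fun t => ‖q t‖))).comp
    (tendsto_comap : Tendsto Complex.im upperInfinity atTop)
  rw [add_zero] at h2
  exact h2

theorem tendsto_asymptoticError_upperInfinity (q : Potential r) :
    Tendsto (fun z : ℂ => asymptoticError q z.im) upperInfinity (𝓝 0) :=
  (tendsto_asymptoticError q).comp tendsto_comap

/-- The error is relative to `f` itself, which is not known to be bounded. Once `|ρ| ≤ 1/2` it
follows that `‖f‖ ≤ 2‖a‖`, and the error becomes absolute. -/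
theorem tendsto_of_norm_sub_le_mul_norm {α E : Type*} [NormedAddCommGroup E]
    {l : Filter α} {f : α → E} {a : E} {ρ : α → ℝ} (hρ : Tendsto ρ l (𝓝 0))
    (h : ∀ᶠ x in l, ‖f x - a‖ ≤ ρ x * ‖f x‖) : Tendsto f l (𝓝 a) := by
  rw [tendsto_iff_norm_sub_tendsto_zero]
  refine squeeze_zero' (Eventually.of_forall fun _ => norm_nonneg _)
    (g := fun x => |ρ x| * (2 * ‖a‖)) ?_ ?_
  · have h' : ∀ᶠ x in l, |ρ x| ≤ 1 / 2 :=
      hρ.abs.eventually (ge_mem_nhds (by rw [abs_zero]; exact one_half_pos))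
    filter_upwards [h, h'] with x h1 h2
    have h3 : ‖f x‖ ≤ ‖a‖ + ‖f x - a‖ := norm_le_norm_add_norm_sub' _ _
    have h4 : ρ x * ‖f x‖ ≤ |ρ x| * ‖f x‖ := by gcongr; exact le_abs_self _
    have h5 : |ρ x| * ‖f x‖ ≤ 1 / 2 * ‖f x‖ := by gcongr
    have h6 : ‖f x‖ ≤ 2 * ‖a‖ := by linarith
    calc ‖f x - a‖ ≤ |ρ x| * ‖f x‖ := h1.trans h4
      _ ≤ _ := by gcongr
  · simpa using hρ.abs.mul_const (2 * ‖a‖)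

/-! ### The Weyl solution and the Weyl function at `+i∞` -/

theorem toRows₁_weylInitial (q : Potential r) (z : ℂ) :
    (weylInitial q z).toRows₁ =
      ((1 / Real.sqrt 2 : ℝ) : ℂ) • (1 - Complex.I • weylFunction q z) := by
  have h : (weylInitial q z).toRows₁ = ((boundaryMatrix r)ᴴ).toRows₁ +
      (theta r * ((boundaryMatrix r)ᴴ * weylFunction q z)).toRows₁ := by
    rw [weylInitial, Matrix.mul_assoc]; rfl
  have h2 : ((boundaryMatrix r)ᴴ * weylFunction q z).toRows₁ =
      ((boundaryMatrix r)ᴴ).toRows₁ * weylFunction q z := rfl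
  rw [h, toRows₁_theta_mul, h2, toRows₁_conjTranspose_boundaryMatrix, Matrix.smul_mul,
    Matrix.one_mul, smul_sub, neg_smul, sub_eq_add_neg, smul_comm]

theorem toRows₂_weylInitial (q : Potential r) (z : ℂ) :
    (weylInitial q z).toRows₂ =
      -(((1 / Real.sqrt 2 : ℝ) : ℂ) • (1 + Complex.I • weylFunction q z)) := by
  have h : (weylInitial q z).toRows₂ = ((boundaryMatrix r)ᴴ).toRows₂ +
      (theta r * ((boundaryMatrix r)ᴴ * weylFunction q z)).toRows₂ := by
    rw [weylInitial, Matrix.mul_assoc]; rfl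
  have h2 : ((boundaryMatrix r)ᴴ * weylFunction q z).toRows₂ =
      ((boundaryMatrix r)ᴴ).toRows₂ * weylFunction q z := rfl
  rw [h, toRows₂_theta_mul, h2, toRows₂_conjTranspose_boundaryMatrix, Matrix.neg_mul,
    Matrix.smul_mul, Matrix.one_mul, smul_add, neg_add, smul_neg, smul_comm]

theorem eventually_decaying_bounds (q : Potential r) :
    ∀ᶠ z in upperInfinity, ∀ x ∈ Icc (0 : ℝ) 1,
      ‖Complex.exp (-(Complex.I * z) * x) • upper q z (weylInitial q z) x -
          (weylInitial q z).toRows₁‖ ≤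
        2 * asymptoticError q z.im * ‖(weylInitial q z).toRows₁‖ ∧
      Real.exp (z.im * x) * ‖lower q z (weylInitial q z) x‖ ≤
        (Real.exp (-(2 * z.im * (1 - x))) + weightBound (fun t => ‖q t‖) z.im) *
          (2 * ‖(weylInitial q z).toRows₁‖) := by
  filter_upwards [eventually_upperInfinity_im_gt 0,
    (tendsto_asymptoticError_upperInfinity q).eventually
      (ge_mem_nhds (one_half_pos (α := ℝ)))] with z hz hE
  exact decaying_solution_bounds q hz hE (boundary_weylSolution (det_sMatrix_ne_zero q hz.ne'))

/-- The lower half of the initial value differs from the upper half by a constant matrix, whatever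
`m` is. The decay estimate at `x = 0` makes the lower half small relative to the upper one, so the
upper half tends to that constant. -/
theorem tendsto_toRows₁_weylInitial (q : Potential r) :
    Tendsto (fun z => (weylInitial q z).toRows₁) upperInfinity
      (𝓝 ((2 * ((1 / Real.sqrt 2 : ℝ) : ℂ)) • 1)) := by
  refine tendsto_of_norm_sub_le_mul_norm
    (ρ := fun z : ℂ => 2 * (Real.exp (-(2 * z.im * 1)) + weightBound (fun t => ‖q t‖) z.im))
    ?_ ?_
  · simpa using (tendsto_exp_add_weightBound q one_pos).const_mul 2
  · filter_upwards [eventually_decaying_bounds q] with z hz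
    have h := (hz 0 (by simp)).2
    rw [mul_zero, Real.exp_zero, one_mul, sub_zero, lower_zero] at h
    have e : (weylInitial q z).toRows₁ - (2 * ((1 / Real.sqrt 2 : ℝ) : ℂ)) • 1 =
        (weylInitial q z).toRows₂ := by
      rw [toRows₁_weylInitial, toRows₂_weylInitial, two_mul, add_smul, smul_sub, smul_add]
      abel
    rw [e]
    exact h.trans (le_of_eq (by ring))

theorem weylFunction_eq_toRows₁ (q : Potential r) (z : ℂ) :
    weylFunction q z = Complex.I • (((Real.sqrt 2 : ℝ) : ℂ) • (weylInitial q z).toRows₁ - 1) := by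
  have h2 : ((Real.sqrt 2 : ℝ) : ℂ) * ((1 / Real.sqrt 2 : ℝ) : ℂ) = 1 := by
    rw [← Complex.ofReal_mul, mul_one_div_cancel (by positivity), Complex.ofReal_one]
  rw [toRows₁_weylInitial, smul_smul, h2, one_smul, sub_sub_cancel_left, smul_neg, smul_smul,
    Complex.I_mul_I, neg_smul, one_smul, neg_neg]

theorem sqrt_two_mul_two_mul_inv :
    ((Real.sqrt 2 : ℝ) : ℂ) * (2 * ((1 / Real.sqrt 2 : ℝ) : ℂ)) = 2 := by
  rw [mul_left_comm, ← Complex.ofReal_mul, mul_one_div_cancel (by positivity),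
    Complex.ofReal_one, mul_one]

/-- The Weyl function tends to `i` at `+i∞`. -/
theorem tendsto_weylFunction (q : Potential r) :
    Tendsto (weylFunction q) upperInfinity (𝓝 (Complex.I • 1)) := by
  have h := (((tendsto_toRows₁_weylInitial q).const_smul ((Real.sqrt 2 : ℝ) : ℂ)).sub_const
    1).const_smul Complex.I
  have e : ((Real.sqrt 2 : ℝ) : ℂ) • (2 * ((1 / Real.sqrt 2 : ℝ) : ℂ)) •
      (1 : Matrix (Fin r) (Fin r) ℂ) - 1 = 1 := by
    rw [smul_smul, sqrt_two_mul_two_mul_inv, two_smul, add_sub_cancel_right]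
  rw [e] at h
  refine h.congr fun z => ?_
  exact (weylFunction_eq_toRows₁ q z).symm

/-- Assembling a block matrix as a continuous linear map. -/
def blocksCLM (r : ℕ) : ((Matrix (Fin r) (Fin r) ℂ × Matrix (Fin r) (Fin r) ℂ) ×
    (Matrix (Fin r) (Fin r) ℂ × Matrix (Fin r) (Fin r) ℂ)) →L[ℂ]
      Matrix (Fin r ⊕ Fin r) (Fin r ⊕ Fin r) ℂ :=
  LinearMap.toContinuousLinearMap
    { toFun := fun A => Matrix.fromBlocks A.1.1 A.1.2 A.2.1 A.2.2
      map_add' := fun A B => by simp [Matrix.fromBlocks_add]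
      map_smul' := fun c A => by simp [Matrix.fromBlocks_smul] }

theorem blocksCLM_apply (A B C D : Matrix (Fin r) (Fin r) ℂ) :
    blocksCLM r ((A, B), (C, D)) = Matrix.fromBlocks A B C D := rfl

/-- The normalized initial values of the decaying and the growing solution. -/
def weylFrame (m : Matrix (Fin r) (Fin r) ℂ) (z : ℂ) (x : ℝ) :
    Matrix (Fin r ⊕ Fin r) (Fin r ⊕ Fin r) ℂ :=
  Matrix.fromCols
    ((((1 / Real.sqrt 2 : ℝ) : ℂ) * Complex.exp (-(Complex.I * z) * x)) •
      ((boundaryMatrix r)ᴴ + theta r * (boundaryMatrix r)ᴴ * m))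
    ((Complex.I * (Real.sqrt 2 : ℝ) * Complex.exp (Complex.I * z * x)) •
      (theta r * (boundaryMatrix r)ᴴ))

theorem fundamental_mul_weylFrame (q : Potential r) (z : ℂ) (x : ℝ) :
    fundamental q z x * weylFrame (weylFunction q z) z x = blocksCLM r
      ((((1 / Real.sqrt 2 : ℝ) : ℂ) •
          (Complex.exp (-(Complex.I * z) * x) • upper q z (weylInitial q z) x),
        (Complex.I * (Real.sqrt 2 : ℝ)) • (Complex.exp (Complex.I * z * x) •
          upper q z (theta r * (boundaryMatrix r)ᴴ) x)),
       (((1 / Real.sqrt 2 : ℝ) : ℂ) •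
          (Complex.exp (-(Complex.I * z) * x) • lower q z (weylInitial q z) x),
        (Complex.I * (Real.sqrt 2 : ℝ)) • (Complex.exp (Complex.I * z * x) •
          lower q z (theta r * (boundaryMatrix r)ᴴ) x))) := by
  rw [blocksCLM_apply, weylFrame, Matrix.mul_fromCols, Matrix.mul_smul, Matrix.mul_smul]
  simp only [smul_smul]
  ext (i | i) (j | j) <;> rfl

/-- At interior points the normalized frame is asymptotically trivial. -/
theorem tendsto_fundamental_mul_weylFrame (q : Potential r) {x : ℝ} (hx : x ∈ Ioo (0 : ℝ) 1) :
    Tendsto (fun z => fundamental q z x * weylFrame (weylFunction q z) z x) upperInfinity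
      (𝓝 1) := by
  have hx' := Ioo_subset_Icc_self hx
  set W := theta r * (boundaryMatrix r)ᴴ with hW
  have hW1 : W.toRows₁ = (-Complex.I * ((1 / Real.sqrt 2 : ℝ) : ℂ)) • 1 := by
    rw [hW, toRows₁_theta_mul, toRows₁_conjTranspose_boundaryMatrix, smul_smul]
  have hW2 : W.toRows₂ = (-Complex.I * ((1 / Real.sqrt 2 : ℝ) : ℂ)) • 1 := by
    rw [hW, toRows₂_theta_mul, toRows₂_conjTranspose_boundaryMatrix, smul_neg, smul_smul,
      neg_mul, neg_smul]
  -- The scalars in `weylFrame` are chosen to turn both diagonal limits into the identity: `hs` for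
  -- the decaying column, `e2` below for the growing one.
  have hs : ((1 / Real.sqrt 2 : ℝ) : ℂ) * (2 * ((1 / Real.sqrt 2 : ℝ) : ℂ)) = 1 := by
    rw [mul_left_comm, inv_sqrt_two_sq]; norm_num
  have hgrow : ∀ᶠ z in upperInfinity,
      ‖Complex.exp (Complex.I * z * x) • lower q z W x - W.toRows₂‖ ≤
        2 * asymptoticError q z.im * ‖W.toRows₂‖ ∧
      Real.exp (-(z.im * x)) * ‖upper q z W x‖ ≤
        (Real.exp (-(2 * z.im * (x - 0))) + weightBound (fun t => ‖q t‖) z.im) *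
          (2 * ‖W.toRows₂‖) := by
    filter_upwards [eventually_upperInfinity_im_gt 0,
      (tendsto_asymptoticError_upperInfinity q).eventually
        (ge_mem_nhds (one_half_pos (α := ℝ)))] with z hz hE
    exact growing_solution_bounds q hz hE (hW1.trans hW2.symm) x hx'
  have hE0 := tendsto_asymptoticError_upperInfinity q
  have hc := (tendsto_toRows₁_weylInitial q)
  have t11 : Tendsto (fun z => Complex.exp (-(Complex.I * z) * x) •
      upper q z (weylInitial q z) x) upperInfinity
      (𝓝 ((2 * ((1 / Real.sqrt 2 : ℝ) : ℂ)) • 1)) := by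
    have h0 : Tendsto (fun z => Complex.exp (-(Complex.I * z) * x) •
        upper q z (weylInitial q z) x - (weylInitial q z).toRows₁) upperInfinity (𝓝 0) := by
      refine squeeze_zero_norm' ((eventually_decaying_bounds q).mono fun z hz => (hz x hx').1) ?_
      simpa using (hE0.const_mul 2).mul hc.norm
    simpa using h0.add hc
  -- The off-diagonal limits need an interior point: the layers `exp (-2τ(1 - x))` here and `exp
  -- (-2τx)` in `t12` do not decay at `x = 1` and `x = 0` respectively.
  have t21 : Tendsto (fun z => Complex.exp (-(Complex.I * z) * x) •
      lower q z (weylInitial q z) x) upperInfinity (𝓝 0) := by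
    refine squeeze_zero_norm' ((eventually_decaying_bounds q).mono fun z hz => ?_)
      (by simpa using (tendsto_exp_add_weightBound q (sub_pos.2 hx.2)).mul (hc.norm.const_mul 2))
    rw [norm_smul, norm_exp_neg_I_mul]
    exact (hz x hx').2
  have t12 : Tendsto (fun z => Complex.exp (Complex.I * z * x) • upper q z W x) upperInfinity
      (𝓝 0) := by
    have h0 := (tendsto_exp_add_weightBound q (sub_pos.2 hx.1)).mul_const (2 * ‖W.toRows₂‖)
    rw [zero_mul] at h0
    refine squeeze_zero_norm' (hgrow.mono fun z hz => ?_) h0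
    rw [norm_smul, norm_exp_I_mul]
    exact hz.2
  have t22 : Tendsto (fun z => Complex.exp (Complex.I * z * x) • lower q z W x) upperInfinity
      (𝓝 W.toRows₂) := by
    rw [tendsto_iff_norm_sub_tendsto_zero]
    refine squeeze_zero' (Eventually.of_forall fun _ => norm_nonneg _)
      (hgrow.mono fun z hz => hz.1) ?_
    simpa using (hE0.const_mul 2).mul_const ‖W.toRows₂‖
  have hall := ((blocksCLM r).continuous.tendsto _).comp
    (((t11.const_smul ((1 / Real.sqrt 2 : ℝ) : ℂ)).prodMk_nhds
      (t12.const_smul (Complex.I * (Real.sqrt 2 : ℝ)))).prodMk_nhds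
    ((t21.const_smul ((1 / Real.sqrt 2 : ℝ) : ℂ)).prodMk_nhds
      (t22.const_smul (Complex.I * (Real.sqrt 2 : ℝ)))))
  have e2 : Complex.I * ((Real.sqrt 2 : ℝ) : ℂ) * (-Complex.I * ((1 / Real.sqrt 2 : ℝ) : ℂ)) = 1 := by
    have : ((Real.sqrt 2 : ℝ) : ℂ) * ((1 / Real.sqrt 2 : ℝ) : ℂ) = 1 := by
      rw [← Complex.ofReal_mul, mul_one_div_cancel (by positivity), Complex.ofReal_one]
    calc _ = -(Complex.I * Complex.I) *
          (((Real.sqrt 2 : ℝ) : ℂ) * ((1 / Real.sqrt 2 : ℝ) : ℂ)) := by ring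
      _ = 1 := by rw [this, Complex.I_mul_I]; norm_num
  rw [hW2, smul_smul, smul_smul, hs, e2, one_smul, smul_zero, smul_zero, blocksCLM_apply,
    Matrix.fromBlocks_one] at hall
  exact hall.congr fun z => (fundamental_mul_weylFrame q z x).symm

/-! ### Solutions with the same Weyl function -/

/-- The transition matrix `u_p u_q⁻¹`. -/
def transition (p q : Potential r) (x : ℝ) (z : ℂ) :
    Matrix (Fin r ⊕ Fin r) (Fin r ⊕ Fin r) ℂ :=
  fundamental p z x * Ring.inverse (fundamental q z x)

theorem differentiable_ring_inverse {R : Type*} [NormedRing R] [NormedAlgebra ℂ R]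
    [CompleteSpace R] {f : ℂ → R} (hf : Differentiable ℂ f) (h : ∀ z, IsUnit (f z)) :
    Differentiable ℂ fun z => Ring.inverse (f z) := fun z =>
  (differentiableAt_inverse (𝕜 := ℂ) (h z)).comp z (hf z)

theorem differentiable_transition (p q : Potential r) {x : ℝ} (hx : x ∈ Icc (0 : ℝ) 1) :
    Differentiable ℂ (transition p q x) :=
  (differentiable_fundamental p x).mul
    (differentiable_ring_inverse (differentiable_fundamental q x)
      fun z => isUnit_fundamental q z hx)

/-- The frame `F` depends on the potential only through `m`, so it is common to both. Thus `u_p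
u_q⁻¹ = (u_p F)(u_q F)⁻¹`, where both factors tend to `1` although the frame itself contains growing
exponentials. -/
theorem tendsto_transition {p q : Potential r}
    (h : ∀ z : ℂ, z.im ≠ 0 → weylFunction p z = weylFunction q z) {x : ℝ}
    (hx : x ∈ Ioo (0 : ℝ) 1) : Tendsto (transition p q x) upperInfinity (𝓝 1) := by
  have hx' := Ioo_subset_Icc_self hx
  have hp := tendsto_fundamental_mul_weylFrame p hx
  have hq := tendsto_fundamental_mul_weylFrame q hx
  have hinv : Tendsto (fun z => Ring.inverse
      (fundamental q z x * weylFrame (weylFunction q z) z x)) upperInfinity (𝓝 1) := by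
    have h1 := (NormedRing.inverse_continuousAt
      (1 : (Matrix (Fin r ⊕ Fin r) (Fin r ⊕ Fin r) ℂ)ˣ)).tendsto
    rw [Units.val_one, Ring.inverse_one] at h1
    exact h1.comp hq
  have hu : ∀ᶠ z in upperInfinity,
      IsUnit (fundamental q z x * weylFrame (weylFunction q z) z x) :=
    hq.eventually (Units.nhds (1 : (Matrix (Fin r ⊕ Fin r) (Fin r ⊕ Fin r) ℂ)ˣ))
  have hmul := hp.mul hinv
  rw [mul_one] at hmul
  refine hmul.congr' ?_
  filter_upwards [hu, eventually_upperInfinity_im_gt 0] with z hz him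
  have e : fundamental p z x * weylFrame (weylFunction p z) z x =
      transition p q x z * (fundamental q z x * weylFrame (weylFunction q z) z x) := by
    rw [transition, mul_assoc, ← mul_assoc (Ring.inverse _),
      Ring.inverse_mul_cancel _ (isUnit_fundamental q z hx'), one_mul, h z him.ne']
  rw [e, mul_assoc, Ring.mul_inverse_cancel _ hz, mul_one]

/-- Because `u(z)⁻¹ = -ϑ u(z̄)* ϑ`, taking adjoints exchanges the potentials and reflects `z`; this
transfers the limit at `+i∞` to `-i∞`. -/
theorem conjTranspose_transition (p q : Potential r) {x : ℝ} (hx : x ∈ Icc (0 : ℝ) 1) (z : ℂ) :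
    (transition p q x z)ᴴ = -theta r * transition q p x (star z) * theta r := by
  have hp := inverse_fundamental p (star z) hx
  rw [star_star] at hp
  rw [transition, transition, hp, inverse_fundamental q z hx]
  simp only [Matrix.conjTranspose_mul, Matrix.conjTranspose_neg, conjTranspose_theta,
    Matrix.conjTranspose_conjTranspose, neg_neg]
  simp only [neg_mul, mul_neg, mul_assoc, theta_mul_theta, mul_one, neg_neg]

theorem tendsto_transition_lower {p q : Potential r}
    (h : ∀ z : ℂ, z.im ≠ 0 → weylFunction p z = weylFunction q z) {x : ℝ}
    (hx : x ∈ Ioo (0 : ℝ) 1) :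
    Tendsto (fun z => transition p q x (star z)) upperInfinity (𝓝 1) := by
  have h1 := tendsto_transition (fun z hz => (h z hz).symm) hx
  have h2 := ((h1.const_mul (-theta r)).mul_const (theta r))
  rw [mul_one, neg_mul, theta_mul_theta, neg_neg] at h2
  have h3 := (continuous_star.tendsto (1 : Matrix (Fin r ⊕ Fin r) (Fin r ⊕ Fin r) ℂ)).comp h2
  rw [star_one] at h3
  refine h3.congr fun z => ?_
  have h4 := conjTranspose_transition p q (Ioo_subset_Icc_self hx) (star z)
  rw [star_star] at h4
  rw [Function.comp_apply, ← h4, Matrix.star_eq_conjTranspose,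
    Matrix.conjTranspose_conjTranspose]

/-- Solutions are bounded on horizontal strips. -/
theorem exists_norm_solution_le (q : Potential r) (C : ℝ)
    (W : Matrix (Fin r ⊕ Fin r) (Fin r) ℂ) :
    ∃ K, ∀ z : ℂ, |z.im| ≤ C → ∀ x ∈ Icc (0 : ℝ) 1,
      ‖upper q z W x‖ + ‖lower q z W x‖ ≤ K := by
  -- On the strip every exponential is at most `exp C`. Two of them enter variation of constants,
  -- one inside the integral and one when the exponential is divided out.
  set k : ℝ → ℝ := fun t => Real.exp (2 * C) * ‖q t‖ with hk
  have hkm : MemLp k 2 unitMeasure := (memLp_norm_potential q).const_mul _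
  obtain ⟨τ, hτ, hkτ⟩ := exists_weightBound_le k (one_half_pos (α := ℝ))
  refine ⟨2 * (Real.exp C * (‖W.toRows₁‖ + ‖W.toRows₂‖)) * Real.exp (2 * τ), fun z hz => ?_⟩
  have hc : ContinuousOn (fun x => ‖upper q z W x‖ + ‖lower q z W x‖) (Icc 0 1) :=
    (continuousOn_norm_upper q z W).add (continuousOn_norm_lower q z W)
  refine le_of_le_add_integral hkm (fun _ => by positivity) hc (fun _ _ => by positivity)
    (by positivity) hτ hkτ fun x hx => ?_
  have hexp : ∀ t ∈ Icc (0 : ℝ) 1, Real.exp (z.im * t) ≤ Real.exp C ∧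
      Real.exp (-(z.im * t)) ≤ Real.exp C := by
    intro t ht
    have h1 : |z.im * t| ≤ C := by
      rw [abs_mul, abs_of_nonneg ht.1]
      calc |z.im| * t ≤ |z.im| * 1 := by gcongr; exact ht.2
        _ ≤ C := by linarith
    exact ⟨Real.exp_le_exp.2 (abs_le.1 h1).2, Real.exp_le_exp.2 (by linarith [(abs_le.1 h1).1])⟩
  have hu := norm_exp_smul_upper_sub_le q z W (a := 0) (by simp) hx hx.1
  have hl := norm_exp_smul_lower_sub_le q z W (a := 0) (by simp) hx hx.1
  rw [upper_zero, Complex.ofReal_zero, mul_zero, Complex.exp_zero, one_smul] at hu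
  rw [lower_zero, Complex.ofReal_zero, mul_zero, Complex.exp_zero, one_smul] at hl
  have hcu : ContinuousOn (fun t => Real.exp C * ‖upper q z W t‖) (Icc 0 1) :=
    continuousOn_const.mul (continuousOn_norm_upper q z W)
  have hcl : ContinuousOn (fun t => Real.exp C * ‖lower q z W t‖) (Icc 0 1) :=
    continuousOn_const.mul (continuousOn_norm_lower q z W)
  have hiu := intervalIntegrable_potential_mul q hcu (a := 0) (by simp) hx
  have hil := intervalIntegrable_potential_mul q hcl (a := 0) (by simp) hx
  have iu : ∫ t in (0 : ℝ)..x, ‖q t‖ * (Real.exp (z.im * t) * ‖lower q z W t‖) ≤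
      ∫ t in (0 : ℝ)..x, ‖q t‖ * (Real.exp C * ‖lower q z W t‖) := by
    refine intervalIntegral.integral_mono_on hx.1 (intervalIntegrable_potential_mul q
      (ContinuousOn.mul (by fun_prop) (continuousOn_norm_lower q z W)) (by simp) hx)
      hil fun t ht => ?_
    have := (hexp t ⟨ht.1, ht.2.trans hx.2⟩).1
    gcongr _ * (?_ * _)
  have il : ∫ t in (0 : ℝ)..x, ‖q t‖ * (Real.exp (-(z.im * t)) * ‖upper q z W t‖) ≤
      ∫ t in (0 : ℝ)..x, ‖q t‖ * (Real.exp C * ‖upper q z W t‖) := by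
    refine intervalIntegral.integral_mono_on hx.1 (intervalIntegrable_potential_mul q
      (ContinuousOn.mul (by fun_prop) (continuousOn_norm_upper q z W)) (by simp) hx)
      hiu fun t ht => ?_
    have := (hexp t ⟨ht.1, ht.2.trans hx.2⟩).2
    gcongr _ * (?_ * _)
  have bu : ‖upper q z W x‖ ≤ Real.exp C * (‖W.toRows₁‖ +
      ∫ t in (0 : ℝ)..x, ‖q t‖ * (Real.exp C * ‖lower q z W t‖)) := by
    have h1 := norm_le_norm_add_norm_sub' (Complex.exp (-(Complex.I * z) * x) • upper q z W x)
      W.toRows₁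
    rw [norm_smul, norm_exp_neg_I_mul] at h1
    calc ‖upper q z W x‖ = Real.exp (-(z.im * x)) * (Real.exp (z.im * x) * ‖upper q z W x‖) := by
          rw [← mul_assoc, ← Real.exp_add]; simp
      _ ≤ _ := by
          refine mul_le_mul (hexp x hx).2 ?_ (by positivity) (by positivity)
          linarith
  have bl : ‖lower q z W x‖ ≤ Real.exp C * (‖W.toRows₂‖ +
      ∫ t in (0 : ℝ)..x, ‖q t‖ * (Real.exp C * ‖upper q z W t‖)) := by
    have h1 := norm_le_norm_add_norm_sub' (Complex.exp (Complex.I * z * x) • lower q z W x)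
      W.toRows₂
    rw [norm_smul, norm_exp_I_mul] at h1
    calc ‖lower q z W x‖ = Real.exp (z.im * x) * (Real.exp (-(z.im * x)) * ‖lower q z W x‖) := by
          rw [← mul_assoc, ← Real.exp_add]; simp
      _ ≤ _ := by
          refine mul_le_mul (hexp x hx).1 ?_ (by positivity) (by positivity)
          linarith
  have hsum : ∫ t in (0 : ℝ)..x, k t * (‖upper q z W t‖ + ‖lower q z W t‖) =
      Real.exp C * (∫ t in (0 : ℝ)..x, ‖q t‖ * (Real.exp C * ‖lower q z W t‖)) +
      Real.exp C * ∫ t in (0 : ℝ)..x, ‖q t‖ * (Real.exp C * ‖upper q z W t‖) := by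
    rw [← intervalIntegral.integral_const_mul, ← intervalIntegral.integral_const_mul,
      ← intervalIntegral.integral_add (hil.const_mul _) (hiu.const_mul _)]
    refine intervalIntegral.integral_congr fun t _ => ?_
    simp only [hk, two_mul, Real.exp_add]
    ring
  rw [hsum]
  linarith

theorem exists_norm_fundamental_le (q : Potential r) (C : ℝ) :
    ∃ K, ∀ z : ℂ, |z.im| ≤ C → ∀ x ∈ Icc (0 : ℝ) 1, ‖fundamental q z x‖ ≤ K := by
  obtain ⟨K₁, h₁⟩ := exists_norm_solution_le q C (Matrix.fromRows 1 0)
  obtain ⟨K₂, h₂⟩ := exists_norm_solution_le q C (Matrix.fromRows 0 1)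
  refine ⟨‖blocksCLM r‖ * max K₁ K₂, fun z hz x hx => ?_⟩
  have e : fundamental q z x = blocksCLM r
      ((upper q z (Matrix.fromRows 1 0) x, upper q z (Matrix.fromRows 0 1) x),
        (lower q z (Matrix.fromRows 1 0) x, lower q z (Matrix.fromRows 0 1) x)) := by
    have h1 : fundamental q z x = fundamental q z x *
        Matrix.fromCols (Matrix.fromRows 1 0) (Matrix.fromRows 0 1) := by
      rw [Matrix.fromCols_fromRows_eq_fromBlocks, Matrix.fromBlocks_one, mul_one]
    rw [blocksCLM_apply]
    conv_lhs => rw [h1, Matrix.mul_fromCols]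
    ext (i | i) (j | j) <;> rfl
  rw [e]
  refine (ContinuousLinearMap.le_opNorm _ _).trans ?_
  gcongr
  have b1 := h₁ z hz x hx
  have b2 := h₂ z hz x hx
  have m1 := le_max_left K₁ K₂
  have m2 := le_max_right K₁ K₂
  simp only [Prod.norm_def, max_le_iff]
  refine ⟨⟨?_, ?_⟩, ⟨?_, ?_⟩⟩ <;>
    linarith [norm_nonneg (upper q z (Matrix.fromRows 1 0) x),
      norm_nonneg (upper q z (Matrix.fromRows 0 1) x),
      norm_nonneg (lower q z (Matrix.fromRows 1 0) x),
      norm_nonneg (lower q z (Matrix.fromRows 0 1) x)]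

/-- Liouville's theorem: the entire function is bounded near `±i∞` by its limits and on the
remaining strip by the solution bounds, so it is constant and equal to its limit. -/
theorem transition_eq_one {p q : Potential r}
    (h : ∀ z : ℂ, z.im ≠ 0 → weylFunction p z = weylFunction q z) {x : ℝ}
    (hx : x ∈ Ioo (0 : ℝ) 1) (z : ℂ) : transition p q x z = 1 := by
  have hx' := Ioo_subset_Icc_self hx
  have hd := differentiable_transition p q hx'
  have hup := tendsto_transition h hx
  have hlo := tendsto_transition_lower h hx
  have ev : ∀ {f : ℂ → Matrix (Fin r ⊕ Fin r) (Fin r ⊕ Fin r) ℂ},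
      Tendsto f upperInfinity (𝓝 1) → ∃ C, ∀ z : ℂ, C ≤ z.im → ‖f z‖ ≤ ‖(1 : Matrix (Fin r ⊕ Fin r)
        (Fin r ⊕ Fin r) ℂ)‖ + 1 := by
    intro f hf
    have h1 := hf.norm.eventually (ge_mem_nhds (lt_add_one _))
    obtain ⟨s, hs, hsub⟩ := mem_comap.1 h1
    obtain ⟨C, hC⟩ := mem_atTop_sets.1 hs
    exact ⟨C, fun z hz => hsub (hC _ hz)⟩
  obtain ⟨C₁, hC₁⟩ := ev hup
  obtain ⟨C₂, hC₂⟩ := ev hlo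
  obtain ⟨K₁, hK₁⟩ := exists_norm_fundamental_le p (max C₁ C₂)
  obtain ⟨K₂, hK₂⟩ := exists_norm_fundamental_le q (max C₁ C₂)
  have hbdd : ∀ z, ‖transition p q x z‖ ≤
      max (‖(1 : Matrix (Fin r ⊕ Fin r) (Fin r ⊕ Fin r) ℂ)‖ + 1)
        (K₁ * (‖-theta r‖ * K₂ * ‖theta r‖)) := by
    intro z
    rcases le_or_gt (max C₁ C₂) z.im with h1 | h1
    · exact (hC₁ z ((le_max_left _ _).trans h1)).trans (le_max_left _ _)
    rcases le_or_gt (max C₁ C₂) (-z.im) with h2 | h2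
    · have := hC₂ (star z) ((le_max_right _ _).trans (by simpa using h2))
      rw [star_star] at this
      exact this.trans (le_max_left _ _)
    · have h3 : |z.im| ≤ max C₁ C₂ := abs_le.2 ⟨by linarith, h1.le⟩
      have h4 : |(star z).im| ≤ max C₁ C₂ := by simpa using h3
      refine le_trans ?_ (le_max_right _ _)
      rw [transition, inverse_fundamental q z hx']
      have k1 := hK₁ z h3 x hx'
      have k2 := hK₂ (star z) h4 x hx'
      have k0 : 0 ≤ K₁ := (norm_nonneg _).trans k1
      refine (norm_mul_le _ _).trans ?_
      gcongr
      refine (norm_mul_le _ _).trans ?_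
      gcongr
      refine (norm_mul_le _ _).trans ?_
      rw [Matrix.l2_opNorm_conjTranspose]
      gcongr
  have hb : Bornology.IsBounded (range (transition p q x)) := by
    rw [isBounded_iff_forall_norm_le]
    exact ⟨_, by rintro _ ⟨z, rfl⟩; exact hbdd z⟩
  have hconst : ∀ w, transition p q x w = transition p q x z :=
    fun w => hd.apply_eq_apply_of_bounded hb w z
  refine tendsto_nhds_unique (f := fun _ : ℂ => transition p q x z) (l := upperInfinity)
    tendsto_const_nhds (hup.congr hconst)

/-- The Weyl function determines the potential. -/
theorem eq_of_weylFunction_eq {p q : Potential r}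
    (h : ∀ z : ℂ, z.im ≠ 0 → weylFunction p z = weylFunction q z) : p = q := by
  have hfund : ∀ x ∈ Ioo (0 : ℝ) 1, fundamental p 0 x = fundamental q 0 x := by
    intro x hx
    have h1 := transition_eq_one h hx 0
    rw [transition] at h1
    have h2 := congrArg (· * fundamental q 0 x) h1
    simpa [mul_assoc, Ring.inverse_mul_cancel _ (isUnit_fundamental q 0 (Ioo_subset_Icc_self hx))]
      using h2
  -- The single parameter `z = 0` suffices: equal solutions have equal derivatives, and cancelling
  -- the invertible `u` leaves `ϑQ_p = ϑQ_q`, whose blocks give the potentials.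
  have hp := (hasSobolevDeriv_fundamental p 0).ae_hasDerivAt
  have hq := (hasSobolevDeriv_fundamental q 0).ae_hasDerivAt
  refine Lp.ext ?_
  rw [Filter.EventuallyEq, ae_restrict_iff' measurableSet_Ioo]
  filter_upwards [hp, hq] with x h1 h2 hx
  have hev : fundamental p 0 =ᶠ[𝓝 x] fundamental q 0 := by
    filter_upwards [Ioo_mem_nhds hx.1 hx.2] with t ht using hfund t ht
  have h3 := (h1 hx).unique ((h2 hx).congr_of_eventuallyEq hev)
  rw [hfund x hx] at h3
  have h4 := (isUnit_fundamental q 0 (Ioo_subset_Icc_self hx)).mul_right_cancel h3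
  rw [zero_smul, zero_add, zero_add] at h4
  have h5 := congrArg (fun A => -theta r * A) h4
  simp only [neg_mul, ← mul_assoc, theta_mul_theta, neg_neg, one_mul] at h5
  exact (Matrix.fromBlocks_inj.1 h5).2.1

/-! ### Bounds for the Weyl function near the real axis -/

/-- The sum of the absolute values of the entries of the Weyl function. -/
def weylSum (q : Potential r) (z : ℂ) : ℝ := ∑ i, ∑ j, ‖weylFunction q z i j‖

theorem weylSum_nonneg (q : Potential r) (z : ℂ) : 0 ≤ weylSum q z := by
  unfold weylSum; positivity

theorem norm_weylFunction_apply_le (q : Potential r) (z : ℂ) (i j : Fin r) :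
    ‖weylFunction q z i j‖ ≤ weylSum q z :=
  (Finset.single_le_sum (f := fun j => ‖weylFunction q z i j‖) (fun _ _ => norm_nonneg _)
    (Finset.mem_univ j)).trans
    (Finset.single_le_sum (f := fun i => ∑ j, ‖weylFunction q z i j‖)
      (fun _ _ => by positivity) (Finset.mem_univ i))

theorem norm_trace_weylFunction_le (q : Potential r) (z : ℂ) :
    ‖(weylFunction q z).trace‖ ≤ weylSum q z :=
  (norm_sum_le _ _).trans (Finset.sum_le_sum fun i _ =>
    Finset.single_le_sum (f := fun j => ‖weylFunction q z i j‖) (fun _ _ => norm_nonneg _)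
      (Finset.mem_univ i))

theorem weylSum_star (q : Potential r) {z : ℂ} (hz : z.im ≠ 0) :
    weylSum q (star z) = weylSum q z := by
  rw [weylSum, weylSum, Finset.sum_comm]
  refine Finset.sum_congr rfl fun i _ => Finset.sum_congr rfl fun j _ => ?_
  rw [← conjTranspose_weylFunction_star q hz, Matrix.conjTranspose_apply, norm_star]

/-- The energy of the Weyl solution is controlled by the Weyl function. -/
theorem abs_im_mul_energy_le (q : Potential r) {z : ℂ} (hz : z.im ≠ 0) :
    |z.im| * energy q z (weylInitial q z) ≤ weylSum q z := by
  have hd := det_sMatrix_ne_zero q hz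
  have h := congrArg Matrix.trace (weylFunction_sub hd hd)
  rw [Matrix.trace_sub, Matrix.trace_smul, trace_gram, Matrix.trace_conjTranspose] at h
  have h1 := norm_trace_weylFunction_le q z
  have h2 : ‖(z - star z) • ((energy q z (weylInitial q z) : ℝ) : ℂ)‖ =
      2 * (|z.im| * energy q z (weylInitial q z)) := by
    have e : z - star z = ((2 * z.im : ℝ) : ℂ) * Complex.I := Complex.sub_conj z
    rw [e, norm_smul, norm_mul, Complex.norm_I, Complex.norm_real, Complex.norm_real,
      Real.norm_eq_abs, Real.norm_eq_abs, abs_mul, abs_of_nonneg (energy_nonneg _ _ _), abs_two]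
    ring
  have h3 := norm_sub_le (weylFunction q z).trace (star (weylFunction q z).trace)
  rw [norm_star, h, h2] at h3
  linarith

theorem exists_weylSum_le_of_le_im (q : Potential r) :
    ∃ A C : ℝ, 0 ≤ A ∧ 1 ≤ C ∧ ∀ z : ℂ, C ≤ z.im → weylSum q z ≤ A := by
  have hcont : Continuous fun M : Matrix (Fin r) (Fin r) ℂ => ∑ i, ∑ j, ‖M i j‖ :=
    continuous_finsetSum _ fun i _ => continuous_finsetSum _ fun j _ =>
      (continuous_id.matrix_elem i j).norm
  have h1 := ((hcont.tendsto _).comp (tendsto_weylFunction q)).eventually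
    (ge_mem_nhds (lt_add_one _))
  obtain ⟨s, hs, hsub⟩ := mem_comap.1 h1
  obtain ⟨C, hC⟩ := mem_atTop_sets.1 hs
  refine ⟨_, max C 1, ?_, le_max_right _ _, fun z hz => hsub (hC _ ((le_max_left _ _).trans hz))⟩
  positivity

/-- The Herglotz identity with `w` at height `C` on the same vertical line bounds `m(z)` by an inner
product of two Weyl solutions. The energy at `z` is itself at most `weylSum q z / Im z`, so a
weighted Cauchy–Schwarz bound lets half of `weylSum q z` be absorbed. -/
theorem weylSum_le_of_im_lt (q : Potential r) {A C : ℝ} (hC : 1 ≤ C)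
    (hA : ∀ z : ℂ, C ≤ z.im → weylSum q z ≤ A) {z : ℂ} (hz : 0 < z.im) (hzC : z.im ≤ C) :
    weylSum q z * z.im ≤ 2 * A * C + 16 * C ^ 2 * (r * r + 1) ^ 2 * A := by
  set w : ℂ := ⟨z.re, C⟩ with hw
  set N : ℝ := r * r with hN
  have hN0 : 0 ≤ N := by positivity
  have hwA : weylSum q w ≤ A := hA w le_rfl
  have hA0 : 0 ≤ A := (weylSum_nonneg q w).trans hwA
  have hwim : w.im ≠ 0 := by show C ≠ 0; positivity
  -- Chosen so that the `Y / δ` terms, summed over the `N` entries, cost at most `weylSum q z / 2`;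
  -- the other terms then grow only like `1 / Im z`. Using `N + 1` keeps `δ` positive.
  set δ : ℝ := 4 * C * (N + 1) / z.im with hδ
  have hδ0 : 0 < δ := by positivity
  set X := energy q w (weylInitial q w)
  set Y := energy q z (weylInitial q z)
  have hX0 : 0 ≤ X := energy_nonneg _ _ _
  have hY0 : 0 ≤ Y := energy_nonneg _ _ _
  have hX : X ≤ A := by
    have := abs_im_mul_energy_le q hwim
    have h2 : |w.im| = C := abs_of_pos (by positivity)
    rw [h2] at this
    nlinarith
  have hY : z.im * Y ≤ weylSum q z := by
    have := abs_im_mul_energy_le q hz.ne'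
    rwa [abs_of_pos hz] at this
  have hn : ‖z - star w‖ ≤ 2 * C := by
    have e : z - star w = ((z.im + C : ℝ) : ℂ) * Complex.I := by
      apply Complex.ext <;> simp [hw]
    rw [e, norm_mul, Complex.norm_I, mul_one, Complex.norm_real, Real.norm_eq_abs,
      abs_of_pos (by positivity)]
    linarith
  have hentry : ∀ i j, ‖weylFunction q z i j‖ ≤
      ‖weylFunction q w j i‖ + 2 * C * (δ * X + Y / δ) := by
    intro i j
    have h := congrFun (congrFun (weylFunction_sub (det_sMatrix_ne_zero q hwim)
      (det_sMatrix_ne_zero q hz.ne')) i) j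
    rw [Matrix.sub_apply, Matrix.conjTranspose_apply, sub_eq_iff_eq_add] at h
    rw [h, add_comm]
    refine (norm_add_le _ _).trans ?_
    rw [norm_star, Matrix.smul_apply, norm_smul]
    gcongr
    exact norm_gram_le q w z _ _ i j hδ0
  have hsum : weylSum q z ≤ weylSum q w + N * (2 * C * (δ * X + Y / δ)) := by
    calc weylSum q z ≤ ∑ i, ∑ j, (‖weylFunction q w j i‖ + 2 * C * (δ * X + Y / δ)) :=
          Finset.sum_le_sum fun i _ => Finset.sum_le_sum fun j _ => hentry i j
      _ = _ := by
          simp only [Finset.sum_add_distrib, Finset.sum_const, Finset.card_univ, Fintype.card_fin,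
            nsmul_eq_mul]
          rw [Finset.sum_comm, weylSum, hN]
          ring
  have hL0 := weylSum_nonneg q z
  have e1 : Y / δ * (4 * C * (N + 1)) = z.im * Y := by
    rw [hδ]; field_simp
  have e2 : δ * z.im = 4 * C * (N + 1) := by
    rw [hδ]; field_simp
  have h1 : N * (2 * C * (Y / δ)) ≤ weylSum q z / 2 := by
    have : 0 ≤ Y / δ := by positivity
    have h5 : N * (2 * C * (Y / δ)) ≤ (N + 1) * (2 * C * (Y / δ)) := by gcongr; linarith
    nlinarith
  have h2 : weylSum q z ≤ 2 * A + 4 * N * C * δ * A := by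
    have h6 : N * (2 * C * (δ * X)) ≤ N * (2 * C * (δ * A)) := by gcongr
    nlinarith
  calc weylSum q z * z.im ≤ (2 * A + 4 * N * C * δ * A) * z.im := by gcongr
    _ = 2 * A * z.im + 4 * N * C * (δ * z.im) * A := by ring
    _ = 2 * A * z.im + 4 * N * C * (4 * C * (N + 1)) * A := by rw [e2]
    _ = 2 * A * z.im + 16 * C ^ 2 * (N * (N + 1)) * A := by ring
    _ ≤ 2 * A * C + 16 * C ^ 2 * (N + 1) ^ 2 * A := by gcongr; nlinarith

/-- The Weyl function is bounded by a multiple of `1 + 1 / |Im z|`. -/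
theorem exists_norm_weylFunction_mul_im_le (q : Potential r) :
    ∃ K, ∀ z : ℂ, ∀ i j, z.im ≠ 0 → ‖weylFunction q z i j‖ * |z.im| ≤ K * (1 + |z.im|) := by
  obtain ⟨A, C, hA, hC, h⟩ := exists_weylSum_le_of_le_im q
  set B : ℝ := 2 * A * C + 16 * C ^ 2 * (r * r + 1) ^ 2 * A with hB
  have hB0 : 0 ≤ B := by positivity
  have key : ∀ z : ℂ, 0 < z.im → weylSum q z * |z.im| ≤ (A + B) * (1 + |z.im|) := by
    intro z hz
    rw [abs_of_pos hz]
    rcases le_total C z.im with h1 | h1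
    · have h2 := h z h1
      nlinarith [mul_nonneg hB0 hz.le, mul_le_mul_of_nonneg_right h2 hz.le]
    · have h2 := weylSum_le_of_im_lt q hC h hz h1
      nlinarith [mul_nonneg hB0 hz.le, mul_nonneg hA hz.le]
  refine ⟨A + B, fun z i j hz => ?_⟩
  refine (mul_le_mul_of_nonneg_right (norm_weylFunction_apply_le q z i j) (abs_nonneg _)).trans ?_
  rcases hz.lt_or_gt with h1 | h1
  · have h2 := key (star z) (by simpa using h1)
    rw [weylSum_star q hz] at h2
    simpa using h2
  · exact key z h1

/-! ### A boundedness principle -/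

/-- A holomorphic function on a disc of radius `2` centred on the real axis that is bounded by
`K / |Im z|` is bounded by `4K/3` on the concentric disc of radius `1`. -/
theorem norm_le_of_norm_mul_im_le {f : ℂ → ℂ} {x₀ K : ℝ}
    (hf : DifferentiableOn ℂ f (Metric.closedBall (x₀ : ℂ) 2))
    (hK : ∀ z ∈ Metric.closedBall (x₀ : ℂ) 2, ‖f z‖ * |z.im| ≤ K) {z : ℂ}
    (hz : z ∈ Metric.closedBall (x₀ : ℂ) 1) : ‖f z‖ ≤ 4 * K / 3 := by
  -- On the circle of radius `2` the polynomial equals `(z - x₀) · 2i Im z`, so it compensates the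
  -- growth of `f` at the two real points. The maximum principle carries the bound inside, where the
  -- polynomial is at least `3` in modulus on the unit disc.
  set g : ℂ → ℂ := fun z => ((z - x₀) ^ 2 - 4) * f z with hg
  have hd : DiffContOnCl ℂ g (Metric.ball (x₀ : ℂ) 2) := by
    refine DifferentiableOn.diffContOnCl ?_
    rw [closure_ball _ two_ne_zero]
    exact DifferentiableOn.mul (by fun_prop) hf
  have hbd : ∀ w ∈ frontier (Metric.ball (x₀ : ℂ) 2), ‖g w‖ ≤ 4 * K := by
    intro w hw
    rw [frontier_ball _ two_ne_zero, mem_sphere_iff_norm] at hw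
    have hw2 : w ∈ Metric.closedBall (x₀ : ℂ) 2 := by
      rw [mem_closedBall_iff_norm]; exact hw.le
    have h1 : (w - x₀) ^ 2 - 4 = (w - x₀) * ((w - x₀) - star (w - x₀)) := by
      have h2 : (w - x₀) * star (w - x₀) = ((‖w - x₀‖ ^ 2 : ℝ) : ℂ) := by
        rw [Complex.star_def, Complex.mul_conj, Complex.normSq_eq_norm_sq]
      rw [mul_sub, h2, hw]
      push_cast
      ring
    have h3 : ((w - x₀) - star (w - x₀)) = ((2 * w.im : ℝ) : ℂ) * Complex.I := by
      have := Complex.sub_conj (w - x₀)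
      simpa using this
    have h4 := hK w hw2
    rw [hg]
    simp only
    rw [norm_mul, h1, h3, norm_mul, norm_mul, hw, Complex.norm_I, Complex.norm_real,
      Real.norm_eq_abs, abs_mul, abs_two]
    linarith
  have hzc : z ∈ closure (Metric.ball (x₀ : ℂ) 2) := by
    rw [closure_ball _ two_ne_zero]
    exact Metric.closedBall_subset_closedBall one_le_two hz
  have h1 := Complex.norm_le_of_forall_mem_frontier_norm_le Metric.isBounded_ball hd hbd hzc
  have h2 : 3 ≤ ‖(z - x₀) ^ 2 - 4‖ := by
    rw [mem_closedBall_iff_norm] at hz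
    have h3 : ‖(z - x₀) ^ 2‖ ≤ 1 := by
      rw [norm_pow]; exact pow_le_one₀ (norm_nonneg _) hz
    have h4 := norm_sub_norm_le (4 : ℂ) ((z - x₀) ^ 2)
    rw [norm_sub_rev] at h4
    have h5 : ‖(4 : ℂ)‖ = 4 := by norm_num
    linarith
  rw [hg] at h1
  simp only [norm_mul] at h1
  have h3 : 3 * ‖f z‖ ≤ ‖(z - x₀) ^ 2 - 4‖ * ‖f z‖ := by gcongr
  linarith

/-! ### Holomorphy of the Weyl function -/

theorem differentiable_matrix_apply {m n : Type*} [Fintype m] [Fintype n] [DecidableEq n]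
    {f : ℂ → Matrix m n ℂ} (hf : Differentiable ℂ f) (i : m) (j : n) :
    Differentiable ℂ fun z => f z i j :=
  (LinearMap.toContinuousLinearMap (Matrix.entryLinearMap ℂ ℂ i j)).differentiable.comp hf

theorem differentiable_mul_apply {l m n : Type*} [Fintype m] {f : ℂ → Matrix l m ℂ}
    {g : ℂ → Matrix m n ℂ} (hf : ∀ i j, Differentiable ℂ fun z => f z i j)
    (hg : ∀ i j, Differentiable ℂ fun z => g z i j) (i : l) (j : n) :
    Differentiable ℂ fun z => (f z * g z) i j := by
  simp only [Matrix.mul_apply]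
  exact Differentiable.fun_sum fun k _ => (hf i k).mul (hg k j)

theorem differentiable_det {n : Type*} [Fintype n] [DecidableEq n] {f : ℂ → Matrix n n ℂ}
    (hf : ∀ i j, Differentiable ℂ fun z => f z i j) : Differentiable ℂ fun z => (f z).det := by
  simp only [Matrix.det_apply]
  refine Differentiable.fun_sum fun σ _ => Differentiable.const_smul ?_ _
  exact Differentiable.fun_finsetProd fun i _ => hf _ _

theorem differentiable_adjugate_apply {n : Type*} [Fintype n] [DecidableEq n]
    {f : ℂ → Matrix n n ℂ} (hf : ∀ i j, Differentiable ℂ fun z => f z i j) (i j : n) :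
    Differentiable ℂ fun z => (f z).adjugate i j := by
  simp only [Matrix.adjugate_apply]
  refine differentiable_det fun k l => ?_
  simp only [Matrix.updateRow_apply]
  split_ifs
  · exact differentiable_const _
  · exact hf k l

theorem differentiable_sMatrix_apply (q : Potential r) (i j : Fin r) :
    Differentiable ℂ fun z => sMatrix q z i j := by
  simp only [sMatrix_eq]
  have h : ∀ k l, Differentiable ℂ fun z => fundamental q z 1 k l :=
    differentiable_matrix_apply (differentiable_fundamental q 1)
  have h' := differentiable_mul_apply (g := fun _ => theta r * (boundaryMatrix r)ᴴ) h
    fun _ _ => differentiable_const _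
  exact differentiable_mul_apply (f := fun _ => boundaryMatrix r)
    (fun _ _ => differentiable_const _) h' i j

theorem differentiable_cMatrix_apply (q : Potential r) (i j : Fin r) :
    Differentiable ℂ fun z => cMatrix q z i j := by
  simp only [cMatrix_eq]
  have h : ∀ k l, Differentiable ℂ fun z => fundamental q z 1 k l :=
    differentiable_matrix_apply (differentiable_fundamental q 1)
  have h' := differentiable_mul_apply (g := fun _ => (boundaryMatrix r)ᴴ) h
    fun _ _ => differentiable_const _
  exact differentiable_mul_apply (f := fun _ => boundaryMatrix r)
    (fun _ _ => differentiable_const _) h' i j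

theorem differentiable_det_sMatrix (q : Potential r) :
    Differentiable ℂ fun z => (sMatrix q z).det :=
  differentiable_det (differentiable_sMatrix_apply q)

/-- The numerator of an entry of the Weyl function. -/
def weylNumerator (q : Potential r) (i j : Fin r) (z : ℂ) : ℂ :=
  -((sMatrix q z).adjugate * cMatrix q z) i j

theorem differentiable_weylNumerator (q : Potential r) (i j : Fin r) :
    Differentiable ℂ (weylNumerator q i j) :=
  (differentiable_mul_apply (differentiable_adjugate_apply (differentiable_sMatrix_apply q))
    (differentiable_cMatrix_apply q) i j).neg

theorem weylFunction_apply (q : Potential r) (z : ℂ) (i j : Fin r) :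
    weylFunction q z i j = ((sMatrix q z).det)⁻¹ * weylNumerator q i j z := by
  rw [weylFunction, Matrix.inv_def, Ring.inverse_eq_inv', Matrix.smul_mul, Matrix.neg_apply,
    Matrix.smul_apply, weylNumerator, smul_eq_mul, mul_neg]

theorem meromorphicAt_weylFunction (q : Potential r) (i j : Fin r) (z : ℂ) :
    MeromorphicAt (fun z => weylFunction q z i j) z := by
  simp only [weylFunction_apply]
  exact (((differentiable_det_sMatrix q).analyticAt z).meromorphicAt.inv).mul
    ((differentiable_weylNumerator q i j).analyticAt z).meromorphicAt

theorem analyticAt_weylFunction (q : Potential r) (i j : Fin r) {z : ℂ}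
    (hz : (sMatrix q z).det ≠ 0) : AnalyticAt ℂ (fun z => weylFunction q z i j) z := by
  simp only [weylFunction_apply]
  exact (((differentiable_det_sMatrix q).analyticAt z).inv hz).mul
    ((differentiable_weylNumerator q i j).analyticAt z)

theorem differentiableAt_weylFunction (q : Potential r) (i j : Fin r) {z : ℂ}
    (hz : (sMatrix q z).det ≠ 0) : DifferentiableAt ℂ (fun z => weylFunction q z i j) z :=
  (analyticAt_weylFunction q i j hz).differentiableAt

/-- The identity theorem: an accumulation of zeros would make the entire function `det s` vanish at
`i`. -/
theorem eventually_det_sMatrix_ne_zero (q : Potential r) (z : ℂ) :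
    ∀ᶠ w in 𝓝[≠] z, (sMatrix q w).det ≠ 0 := by
  by_contra h
  have h1 : ∃ᶠ w in 𝓝[≠] z, (sMatrix q w).det = 0 := by
    simpa only [Filter.not_eventually, not_not] using h
  have h2 : AnalyticOnNhd ℂ (fun z => (sMatrix q z).det) univ :=
    fun w _ => (differentiable_det_sMatrix q).analyticAt w
  have h3 := h2.eqOn_zero_of_preconnected_of_frequently_eq_zero isPreconnected_univ
    (mem_univ z) h1 (mem_univ Complex.I)
  exact det_sMatrix_ne_zero q (z := Complex.I) (by simp) h3

/-! ### Residues -/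

/-- Circle integrals of the Weyl function around a point eventually stabilize. -/
theorem exists_isResidue (q : Potential r) (z₀ : ℂ) : ∃ A, IsResidue (weylFunction q) z₀ A := by
  obtain ⟨ρ, hρ, hball⟩ := Metric.mem_nhdsWithin_iff.1 (eventually_det_sMatrix_ne_zero q z₀)
  have hdet : ∀ w, w ≠ z₀ → dist w z₀ < ρ → (sMatrix q w).det ≠ 0 :=
    fun w hw hd => hball ⟨hd, hw⟩
  refine ⟨Matrix.of fun k l => (2 * Real.pi * Complex.I)⁻¹ *
    ∮ z in C(z₀, ρ / 2), weylFunction q z k l, ?_⟩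
  filter_upwards [Ioo_mem_nhdsGT (half_pos hρ)] with ε hε k l
  rw [Matrix.of_apply]
  congr 1
  refine (Complex.circleIntegral_eq_of_differentiable_on_annulus_off_countable hε.1 hε.2.le
    countable_empty ?_ ?_).symm
  · intro w hw
    refine (differentiableAt_weylFunction q k l (hdet w ?_ ?_)).continuousAt.continuousWithinAt
    · rintro rfl
      exact hw.2 (by simpa using hε.1)
    · exact (Metric.mem_closedBall.1 hw.1).trans_lt (half_lt_self hρ)
  · intro w hw
    refine differentiableAt_weylFunction q k l (hdet w ?_ ?_)
    · rintro rfl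
      exact hw.1.2 (by simpa using hε.1.le)
    · exact (Metric.mem_ball.1 hw.1.1).trans (half_lt_self hρ)

theorem IsResidue.unique {m : ℂ → Matrix (Fin r) (Fin r) ℂ} {z₀ : ℂ}
    {A B : Matrix (Fin r) (Fin r) ℂ} (hA : IsResidue m z₀ A) (hB : IsResidue m z₀ B) : A = B := by
  obtain ⟨ε, h1, h2⟩ := (hA.and hB).exists
  ext k l
  rw [← h1 k l, h2 k l]

/-! ### The eigenvalues are unbounded in both directions -/

/-- A function bounded by `K (1 + 1 / |Im z|)` and holomorphic on a right half-plane is slowly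
varying far to the right. -/
theorem false_of_bounded_right_half_plane {f : ℂ → ℂ} {Λ K Y : ℝ}
    (hd : ∀ z : ℂ, Λ < z.re → DifferentiableAt ℂ f z)
    (hK : ∀ z : ℂ, z.im ≠ 0 → ‖f z‖ * |z.im| ≤ K * (1 + |z.im|)) (hY : 0 < Y)
    (hf : ∀ x : ℝ, 1 ≤ ‖f (x + Y * Complex.I) - f (x - Y * Complex.I)‖) : False := by
  have hK0 : 0 ≤ K := by
    have := hK Complex.I (by simp)
    simp only [Complex.I_im, abs_one] at this
    linarith [norm_nonneg (f Complex.I)]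
  have hbound : ∀ z : ℂ, Λ + 3 ≤ z.re → ‖f z‖ ≤ 4 * K := by
    intro z hz
    rcases le_total |z.im| 1 with h1 | h1
    · have h := norm_le_of_norm_mul_im_le (f := f) (x₀ := z.re) (K := 3 * K) (z := z) ?_ ?_ ?_
      · linarith
      · intro w hw
        refine (hd w ?_).differentiableWithinAt
        have h2 := Complex.abs_re_le_norm (w - z.re)
        rw [mem_closedBall_iff_norm] at hw
        simp only [Complex.sub_re, Complex.ofReal_re] at h2
        linarith [(abs_le.1 (h2.trans hw)).1]
      · intro w hw
        rcases eq_or_ne w.im 0 with h0 | h0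
        · rw [h0, abs_zero, mul_zero]; positivity
        · have h2 := Complex.abs_im_le_norm (w - z.re)
          rw [mem_closedBall_iff_norm] at hw
          simp only [Complex.sub_im, Complex.ofReal_im, sub_zero] at h2
          refine (hK w h0).trans ?_
          nlinarith
      · rw [mem_closedBall_iff_norm]
        have e : z - z.re = (z.im : ℂ) * Complex.I := by
          apply Complex.ext <;> simp
        rw [e, norm_mul, Complex.norm_I, mul_one, Complex.norm_real]
        exact h1
    · have h2 := hK z (fun h => by rw [h] at h1; simp at h1; linarith)
      nlinarith [norm_nonneg (f z)]
  -- Cauchy's estimate gives `|f'| ≤ 4K / R`; this `R` makes the variation over the segment of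
  -- length `2Y` less than `1`.
  set R : ℝ := 8 * K * Y + 1 with hR
  have hR0 : 0 < R := by positivity
  have hderiv : ∀ z ∈ {z : ℂ | Λ + 3 + R ≤ z.re}, ‖deriv f z‖ ≤ 4 * K / R := by
    intro z hz
    have hre : ∀ w : ℂ, ‖w - z‖ ≤ R → Λ + 3 ≤ w.re := by
      intro w hw
      have h2 := (abs_le.1 ((Complex.abs_re_le_norm (w - z)).trans hw)).1
      rw [Complex.sub_re] at h2
      have : Λ + 3 + R ≤ z.re := hz
      linarith
    refine Complex.norm_deriv_le_of_forall_mem_sphere_norm_le hR0 ?_ fun w hw =>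
      hbound w (hre w (mem_sphere_iff_norm.1 hw).le)
    refine DifferentiableOn.diffContOnCl fun w hw => (hd w ?_).differentiableWithinAt
    rw [closure_ball _ hR0.ne'] at hw
    linarith [hre w (mem_closedBall_iff_norm.1 hw)]
  have hconv : Convex ℝ {z : ℂ | Λ + 3 + R ≤ z.re} := convex_halfSpace_re_ge _
  set x : ℝ := Λ + 3 + R with hx
  have h1 := hconv.norm_image_sub_le_of_norm_deriv_le
    (fun z hz => hd z (by have : Λ + 3 + R ≤ z.re := hz; linarith)) hderiv
    (x := x - Y * Complex.I) (y := x + Y * Complex.I) (by simp [hx]) (by simp [hx])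
  have e : (x + Y * Complex.I : ℂ) - (x - Y * Complex.I) = ((2 * Y : ℝ) : ℂ) * Complex.I := by
    push_cast; ring
  rw [e, norm_mul, Complex.norm_I, mul_one, Complex.norm_real, Real.norm_eq_abs,
    abs_of_pos (by positivity)] at h1
  have h2 := (hf x).trans h1
  rw [div_mul_eq_mul_div, le_div_iff₀ hR0] at h2
  linarith

/-- Since `m → i` uniformly in the real part and `m(z̄) = m(z)*`, a fixed height works for all `x`:
accuracy `1/2` leaves `Im m_ii ≥ 1/2`, hence a jump of at least `1`. -/
theorem exists_one_le_norm_weylFunction_sub (q : Potential r) (i : Fin r) :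
    ∃ Y : ℝ, 0 < Y ∧ ∀ x : ℝ, 1 ≤ ‖weylFunction q (x + Y * Complex.I) i i -
      weylFunction q (x - Y * Complex.I) i i‖ := by
  have h := ((Continuous.matrix_elem continuous_id i i).tendsto _).comp (tendsto_weylFunction q)
  have h1 := (Metric.tendsto_nhds.1 h) (1 / 2) one_half_pos
  obtain ⟨s, hs, hsub⟩ := mem_comap.1 h1
  obtain ⟨C, hC⟩ := mem_atTop_sets.1 hs
  refine ⟨max C 1, by positivity, fun x => ?_⟩
  set Y := max C 1
  set z : ℂ := x + Y * Complex.I with hz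
  have him : z.im = Y := by simp [hz]
  have h2 : dist (weylFunction q z i i) Complex.I < 1 / 2 := by
    have : z ∈ Complex.im ⁻¹' s := hC _ (by rw [him]; exact le_max_left _ _)
    simpa using hsub this
  have hne : z.im ≠ 0 := by rw [him]; positivity
  have h3 := congrFun (congrFun (conjTranspose_weylFunction_star q hne) i) i
  rw [Matrix.conjTranspose_apply] at h3
  have h4 : star z = x - Y * Complex.I := by simp [hz, sub_eq_add_neg]
  rw [h4] at h3
  have h5 : weylFunction q (x - Y * Complex.I) i i = star (weylFunction q z i i) := by
    rw [← h3, star_star]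
  have e : weylFunction q z i i - star (weylFunction q z i i) =
      ((2 * (weylFunction q z i i).im : ℝ) : ℂ) * Complex.I := Complex.sub_conj _
  rw [h5, e, norm_mul, Complex.norm_I, mul_one, Complex.norm_real, Real.norm_eq_abs]
  rw [Complex.dist_eq] at h2
  have h6 := (Complex.abs_im_le_norm _).trans h2.le
  rw [Complex.sub_im, Complex.I_im] at h6
  have := (abs_le.1 h6).1
  exact le_trans (by linarith) (le_abs_self _)

/-- Without eigenvalues beyond `Λ` a diagonal entry of `m` would be holomorphic on a right
half-plane, which its growth bound and persistent jump forbid. A diagonal entry exists because `r ≥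
1`. -/
theorem exists_eigenvalue_gt (hr : 1 ≤ r) (q : Potential r) (Λ : ℝ) :
    ∃ x : ℝ, Λ < x ∧ IsEigenvalue q x := by
  by_contra! h
  let i : Fin r := ⟨0, hr⟩
  obtain ⟨K, hK⟩ := exists_norm_weylFunction_mul_im_le q
  obtain ⟨Y, hY, hf⟩ := exists_one_le_norm_weylFunction_sub q i
  refine false_of_bounded_right_half_plane (f := fun z => weylFunction q z i i) (Λ := Λ)
    (fun z hz => differentiableAt_weylFunction q i i fun h0 => ?_) (fun z => hK z i i) hY hf
  rw [← isEigenvalue_iff] at h0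
  have e : ((z.re : ℝ) : ℂ) = z := by apply Complex.ext <;> simp [h0.im_eq_zero]
  exact h z.re hz (e ▸ h0)

/-- The substitution `z ↦ -z` turns a left half-plane into a right one; the growth bound and the
jump are invariant under it. -/
theorem exists_eigenvalue_lt (hr : 1 ≤ r) (q : Potential r) (Λ : ℝ) :
    ∃ x : ℝ, x < Λ ∧ IsEigenvalue q x := by
  by_contra! h
  let i : Fin r := ⟨0, hr⟩
  obtain ⟨K, hK⟩ := exists_norm_weylFunction_mul_im_le q
  obtain ⟨Y, hY, hf⟩ := exists_one_le_norm_weylFunction_sub q i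
  refine false_of_bounded_right_half_plane (f := fun z => weylFunction q (-z) i i) (Λ := -Λ)
    (K := K) (fun z hz => ?_) (fun z hz => ?_) hY fun x => ?_
  · refine DifferentiableAt.comp z (differentiableAt_weylFunction q i i fun h0 => ?_)
      differentiableAt_id.neg
    rw [← isEigenvalue_iff] at h0
    have e : (((-z).re : ℝ) : ℂ) = -z := by apply Complex.ext <;> simp [h0.im_eq_zero]
    exact h (-z).re (by rw [Complex.neg_re]; linarith) (e ▸ h0)
  · simpa using hK (-z) i i (by simpa using hz)
  · have := hf (-x)
    rw [norm_sub_rev] at this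
    have e1 : -(x + Y * Complex.I : ℂ) = ((-x : ℝ) : ℂ) - Y * Complex.I := by push_cast; ring
    have e2 : -(x - Y * Complex.I : ℂ) = ((-x : ℝ) : ℂ) + Y * Complex.I := by push_cast; ring
    rw [e1, e2]
    exact this

/-! ### Enumeration of the eigenvalues -/

theorem finite_eigenvalues_Icc (q : Potential r) (a b : ℝ) :
    {x : ℝ | IsEigenvalue q x ∧ x ∈ Icc a b}.Finite := by
  by_contra h
  have hinf : (((↑) : ℝ → ℂ) '' {x : ℝ | IsEigenvalue q x ∧ x ∈ Icc a b}).Infinite :=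
    Set.Infinite.image Complex.ofReal_injective.injOn h
  obtain ⟨z, -, hz⟩ := hinf.exists_accPt_of_subset_isCompact
    (isCompact_Icc.image Complex.continuous_ofReal (s := Icc a b))
    (image_mono fun x hx => hx.2)
  rw [accPt_iff_frequently_nhdsNE] at hz
  refine hz ((eventually_det_sMatrix_ne_zero q z).mono ?_)
  rintro w hw ⟨x, hx, rfl⟩
  exact hw ((isEigenvalue_iff q x).1 hx.1)

/-- A locally finite set of reals unbounded in both directions can be enumerated by `ℤ`. -/
theorem exists_strictMono_range_eq {S : Set ℝ} (hfin : ∀ a b, {x | x ∈ S ∧ x ∈ Icc a b}.Finite)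
    (hgt : ∀ a, ∃ x, a < x ∧ x ∈ S) (hlt : ∀ a, ∃ x, x < a ∧ x ∈ S) :
    ∃ a : ℤ → ℝ, StrictMono a ∧ a 0 ≤ 0 ∧ 0 < a 1 ∧ range a = S := by
  let _ : LocallyFiniteOrder S := LocallyFiniteOrder.ofFiniteIcc fun a b => by
    refine Set.Finite.of_finite_image ((hfin a b).subset ?_) Subtype.val_injective.injOn
    rintro _ ⟨x, hx, rfl⟩
    exact ⟨x.2, hx⟩
  let _ : SuccOrder S := LinearLocallyFiniteOrder.succOrder S
  let _ : PredOrder S := LinearLocallyFiniteOrder.predOrder S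
  have : NoMaxOrder S := ⟨fun a => by
    obtain ⟨x, hx, hxS⟩ := hgt a
    exact ⟨⟨x, hxS⟩, hx⟩⟩
  have : NoMinOrder S := ⟨fun a => by
    obtain ⟨x, hx, hxS⟩ := hlt a
    exact ⟨⟨x, hxS⟩, hx⟩⟩
  have : Nonempty S := by
    obtain ⟨x, -, hx⟩ := hgt 0
    exact ⟨⟨x, hx⟩⟩
  let e : S ≃o ℤ := orderIsoIntOfLinearSuccPredArch
  have hmono : StrictMono fun n : ℤ => (e.symm n : ℝ) := fun m n h =>
    Subtype.coe_lt_coe.2 (e.symm.strictMono h)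
  -- `n` is the last index with a nonpositive value; shifting by it produces `a 0 ≤ 0 < a 1`.
  obtain ⟨n, hn, hmax⟩ := Int.exists_greatest_of_bdd (P := fun n : ℤ => (e.symm n : ℝ) ≤ 0)
    (by
      obtain ⟨x, hx, hxS⟩ := hgt 0
      refine ⟨e ⟨x, hxS⟩, fun m hm => ?_⟩
      by_contra! hc
      have := hmono hc
      simp only [OrderIso.symm_apply_apply] at this
      linarith)
    (by
      obtain ⟨x, hx, hxS⟩ := hlt 0
      exact ⟨e ⟨x, hxS⟩, by simpa using hx.le⟩)
  refine ⟨fun m => (e.symm (m + n) : ℝ), fun k l h => hmono (by lia), by simpa using hn, ?_, ?_⟩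
  · by_contra! hc
    have := hmax _ hc
    lia
  · ext x
    constructor
    · rintro ⟨m, rfl⟩
      exact (e.symm (m + n)).2
    · intro hx
      exact ⟨e ⟨x, hx⟩ - n, by simp⟩

/-- The relabelling `φ` is an order automorphism of `ℤ`, hence a translation, and the sign
conditions force `φ 0 ≤ 0 < φ 1 = φ 0 + 1`. -/
theorem strictMono_eq_of_range_eq {a b : ℤ → ℝ} (ha : StrictMono a) (hb : StrictMono b)
    (ha0 : a 0 ≤ 0) (ha1 : 0 < a 1) (hb0 : b 0 ≤ 0) (hb1 : 0 < b 1)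
    (h : range a = range b) : a = b := by
  have h1 : ∀ n, ∃ m, b m = a n := fun n => h.le (mem_range_self n)
  choose φ hφ using h1
  have hmono : StrictMono φ := fun m n hmn => hb.lt_iff_lt.1 (by rw [hφ, hφ]; exact ha hmn)
  have hsurj : Function.Surjective φ := by
    intro m
    obtain ⟨n, hn⟩ : b m ∈ range a := h.ge (mem_range_self m)
    exact ⟨n, hb.injective (by rw [hφ, hn])⟩
  have hsucc : ∀ n, φ (n + 1) = φ n + 1 := fun n =>
    (StrictMono.orderIsoOfSurjective φ hmono hsurj).map_succ n
  have h0 : φ 0 ≤ 0 := by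
    by_contra! hc
    have := hb.monotone (show 1 ≤ φ 0 by lia)
    rw [hφ] at this
    linarith
  have h1 : 0 < φ 1 := by
    by_contra! hc
    have := hb.monotone hc
    rw [hφ] at this
    linarith
  have h00 : φ 0 = 0 := by
    have := hsucc 0
    rw [zero_add] at this
    lia
  have hid : ∀ n, φ n = n := by
    intro n
    induction n using Int.induction_on with
    | zero => exact h00
    | succ n ih => rw [hsucc, ih]
    | pred n ih =>
      have := hsucc (-(n : ℤ) - 1)
      rw [sub_add_cancel, ih] at this
      lia
  funext n
  rw [← hφ n, hid]

theorem exists_isSpectralData (hr : 1 ≤ r) (q : Potential r) : ∃ a, IsSpectralData q a := by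
  obtain ⟨a, ha, h0, h1, hS⟩ := exists_strictMono_range_eq (S := {x : ℝ | IsEigenvalue q x})
    (finite_eigenvalues_Icc q) (exists_eigenvalue_gt hr q) (exists_eigenvalue_lt hr q)
  choose A hA using fun j : ℤ => exists_isResidue q (a j)
  refine ⟨fun j => (a j, -A j), ha, h0, h1, ?_, fun j => by rw [neg_neg]; exact hA j⟩
  ext z
  constructor
  · intro hz
    have e : ((z.re : ℝ) : ℂ) = z := by
      apply Complex.ext <;> simp [IsEigenvalue.im_eq_zero hz]
    have h2 : z.re ∈ range a := by
      rw [hS]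
      show IsEigenvalue q ((z.re : ℝ) : ℂ)
      rwa [e]
    obtain ⟨j, hj⟩ := h2
    exact ⟨j, by rw [← e, ← hj]⟩
  · rintro ⟨j, rfl⟩
    have h2 : a j ∈ {x : ℝ | IsEigenvalue q x} := hS ▸ mem_range_self j
    exact h2

theorem IsSpectralData.unique {q : Potential r} {a b : ℤ → ℝ × Matrix (Fin r) (Fin r) ℂ}
    (ha : IsSpectralData q a) (hb : IsSpectralData q b) : a = b := by
  obtain ⟨ha, ha0, ha1, haS, haR⟩ := ha
  obtain ⟨hb, hb0, hb1, hbS, hbR⟩ := hb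
  have hrange : range (fun j => (a j).1) = range (fun j => (b j).1) := by
    refine image_injective.2 Complex.ofReal_injective ?_
    rw [← range_comp, ← range_comp]
    exact haS.symm.trans hbS
  have h1 := strictMono_eq_of_range_eq ha hb ha0 ha1 hb0 hb1 hrange
  funext j
  have h2 : (a j).1 = (b j).1 := congrFun h1 j
  refine Prod.ext h2 ?_
  have h3 := haR j
  rw [h2] at h3
  exact neg_injective (h3.unique (hbR j))

/-! ### The spectral data determine the Weyl function -/

/-- A meromorphic function bounded by `K (1 + 1 / |Im z|)` has no poles on the real axis apart from
simple ones, and these are detected by the residues. -/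
theorem meromorphicOrderAt_nonneg_of_circleIntegral_eq_zero {f : ℂ → ℂ} {x K : ℝ}
    (hf : MeromorphicAt f x)
    (hK : ∀ z : ℂ, z.im ≠ 0 → ‖f z‖ * |z.im| ≤ K * (1 + |z.im|))
    (hres : ∀ᶠ ε : ℝ in 𝓝[>] 0, (∮ z in C(x, ε), f z) = 0) :
    0 ≤ meromorphicOrderAt f x := by
  by_contra! hneg
  obtain ⟨n, hn⟩ := WithTop.ne_top_iff_exists.1 hneg.ne_top
  have hn0 : n < 0 := by
    rw [← hn] at hneg
    exact_mod_cast hneg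
  obtain ⟨g, hg, hgx, hfg⟩ := (meromorphicOrderAt_eq_int_iff hf).1 hn.symm
  -- A pole of order at least two grows too fast along the vertical ray `x + iy`. For a simple pole,
  -- `2πi g(x)` is the circle integral, which vanishes. Either way `g(x) = 0`, a contradiction.
  rcases (show n ≤ -2 ∨ n = -1 by lia) with h2 | h1
  · have hpath : Tendsto (fun y : ℝ => (x : ℂ) + y * Complex.I) (𝓝[>] 0) (𝓝[≠] (x : ℂ)) := by
      refine tendsto_nhdsWithin_iff.2 ⟨?_, ?_⟩
      · have : Continuous fun y : ℝ => (x : ℂ) + y * Complex.I := by fun_prop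
        have h := this.tendsto 0
        simp only [Complex.ofReal_zero, zero_mul, add_zero] at h
        exact h.mono_left nhdsWithin_le_nhds
      · filter_upwards [self_mem_nhdsWithin] with y hy
        have hy' : y ≠ 0 := ne_of_gt hy
        simpa using hy'
    have hgt : Tendsto (fun y : ℝ => ‖g (x + y * Complex.I)‖) (𝓝[>] 0) (𝓝 ‖g x‖) :=
      (hg.continuousAt.tendsto.comp (hpath.mono_right nhdsWithin_le_nhds)).norm
    have hsmall : Tendsto (fun y : ℝ => y * (K * (1 + |y|))) (𝓝[>] 0) (𝓝 0) := by
      have : Continuous fun y : ℝ => y * (K * (1 + |y|)) := by fun_prop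
      have h := this.tendsto 0
      rw [zero_mul] at h
      exact h.mono_left nhdsWithin_le_nhds
    have hle : ‖g x‖ ≤ 0 := by
      refine le_of_tendsto_of_tendsto hgt hsmall ?_
      filter_upwards [hpath.eventually hfg, Ioo_mem_nhdsGT one_pos] with y hy hy1
      have him : ((x : ℂ) + y * Complex.I).im = y := by simp
      have hb := hK (x + y * Complex.I) (by rw [him]; exact hy1.1.ne')
      rw [hy, him, add_sub_cancel_left, norm_smul, norm_zpow, norm_mul, Complex.norm_I, mul_one,
        Complex.norm_real, Real.norm_eq_abs, abs_of_pos hy1.1] at hb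
      have hone : 1 ≤ y ^ n * y * y := by
        rw [← zpow_add_one₀ hy1.1.ne', ← zpow_add_one₀ hy1.1.ne']
        exact one_le_zpow_of_nonpos₀ hy1.1 hy1.2.le (by lia)
      rw [abs_of_pos hy1.1]
      calc ‖g (x + y * Complex.I)‖ ≤ y ^ n * y * y * ‖g (x + y * Complex.I)‖ :=
            le_mul_of_one_le_left (norm_nonneg _) hone
        _ = y * (y ^ n * ‖g (x + y * Complex.I)‖ * y) := by ring
        _ ≤ _ := by gcongr; exact hy1.1.le
    exact hgx (norm_le_zero_iff.1 hle)
  · obtain ⟨ρ, hρ, hball⟩ := Metric.mem_nhdsWithin_iff.1 hfg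
    obtain ⟨ρ', hρ', hball'⟩ := Metric.mem_nhds_iff.1 hg.eventually_analyticAt
    obtain ⟨ε, h0, hε⟩ := (hres.and (Ioo_mem_nhdsGT (lt_min hρ hρ'))).exists
    have hint : (∮ z in C(x, ε), f z) = ∮ z in C(x, ε), (z - x)⁻¹ • g z := by
      refine circleIntegral.integral_congr hε.1.le fun z hz => ?_
      have hzd : dist z x = ε := hz
      have hz1 := hball ⟨show dist z x < ρ from hzd ▸ hε.2.trans_le (min_le_left _ _), ?_⟩
      · rw [← zpow_neg_one, ← h1]
        exact hz1
      · rintro rfl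
        rw [dist_self] at hzd
        exact hε.1.ne hzd
    have hdc : DiffContOnCl ℂ g (Metric.ball (x : ℂ) ε) := by
      refine DifferentiableOn.diffContOnCl fun z hz => ?_
      rw [closure_ball _ hε.1.ne'] at hz
      have h3 : dist z x < ρ' :=
        (Metric.mem_closedBall.1 hz).trans_lt (hε.2.trans_le (min_le_right _ _))
      exact (hball' h3).differentiableAt.differentiableWithinAt
    rw [hint, hdc.circleIntegral_sub_inv_smul (Metric.mem_ball_self hε.1)] at h0
    rcases smul_eq_zero.1 h0 with h3 | h3
    · exact Complex.two_pi_I_ne_zero h3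
    · exact hgx h3

/-- All real singularities are removable, so `f` agrees off the real axis with an entire function.
That function is bounded, by the maximum principle near the real axis, hence constant and equal to
its limit `0`. -/
theorem eq_zero_of_norm_mul_im_le {f : ℂ → ℂ} {K : ℝ} (hf : ∀ z, MeromorphicAt f z)
    (han : ∀ z : ℂ, z.im ≠ 0 → AnalyticAt ℂ f z)
    (hK : ∀ z : ℂ, z.im ≠ 0 → ‖f z‖ * |z.im| ≤ K * (1 + |z.im|))
    (hres : ∀ x : ℝ, AnalyticAt ℂ f x ∨ ∀ᶠ ε : ℝ in 𝓝[>] 0, (∮ z in C(x, ε), f z) = 0)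
    (hlim : Tendsto f upperInfinity (𝓝 0)) {z : ℂ} (hz : z.im ≠ 0) : f z = 0 := by
  have hK0 : 0 ≤ K := by
    have := hK Complex.I (by simp)
    simp only [Complex.I_im, abs_one] at this
    linarith [norm_nonneg (f Complex.I)]
  have hord : ∀ z, 0 ≤ meromorphicOrderAt f z := by
    intro z
    by_cases h : z.im = 0
    · have e : ((z.re : ℝ) : ℂ) = z := by apply Complex.ext <;> simp [h]
      rw [← e]
      rcases hres z.re with h1 | h1
      · exact h1.meromorphicOrderAt_nonneg
      · exact meromorphicOrderAt_nonneg_of_circleIntegral_eq_zero (hf _) hK h1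
    · exact (han z h).meromorphicOrderAt_nonneg
  have hmer : MeromorphicOn f univ := fun z _ => hf z
  -- Passing to the normal form repairs the arbitrary values of `f` at its removable singularities.
  set F := toMeromorphicNFOn f univ with hF
  have hdiff : Differentiable ℂ F := by
    intro z
    have h1 := meromorphicNFOn_toMeromorphicNFOn f univ (mem_univ z)
    refine (h1.meromorphicOrderAt_nonneg_iff_analyticAt.1 ?_).differentiableAt
    rw [meromorphicOrderAt_toMeromorphicNFOn hmer (mem_univ z)]
    exact hord z
  have heq : ∀ z : ℂ, z.im ≠ 0 → F z = f z := by
    intro z hz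
    rw [hF, toMeromorphicNFOn_eq_toMeromorphicNFAt hmer (mem_univ z),
      toMeromorphicNFAt_eq_self.2 (han z hz).meromorphicNFAt]
  have hbound : ∀ z, ‖F z‖ ≤ 4 * K := by
    intro z
    rcases le_total |z.im| 1 with h1 | h1
    · have h := norm_le_of_norm_mul_im_le (f := F) (x₀ := z.re) (K := 3 * K) (z := z)
        hdiff.differentiableOn ?_ ?_
      · linarith
      · intro w hw
        rcases eq_or_ne w.im 0 with h0 | h0
        · rw [h0, abs_zero, mul_zero]; positivity
        · have h2 := Complex.abs_im_le_norm (w - z.re)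
          rw [mem_closedBall_iff_norm] at hw
          simp only [Complex.sub_im, Complex.ofReal_im, sub_zero] at h2
          rw [heq w h0]
          refine (hK w h0).trans ?_
          nlinarith
      · rw [mem_closedBall_iff_norm]
        have e : z - z.re = (z.im : ℂ) * Complex.I := by
          apply Complex.ext <;> simp
        rw [e, norm_mul, Complex.norm_I, mul_one, Complex.norm_real]
        exact h1
    · have h0 : z.im ≠ 0 := fun h => by rw [h] at h1; simp at h1; linarith
      have h2 := hK z h0
      rw [heq z h0]
      nlinarith [norm_nonneg (f z)]
  have hb : Bornology.IsBounded (range F) := by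
    rw [isBounded_iff_forall_norm_le]
    exact ⟨_, by rintro _ ⟨z, rfl⟩; exact hbound z⟩
  rw [← heq z hz]
  refine tendsto_nhds_unique (f := fun _ : ℂ => F z) (l := upperInfinity) tendsto_const_nhds
    (hlim.congr' ?_)
  filter_upwards [eventually_upperInfinity_im_gt 0] with w hw
  rw [← heq w hw.ne']
  exact hdiff.apply_eq_apply_of_bounded hb w z

theorem eventually_circleIntegrable_weylFunction (q : Potential r) (i j : Fin r) (z₀ : ℂ) :
    ∀ᶠ ε : ℝ in 𝓝[>] 0, CircleIntegrable (fun z => weylFunction q z i j) z₀ ε := by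
  obtain ⟨ρ, hρ, hball⟩ := Metric.mem_nhdsWithin_iff.1 (eventually_det_sMatrix_ne_zero q z₀)
  filter_upwards [Ioo_mem_nhdsGT hρ] with ε hε
  refine ContinuousOn.circleIntegrable hε.1.le fun w hw => ?_
  have hd : dist w z₀ = ε := hw
  have hne : w ≠ z₀ := by
    rintro rfl
    rw [dist_self] at hd
    exact hε.1.ne hd
  exact (differentiableAt_weylFunction q i j
    (hball ⟨show dist w z₀ < ρ from hd ▸ hε.2, hne⟩)).continuousAt.continuousWithinAt

/-- In the difference of two entries the growth bounds add, the limits at `+i∞` cancel, and common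
norming matrices cancel all residues. -/
theorem weylFunction_eq_of_isSpectralData {p q : Potential r}
    {a : ℤ → ℝ × Matrix (Fin r) (Fin r) ℂ} (hp : IsSpectralData p a) (hq : IsSpectralData q a)
    {z : ℂ} (hz : z.im ≠ 0) : weylFunction p z = weylFunction q z := by
  obtain ⟨-, -, -, hpS, hpR⟩ := hp
  obtain ⟨-, -, -, hqS, hqR⟩ := hq
  ext i j
  rw [← sub_eq_zero]
  obtain ⟨K₁, hK₁⟩ := exists_norm_weylFunction_mul_im_le p
  obtain ⟨K₂, hK₂⟩ := exists_norm_weylFunction_mul_im_le q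
  refine eq_zero_of_norm_mul_im_le (f := fun z => weylFunction p z i j - weylFunction q z i j)
    (K := K₁ + K₂)
    (fun z => (meromorphicAt_weylFunction p i j z).sub (meromorphicAt_weylFunction q i j z))
    (fun z hz => (analyticAt_weylFunction p i j (det_sMatrix_ne_zero p hz)).sub
      (analyticAt_weylFunction q i j (det_sMatrix_ne_zero q hz)))
    (fun z hz => ?_) (fun x => ?_) ?_ hz
  · have h1 := hK₁ z i j hz
    have h2 := hK₂ z i j hz
    have h3 := mul_le_mul_of_nonneg_right
      (norm_sub_le (weylFunction p z i j) (weylFunction q z i j)) (abs_nonneg z.im)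
    linarith
  · by_cases hx : IsEigenvalue p x
    · right
      obtain ⟨k, hk⟩ : (x : ℂ) ∈ range fun j : ℤ => (((a j).1 : ℝ) : ℂ) := hpS ▸ hx
      simp only at hk
      have h1 := hpR k
      have h2 := hqR k
      rw [hk] at h1 h2
      filter_upwards [h1, h2, eventually_circleIntegrable_weylFunction p i j x,
        eventually_circleIntegrable_weylFunction q i j x] with ε e1 e2 i1 i2
      rw [circleIntegral.integral_sub i1 i2, sub_eq_zero]
      exact mul_left_cancel₀ (inv_ne_zero Complex.two_pi_I_ne_zero)
        ((e1 i j).trans (e2 i j).symm)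
    · left
      have hx' : ¬ IsEigenvalue q x := fun h =>
        hx (show (x : ℂ) ∈ {z | IsEigenvalue p z} from hpS.trans hqS.symm ▸ h)
      rw [isEigenvalue_iff] at hx hx'
      exact (analyticAt_weylFunction p i j hx).sub (analyticAt_weylFunction q i j hx')
  · have h1 := ((Continuous.matrix_elem continuous_id i j).tendsto _).comp (tendsto_weylFunction p)
    have h2 := ((Continuous.matrix_elem continuous_id i j).tendsto _).comp (tendsto_weylFunction q)
    simpa using h1.sub h2

/-- The spectral data determine the potential. -/
theorem IsSpectralData.potential_eq {p q : Potential r}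
    {a : ℤ → ℝ × Matrix (Fin r) (Fin r) ℂ} (hp : IsSpectralData p a) (hq : IsSpectralData q a) :
    p = q :=
  eq_of_weylFunction_eq fun _ hz => weylFunction_eq_of_isSpectralData hp hq hz

end DiracInverse

end

/-! ### Assembly of the theorem -/

theorem theorem2 (r : ℕ) (hr : 1 ≤ r) :
    (∀ q : DiracInverse.Potential r,
      ∃! a : ℤ → ℝ × Matrix (Fin r) (Fin r) ℂ, DiracInverse.IsSpectralData q a) ∧
    Set.BijOn (fun q : DiracInverse.Potential r => DiracInverse.spectralData q)
      Set.univ (DiracInverse.spectralDataClass r) := by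
  have hspec : ∀ q : DiracInverse.Potential r,
      DiracInverse.IsSpectralData q (DiracInverse.spectralData q) := fun q =>
    Classical.epsilon_spec (DiracInverse.exists_isSpectralData hr q)
  refine ⟨fun q => ⟨_, hspec q, fun a ha => ha.unique (hspec q)⟩, fun q _ => ⟨q, hspec q⟩,
    fun p _ q _ h => (hspec p).potential_eq ?_, ?_⟩
  · have h' : DiracInverse.spectralData p = DiracInverse.spectralData q := h
    rw [h']
    exact hspec q
  -- The class is defined by the relation `IsSpectralData`, so uniqueness is needed to identify `a`
  -- with the chosen sequence of `q`.
  · rintro a ⟨q, hq⟩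
    exact ⟨q, Set.mem_univ q, (hspec q).unique hq⟩
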